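/- Let $\delta>0$. On $\{(r_1,v,l): r_1>0,\ l\ge 0\}$ consider the system $$r_1'=v+2\delta r_1l^3,\qquad v'=-\frac{r_1-1}{r_1^3}-2\delta v l^3,\qquad l'=-\delta l^4,$$ and put $H(r_1,v)=\tfrac12v^2+\frac{(r_1-1)^2}{2r_1^2}$, $q_1=(1,0,0)$ and $\Gamma_1(h)=\{(r_1,v,0): r_1>0,\ H(r_1,v)=h\}$, which for $h\in(0,\tfrac12)$ is a periodic orbit. For $A=\{q_1\}$ or $A=\Gamma_1(h)$ let the global stable manifold $W^s(A)$ be the set of all points of $\{r_1>0,\ l\ge0\}$ whose forward solution exists for all $s\ge 0$ and whose distance to $A$ tends to $0$ as $s\to\infty$. Then: 1. $W^s(q_1)$ is an embedded $C^\infty$ one-dimensional submanifold with boundary of $\mathbb R^3$, with boundary $\{q_1\}$. 2. For every $h\in(0,\tfrac12)$, $W^s(\Gamma_1(h))$ is an embedded $C^\infty$ two-dimensional submanifold with boundary of $\mathbb R^3$, with boundary $\Gamma_1(h)$. 3. $W^s(\Gamma_1(h))$ depends $C^\infty$ on $h\in(0,\tfrac12)$: near every point $(h_0,p_0)$ with $p_0\in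 W^s(\Gamma_1(h_0))$, the sets $W^s(\Gamma_1(h))$ have local parametrizations over relatively open subsets of the half plane $\{x\in\mathbb R^2 : x_1\ge 0\}$ (immersions that are homeomorphisms onto their images, with the points of $\Gamma_1(h)$ corresponding to $x_1=0$) which are jointly $C^\infty$ in $h$ and the parameters $x$, and whose inverses are jointly continuous. 4. Consider the Kepler problem with linear drag $\ddot u+\delta\dot u+u/|u|^3=0$, $u(t)\in\mathbb R^3\setminus\{0\}$, with angular momentum $L=u\wedge\dot u$ and eccentricity vector $\mathcal E=\dot u\wedge L-u/|u|$, and let $\mathcal E_\infty(u_0,\dot u_0)$ be the limit of $\mathcal E$ along the solution with initial state $(u_0,\dot u_0)$ as $t$ tends to its maximal time of existence from below. For every $c\in(0,1)$ the level set $\{(u_0,\dot u_0)\in(\mathbb R^3\setminus\{0\})\times\mathbb R^3 : |\mathcal E_\infty(u_0,\dot u_0)|=c\}$ is an embedded $C^\infty$ submanifold (without boundary) of dimension $5$ of $\mathbb R^6$, and it depends $C^\infty$ on $c\in(0,1)$ in the sense of 3. -/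

import Mathlib

open Set Filter Topology
open scoped ContDiff

namespace KeplerDrag

noncomputable section

/-! ### Smooth submanifolds with boundary and smooth families of them -/

/-- The closed half space `{x | 0 ≤ x 0}` of `ℝᵏ`. -/
def halfSpace (k : ℕ) [NeZero k] : Set (EuclideanSpace ℝ (Fin k)) :=
  {x | 0 ≤ x 0}

/-- `S` is an embedded `C^∞` submanifold with boundary of the normed space `E`, of dimension `k`,
and its boundary is `B`: every point of `S` has an open neighbourhood `U` in `E` such that `S ∩ U`
is parametrized by a relatively open subset `O ∩ halfSpace k` of the half space, through a
`C^∞` immersion `f` (smooth up to the boundary of the half space) which is a homeomorphism onto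
`S ∩ U` (with inverse `g`) and under which the points of `B` correspond to the boundary points of
the half space.
For `B = ∅` these are the usual embedded `C^∞` submanifolds of dimension `k`. -/
structure IsSmoothSubmanifold {E : Type*} [NormedAddCommGroup E] [NormedSpace ℝ E]
    (k : ℕ) [NeZero k] (S B : Set E) : Prop where
  boundary_subset : B ⊆ S
  exists_param : ∀ p ∈ S, ∃ U : Set E, IsOpen U ∧ p ∈ U ∧
    ∃ O : Set (EuclideanSpace ℝ (Fin k)), IsOpen O ∧
    ∃ (f : EuclideanSpace ℝ (Fin k) → E) (g : E → EuclideanSpace ℝ (Fin k)),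
      ContDiffOn ℝ ∞ f (O ∩ halfSpace k) ∧
      f '' (O ∩ halfSpace k) = S ∩ U ∧
      ContinuousOn g (S ∩ U) ∧
      (∀ x ∈ O ∩ halfSpace k, g (f x) = x) ∧
      (∀ x ∈ O ∩ halfSpace k, Function.Injective (fderivWithin ℝ f (O ∩ halfSpace k) x)) ∧
      (∀ x ∈ O ∩ halfSpace k, f x ∈ B ↔ x 0 = 0)

/-- The `k`-dimensional submanifolds `S h` with boundary `B h` depend `C^∞`-smoothly on the
parameter `h ∈ I`: locally near every point of the total set `{(h, p) | h ∈ I, p ∈ S h}` there are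
parametrizations `f (h, ·)` of `S h` as in `IsSmoothSubmanifold` that are jointly `C^∞` in the
parameter `h` and the point of the half space, and whose inverses are jointly continuous. -/
structure IsSmoothFamily {E : Type*} [NormedAddCommGroup E] [NormedSpace ℝ E]
    (k : ℕ) [NeZero k] (I : Set ℝ) (S B : ℝ → Set E) : Prop where
  boundary_subset : ∀ h ∈ I, B h ⊆ S h
  exists_param : ∀ h₀ ∈ I, ∀ p₀ ∈ S h₀, ∃ U : Set (ℝ × E), IsOpen U ∧ (h₀, p₀) ∈ U ∧
    ∃ O : Set (ℝ × EuclideanSpace ℝ (Fin k)), IsOpen O ∧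
    ∃ (f : ℝ × EuclideanSpace ℝ (Fin k) → E) (g : ℝ × E → EuclideanSpace ℝ (Fin k)),
      ContDiffOn ℝ ∞ f (O ∩ univ ×ˢ halfSpace k) ∧
      (fun y : ℝ × EuclideanSpace ℝ (Fin k) => (y.1, f y)) '' (O ∩ univ ×ˢ halfSpace k) =
        {z : ℝ × E | z.1 ∈ I ∧ z.2 ∈ S z.1} ∩ U ∧
      ContinuousOn g ({z : ℝ × E | z.1 ∈ I ∧ z.2 ∈ S z.1} ∩ U) ∧
      (∀ y ∈ O ∩ univ ×ˢ halfSpace k, g (y.1, f y) = y.2) ∧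
      (∀ y ∈ O ∩ univ ×ˢ halfSpace k, Function.Injective
        (fderivWithin ℝ (fun x => f (y.1, x)) {x | (y.1, x) ∈ O ∩ univ ×ˢ halfSpace k} y.2)) ∧
      (∀ y ∈ O ∩ univ ×ˢ halfSpace k, f y ∈ B y.1 ↔ y.2 0 = 0)

/-! ### The desingularized reduced system -/

/-- The phase space `{(r₁, v, l) | r₁ > 0, l ≥ 0}`. -/
def phaseSpace : Set (ℝ × ℝ × ℝ) := {p | 0 < p.1 ∧ 0 ≤ p.2.2}

/-- The vector field
`r₁' = v + 2 δ r₁ l³`, `v' = - (r₁ - 1) / r₁³ - 2 δ v l³`, `l' = - δ l⁴`. -/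
def vectorField (δ : ℝ) (p : ℝ × ℝ × ℝ) : ℝ × ℝ × ℝ :=
  (p.2.1 + 2 * δ * p.1 * p.2.2 ^ 3,
    -(p.1 - 1) / p.1 ^ 3 - 2 * δ * p.2.1 * p.2.2 ^ 3,
    -δ * p.2.2 ^ 4)

/-- The Hamiltonian of the invariant subsystem `l = 0`. -/
def hamiltonian (r₁ v : ℝ) : ℝ := v ^ 2 / 2 + (r₁ - 1) ^ 2 / (2 * r₁ ^ 2)

/-- The equilibrium `q₁`. -/
def q₁ : ℝ × ℝ × ℝ := (1, 0, 0)

/-- The level set `Γ₁(h)` of the Hamiltonian in `{l = 0}`; for `0 < h < 1/2` it is a periodic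
orbit. -/
def Γ₁ (h : ℝ) : Set (ℝ × ℝ × ℝ) :=
  {p | 0 < p.1 ∧ hamiltonian p.1 p.2.1 = h ∧ p.2.2 = 0}

/-- The (global) stable set of `A`: the points of the phase space whose forward orbit is defined
for all times `s ≥ 0` and converges to `A` as `s → ∞`. -/
def stableSet (δ : ℝ) (A : Set (ℝ × ℝ × ℝ)) : Set (ℝ × ℝ × ℝ) :=
  {p | ∃ γ : ℝ → ℝ × ℝ × ℝ, γ 0 = p ∧
    (∀ s ∈ Ici (0 : ℝ), γ s ∈ phaseSpace ∧
      HasDerivWithinAt γ (vectorField δ (γ s)) (Ici 0) s) ∧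
    Tendsto (fun s => Metric.infDist (γ s) A) atTop (𝓝 0)}

/-! ### The Kepler problem with linear drag and the limiting eccentricity vector -/

/-- Euclidean three-space. -/
abbrev E3 : Type := EuclideanSpace ℝ (Fin 3)

/-- The vector product on `ℝ³`. -/
def cross (a b : E3) : E3 := WithLp.toLp 2 (crossProduct (WithLp.ofLp a) (WithLp.ofLp b))

/-- The angular momentum `L(u, w) = u ∧ w`, where `w` is the velocity. -/
def angularMomentum (u w : E3) : E3 := cross u w

/-- The eccentricity vector `𝓔(u, w) = w ∧ L(u, w) - u / |u|`. -/
def eccentricity (u w : E3) : E3 := cross w (angularMomentum u w) - ‖u‖⁻¹ • u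

/-- The time interval `[0, T)`, where `T` may be `∞`. -/
def timeInterval (T : EReal) : Set ℝ := {t | 0 ≤ t ∧ (t : EReal) < T}

/-- `u` with velocity `w` solves `u'' + δ u' + u / |u|³ = 0` on `[0, T)`, without collision. -/
structure IsKeplerSolution (δ : ℝ) (T : EReal) (u w : ℝ → E3) : Prop where
  ne_zero : ∀ t ∈ timeInterval T, u t ≠ 0
  deriv_pos : ∀ t ∈ timeInterval T, HasDerivWithinAt u (w t) (timeInterval T) t
  deriv_vel : ∀ t ∈ timeInterval T,
    HasDerivWithinAt w (-(δ • w t) - (‖u t‖ ^ 3)⁻¹ • u t) (timeInterval T) t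

/-- A forward solution on `[0, T)` that has no extension to a longer interval, so that `T` is the
maximal time of existence. -/
structure IsMaximalKeplerSolution (δ : ℝ) (T : EReal) (u w : ℝ → E3) : Prop where
  pos : 0 < T
  sol : IsKeplerSolution δ T u w
  maximal : ∀ (T' : EReal) (u' w' : ℝ → E3), IsKeplerSolution δ T' u' w' →
    u' 0 = u 0 → w' 0 = w 0 → T' ≤ T

/-- `e` is the limiting eccentricity vector `𝓔_∞(z)` of the state `z = (u₀, w₀)`: the limit of the
eccentricity vector along the solution that starts at `z`, as `t` tends to the maximal time of
existence from below. -/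
def IsLimitingEccentricity (δ : ℝ) (z : E3 × E3) (e : E3) : Prop :=
  ∃ (T : EReal) (u w : ℝ → E3), IsMaximalKeplerSolution δ T u w ∧ u 0 = z.1 ∧ w 0 = z.2 ∧
    Tendsto (fun t => eccentricity (u t) (w t)) (comap ((↑) : ℝ → EReal) (𝓝[<] T)) (𝓝 e)

/-- The level set `{|𝓔_∞| = c}` in the phase space `(ℝ³ ∖ {0}) × ℝ³` of positions and
velocities. -/
def eccentricityLevelSet (δ c : ℝ) : Set (E3 × E3) :=
  {z | z.1 ≠ 0 ∧ ∃ e : E3, IsLimitingEccentricity δ z e ∧ ‖e‖ = c}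

end

end KeplerDrag

open KeplerDrag

/-!
Write `Z = (1/r₁ - 1) - i v` for the eccentricity vector in the frame that rotates with the particle,
so that `|Z|² = 2 H`, and let `θ' = 1/r₁²` be the polar angle. The eccentricity in the fixed frame,
`w = e^{iθ} Z`, is a slow variable: with `θ` as independent variable it satisfies
`dw/dθ = l³ A(θ, w)`, and for frozen `w` the mean of `A` over a period vanishes, because `A` is
then the derivative of an explicit periodic function (`hasDerivAt_averaging_primitive`). Hence in the
variables `w` and `ρ = l³` the period map has the form `(w, ρ) ↦ (w + ρ² a, ρ - ρ² b)` with smooth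
`a`, `b` and `b > 0` (`exists_periodCurves`). All points of `{ρ = 0}` are fixed points, with
derivative the identity, so that the standard invariant manifold theorems do not apply.

For such a parabolic map `exists_parabolic_limit` shows that the orbits with `ρ ≥ 0` converge to
points of `{ρ = 0}`, and that the limit is a smooth function of the initial point, up to `ρ = 0`.
To every order there is a smooth `Φ` with `Φ(w, 0) = w` whose increment along the map is divisible by
a high power of `ρ` (`exists_approx_invariant`), and the limit is `Φ` plus the sum of these increments
along the orbit. Since `ρₙ ≤ 1/(1 + β n)`, while the derivatives of the `n`-th iterate are bounded by
a fixed power of `1/ρₙ` (`ParabolicBox.exists_norm_iteratedFDeriv_iterate_le`), a high enough order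
makes the series converge together with its derivatives up to a prescribed order.

Consequently `w` converges along the trajectories near `{l = 0}`, `|Z| < 1`, and its limit `ω` together
with `l` gives charts `(ω, l)` of the phase space, smooth up to the boundary `l = 0`, in which
`W^s(Γ₁(h))` is the set `|ω|² = 2 h` and `W^s(q₁)` is `ω = 0`. The flow carries such charts from the
boundary to all points of the stable sets (`exists_isLimitChart`). The parametrizations in the
statement about the reduced system are read off from these charts.

For the Kepler problem with drag and nonvanishing angular momentum, `l = |L|` and a change of time
turn trajectories of the reduced system into solutions, which are therefore defined for all positive
times, and the eccentricity vector is the image of `w` in the orbital plane. Hence `|𝓔_∞| = c` means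
that the reduced state lies in `W^s(Γ₁(c²/2))` (`mem_eccentricityLevelSet_iff`). If the angular
momentum vanishes, then `|𝓔| = 1` along the whole solution, so that these states do not contribute
when `c < 1`. Locally `|𝓔_∞|` is thus the function `|ω|` of the reduced state. It is a submersion, and
its level sets form a smooth family of hypersurfaces (`exists_param_levelSet`).
-/

set_option linter.unusedSectionVars false

namespace KeplerDrag

/-! ### The composition operator on spaces of continuous curves -/

section Superposition

universe u

variable {K : Type*} [TopologicalSpace K] [CompactSpace K]

/-- The superposition operator `α ↦ f ∘ α` between spaces of continuous maps on `K`. -/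
noncomputable def superposition (K : Type*) [TopologicalSpace K] {E F : Type*} [TopologicalSpace E]
    [TopologicalSpace F] (f : E → F) (hf : Continuous f) (α : C(K, E)) : C(K, F) :=
  (⟨f, hf⟩ : C(E, F)).comp α

variable {E F : Type u} [NormedAddCommGroup E] [NormedSpace ℝ E]
  [NormedAddCommGroup F] [NormedSpace ℝ F]

/-- Pointwise application `(A, β) ↦ (t ↦ A t (β t))` as a continuous bilinear map. -/
noncomputable def pointwiseApply (K : Type*) [TopologicalSpace K] [CompactSpace K]
    (E F : Type*) [NormedAddCommGroup E] [NormedSpace ℝ E]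
    [NormedAddCommGroup F] [NormedSpace ℝ F] :
    C(K, E →L[ℝ] F) →L[ℝ] C(K, E) →L[ℝ] C(K, F) :=
  LinearMap.mkContinuous₂
    (LinearMap.mk₂ ℝ (fun (A : C(K, E →L[ℝ] F)) (β : C(K, E)) => (⟨fun t => A t (β t), by fun_prop⟩ : C(K, F)))
      (fun _ _ _ => by ext; simp) (fun _ _ _ => by ext; simp)
      (fun _ _ _ => by ext; simp) (fun _ _ _ => by ext; simp)) 1
    (fun A β => by
      rw [ContinuousMap.norm_le _ (by simp only [one_mul]; positivity)]
      intro t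
      refine ((A t).le_opNorm (β t)).trans ?_
      rw [one_mul]
      exact mul_le_mul (A.norm_coe_le_norm t) (β.norm_coe_le_norm t) (norm_nonneg _)
        (norm_nonneg A))

lemma continuous_superposition {f : E → F} (hf : Continuous f) :
    Continuous (superposition K f hf) :=
  ContinuousMap.continuous_postcomp _

/-- The derivative of the superposition operator at `α` is pointwise multiplication by `f' ∘ α`. -/
lemma hasFDerivAt_superposition {f : E → F} (hf : Differentiable ℝ f)
    (hf' : Continuous (fderiv ℝ f)) (α : C(K, E)) :
    HasFDerivAt (superposition K f hf.continuous)
      (pointwiseApply K E F (superposition K (fderiv ℝ f) hf' α)) α := by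
  rw [hasFDerivAt_iff_isLittleO, Asymptotics.isLittleO_iff]
  intro ε hε
  obtain ⟨d, hd, hcont⟩ := Metric.continuous_iff.1 (continuous_superposition (K := K) hf') α ε hε
  filter_upwards [Metric.ball_mem_nhds α hd] with γ hγ
  rw [ContinuousMap.norm_le _ (by positivity)]
  intro t
  have hball : ∀ z ∈ Metric.ball (α t) d, ‖fderiv ℝ f z - fderiv ℝ f (α t)‖ ≤ ε := by
    intro z hz
    have h1 : dist (α + ContinuousMap.const K (z - α t)) α < d := by
      rw [dist_eq_norm, add_sub_cancel_left]
      refine lt_of_le_of_lt ((ContinuousMap.norm_le _ (norm_nonneg (z - α t))).2 ?_)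
        (mem_ball_iff_norm.1 hz)
      intro s; simp
    have h2 := (hcont _ h1).le
    rw [dist_eq_norm] at h2
    have h3 := (ContinuousMap.norm_coe_le_norm _ t).trans h2
    simpa [superposition] using h3
  have hγt : γ t ∈ Metric.ball (α t) d :=
    lt_of_le_of_lt (ContinuousMap.dist_apply_le_dist t) hγ
  have h := (convex_ball (α t) d).norm_image_sub_le_of_norm_hasFDerivWithin_le'
    (fun z _ => (hf z).hasFDerivAt.hasFDerivWithinAt) hball (Metric.mem_ball_self hd) hγt
  exact h.trans (mul_le_mul_of_nonneg_left ((γ - α).norm_coe_le_norm t) hε.le)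

/-- The target is quantified inside the induction, which passes from `f` to its derivative. -/
lemma contDiff_superposition_nat (n : ℕ) :
    ∀ {F : Type u} [NormedAddCommGroup F] [NormedSpace ℝ F] {f : E → F} (hf : ContDiff ℝ n f),
      ContDiff ℝ n (superposition K f hf.continuous) := by
  induction n with
  | zero =>
    intro F _ _ f hf
    exact contDiff_zero.2 (continuous_superposition hf.continuous)
  | succ n ih =>
    intro F _ _ f hf
    have hd : Differentiable ℝ f := hf.differentiable (by simp)
    have hc : ContDiff ℝ n (fderiv ℝ f) := hf.fderiv_right (by simp)
    have hder := hasFDerivAt_superposition (K := K) hd hc.continuous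
    refine contDiff_succ_iff_fderiv.2 ⟨fun α => (hder α).differentiableAt,
      fun h => absurd h (WithTop.coe_ne_top (a := (n : ℕ∞))), ?_⟩
    have : fderiv ℝ (superposition K f hf.continuous) =
        fun α => pointwiseApply K E F (superposition K (fderiv ℝ f) hc.continuous α) :=
      funext fun α => (hder α).fderiv
    rw [this]
    exact (pointwiseApply K E F).contDiff.comp (ih hc)

/-- Composition with a smooth map is a smooth operator on continuous curves. -/
lemma contDiff_superposition {f : E → F} (hf : ContDiff ℝ ∞ f) :
    ContDiff ℝ ∞ (superposition K f hf.continuous) :=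
  contDiff_infty.2 fun n => contDiff_superposition_nat n (contDiff_infty.1 hf n)

end Superposition

/-! ### Integration of continuous curves and parametric integrals -/

section Integration

variable {X : Type} [NormedAddCommGroup X] [NormedSpace ℝ X]

/-- The primitive `t ↦ ∫₀ᵗ α` of a continuous curve on `[0, 1]`, as a continuous linear map. -/
noncomputable def primitive (X : Type) [NormedAddCommGroup X] [NormedSpace ℝ X] :
    C(unitInterval, X) →L[ℝ] C(unitInterval, X) :=
  LinearMap.mkContinuous
    { toFun := fun α => ⟨fun t => ∫ s in (0 : ℝ)..t, α (projIcc 0 1 zero_le_one s), by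
        have h : Continuous fun s : ℝ => α (projIcc 0 1 zero_le_one s) :=
          α.continuous.comp continuous_projIcc
        exact (intervalIntegral.continuous_primitive (fun a b => h.intervalIntegrable a b) 0).comp
          continuous_subtype_val⟩
      map_add' := fun α β => by
        ext t
        have h : ∀ γ : C(unitInterval, X), Continuous fun s : ℝ => γ (projIcc 0 1 zero_le_one s) :=
          fun γ => γ.continuous.comp continuous_projIcc
        simpa using intervalIntegral.integral_add ((h α).intervalIntegrable 0 t)
          ((h β).intervalIntegrable 0 t)
      map_smul' := fun c α => by
        ext t
        simp } 1
    (fun α => by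
      rw [ContinuousMap.norm_le _ (by positivity)]
      intro t
      have h := intervalIntegral.norm_integral_le_of_norm_le_const (a := (0 : ℝ)) (b := t)
        (f := fun s : ℝ => α (projIcc 0 1 zero_le_one s)) (C := ‖α‖)
        (fun s _ => α.norm_coe_le_norm _)
      refine h.trans ?_
      have := t.2.1
      have := t.2.2
      rw [sub_zero, abs_of_nonneg t.2.1]
      nlinarith [norm_nonneg α])

lemma primitive_apply (α : C(unitInterval, X)) (t : unitInterval) :
    primitive X α t = ∫ s in (0 : ℝ)..t, α (projIcc 0 1 zero_le_one s) := rfl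

/-- A continuous solution of the integral equation `α = x + c ∫ β` is differentiable, with derivative
`c β`. -/
lemma hasDerivWithinAt_of_eq_primitive [CompleteSpace X] {α β : C(unitInterval, X)} {x : X} {c : ℝ}
    (h : ∀ t, α t = x + c • primitive X β t) {t : ℝ} (ht : t ∈ Icc (0 : ℝ) 1) :
    HasDerivWithinAt (fun s => α (projIcc 0 1 zero_le_one s))
      (c • β (projIcc 0 1 zero_le_one t)) (Icc 0 1) t := by
  have hc : Continuous fun s : ℝ => β (projIcc 0 1 zero_le_one s) :=
    β.continuous.comp continuous_projIcc
  have h1 : HasDerivAt (fun t : ℝ => ∫ s in (0 : ℝ)..t, β (projIcc 0 1 zero_le_one s))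
      (β (projIcc 0 1 zero_le_one t)) t :=
    intervalIntegral.integral_hasDerivAt_right (hc.intervalIntegrable _ _)
      (hc.stronglyMeasurableAtFilter _ _) hc.continuousAt
  refine (((h1.const_smul c).const_add x).hasDerivWithinAt).congr (fun s hs => ?_) ?_
  · rw [h, primitive_apply, projIcc_of_mem _ hs]; rfl
  · rw [h, primitive_apply, projIcc_of_mem _ ht]; rfl

end Integration

section Parametric

variable {X Y : Type} [NormedAddCommGroup X] [NormedSpace ℝ X]
  [NormedAddCommGroup Y] [NormedSpace ℝ Y]

/-- The identity curve on `[0, 1]`. -/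
noncomputable def idCurve : C(unitInterval, ℝ) := ⟨Subtype.val, continuous_subtype_val⟩

/-- The time-dependent superposition operator `α ↦ (t ↦ g (t, α t))`. -/
noncomputable def timeSuperposition (g : ℝ × X → Y) (hg : Continuous g) (α : C(unitInterval, X)) :
    C(unitInterval, Y) :=
  superposition unitInterval g hg (idCurve.prodMk α)

@[simp] lemma timeSuperposition_apply (g : ℝ × X → Y) (hg : Continuous g) (α : C(unitInterval, X))
    (t : unitInterval) : timeSuperposition g hg α t = g (t, α t) := rfl

lemma contDiff_timeSuperposition {g : ℝ × X → Y} (hg : ContDiff ℝ ∞ g) :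
    ContDiff ℝ ∞ (timeSuperposition g hg.continuous) := by
  have h : ContDiff ℝ ∞ fun α : C(unitInterval, X) => (idCurve.prodMk α : C(unitInterval, ℝ × X)) := by
    have : (fun α : C(unitInterval, X) => (idCurve.prodMk α : C(unitInterval, ℝ × X))) =
        fun α => idCurve.prodMk (0 : C(unitInterval, X)) +
          (ContinuousLinearMap.inr ℝ ℝ X).compLeftContinuous ℝ unitInterval α := by
      funext α; ext t <;> simp
    rw [this]
    exact contDiff_const.add (ContinuousLinearMap.contDiff _)
  exact (contDiff_superposition hg).comp h

end Parametric

/-! ### Inverse functions and a regular perturbation theorem -/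

section Inverse

/-- The inverse function theorem for a map that is `C^n` on an open set: all the regularity holds on
a neighbourhood, also for `n = ∞`. -/
lemma exists_openPartialHomeomorph_contDiffOn {E F : Type*} [NormedAddCommGroup E]
    [NormedSpace ℝ E] [CompleteSpace E] [NormedAddCommGroup F] [NormedSpace ℝ F] {n : WithTop ℕ∞}
    (hn : 1 ≤ n) {f : E → F} {U : Set E} (hU : IsOpen U) (hf : ContDiffOn ℝ n f U) {a : E}
    (ha : a ∈ U) {f' : E ≃L[ℝ] F} (hf' : HasFDerivAt f (f' : E →L[ℝ] F) a) :
    ∃ e : OpenPartialHomeomorph E F, a ∈ e.source ∧ e.source ⊆ U ∧ (∀ x, e x = f x) ∧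
      ContDiffOn ℝ n e.symm e.target ∧
      ∀ x ∈ e.source, ∃ g' : E ≃L[ℝ] F, HasFDerivAt f (g' : E →L[ℝ] F) x := by
  have hn0 : n ≠ 0 := fun h => by simp [h] at hn
  have hat : ContDiffAt ℝ n f a := hf.contDiffAt (hU.mem_nhds ha)
  have hcont : ContinuousOn (fderiv ℝ f) U := hf.continuousOn_fderiv_of_isOpen hU hn
  have hV : ∃ V ⊆ U, IsOpen V ∧ a ∈ V ∧ ∀ x ∈ V, fderiv ℝ f x ∈ range ((↑) : (E ≃L[ℝ] F) → _) := by
    have h1 : ∀ᶠ x in 𝓝 a, fderiv ℝ f x ∈ range ((↑) : (E ≃L[ℝ] F) → E →L[ℝ] F) := by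
      have h2 := (hcont.continuousAt (hU.mem_nhds ha)).tendsto
      rw [hf'.fderiv] at h2
      exact h2 (ContinuousLinearEquiv.nhds f')
    obtain ⟨V, hV, hVo, haV⟩ := eventually_nhds_iff.1 (h1.and (hU.mem_nhds ha))
    exact ⟨V, fun x hx => (hV x hx).2, hVo, haV, fun x hx => (hV x hx).1⟩
  obtain ⟨V, hVU, hVo, haV, hVr⟩ := hV
  let e := (hat.toOpenPartialHomeomorph f hf' hn0).restrOpen V hVo
  have hsrc : e.source ⊆ V := by
    intro x hx
    simp only [e, OpenPartialHomeomorph.restrOpen_source] at hx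
    exact hx.2
  have hder : ∀ x ∈ V, ∃ g' : E ≃L[ℝ] F, HasFDerivAt f (g' : E →L[ℝ] F) x := by
    intro x hx
    obtain ⟨g', hg'⟩ := hVr x hx
    refine ⟨g', ?_⟩
    rw [hg']
    exact ((hf.contDiffAt (hU.mem_nhds (hVU hx))).differentiableAt hn0).hasFDerivAt
  refine ⟨e, ?_, hsrc.trans hVU, fun x => rfl, ?_, fun x hx => hder x (hsrc hx)⟩
  · simp only [e, OpenPartialHomeomorph.restrOpen_source]
    exact ⟨hat.mem_toOpenPartialHomeomorph_source hf' hn0, haV⟩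
  · intro y hy
    have hx := e.map_target hy
    obtain ⟨g', hg'⟩ := hder _ (hsrc hx)
    exact (e.contDiffAt_symm hy hg'
      (hf.contDiffAt (hU.mem_nhds (hVU (hsrc hx))))).contDiffWithinAt

variable {X : Type} [NormedAddCommGroup X] [NormedSpace ℝ X]

/-- Constant curves, as a continuous linear map. -/
noncomputable def constCurve (X : Type) [NormedAddCommGroup X] [NormedSpace ℝ X] :
    X →L[ℝ] C(unitInterval, X) :=
  LinearMap.mkContinuous
    { toFun := fun x => ContinuousMap.const unitInterval x
      map_add' := fun x y => by ext; simp
      map_smul' := fun c x => by ext; simp } 1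
    (fun x => by
      rw [ContinuousMap.norm_le _ (by positivity)]
      intro t
      simp)

@[simp] lemma constCurve_apply (x : X) (t : unitInterval) : constCurve X x t = x := rfl

/-- Regular perturbation theory: the solution of `α' = c g(t, α)`, `α(0) = x`, on `[0, 1]` depends
smoothly on `(x, c)` near `c = 0`, as an element of the space of continuous curves. -/
theorem exists_contDiffOn_perturbation [CompleteSpace X] {g : ℝ × X → X} (hg : ContDiff ℝ ∞ g)
    (x₀ : X) :
    ∃ V : Set (X × ℝ), IsOpen V ∧ (x₀, 0) ∈ V ∧ ∃ α : X × ℝ → C(unitInterval, X),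
      ContDiffOn ℝ ∞ α V ∧ ∀ z ∈ V, ∀ t, α z t =
        z.1 + z.2 • primitive X (timeSuperposition g hg.continuous (α z)) t := by
  let Y := C(unitInterval, X)
  -- the equation is `Θ (α, x, c) = (0, x, c)`, and `Θ` is a local diffeomorphism where `c = 0`
  let Λ : Y → Y := fun α => primitive X (timeSuperposition g hg.continuous α)
  have hΛ : ContDiff ℝ ∞ Λ := (primitive X).contDiff.comp (contDiff_timeSuperposition hg)
  let Θ : Y × X × ℝ → Y × X × ℝ := fun p => (p.1 - constCurve X p.2.1 - p.2.2 • Λ p.1, p.2)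
  have hΘ : ContDiff ℝ ∞ Θ := by
    refine ContDiff.prodMk ?_ contDiff_snd
    refine (contDiff_fst.sub ((constCurve X).contDiff.comp (contDiff_fst.comp contDiff_snd))).sub ?_
    exact (contDiff_snd.comp contDiff_snd).smul (hΛ.comp contDiff_fst)
  let a : Y × X × ℝ := (constCurve X x₀, x₀, 0)
  let v : Y := Λ (constCurve X x₀)
  let q₁ : Y × X × ℝ →L[ℝ] Y := ContinuousLinearMap.fst ℝ Y (X × ℝ)
  let q₂ : Y × X × ℝ →L[ℝ] X × ℝ := ContinuousLinearMap.snd ℝ Y (X × ℝ)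
  let T : X × ℝ →L[ℝ] Y := (constCurve X).comp (ContinuousLinearMap.fst ℝ X ℝ) +
    (ContinuousLinearMap.snd ℝ X ℝ).smulRight v
  let A : Y × X × ℝ →L[ℝ] Y × X × ℝ := (q₁ - T.comp q₂).prod q₂
  let B : Y × X × ℝ →L[ℝ] Y × X × ℝ := (q₁ + T.comp q₂).prod q₂
  let A' : (Y × X × ℝ) ≃L[ℝ] Y × X × ℝ := ContinuousLinearEquiv.equivOfInverse A B
    (fun p => by simp [A, B, q₁, q₂]) (fun p => by simp [A, B, q₁, q₂])
  have hA : HasFDerivAt Θ (A' : (Y × X × ℝ) →L[ℝ] Y × X × ℝ) a := by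
    have h1 : HasFDerivAt (fun p : Y × X × ℝ => p.2.2 • Λ p.1)
        (((ContinuousLinearMap.snd ℝ X ℝ).smulRight v).comp q₂) a := by
      have h2 : HasFDerivAt (fun p : Y × X × ℝ => p.2.2) ((ContinuousLinearMap.snd ℝ X ℝ).comp q₂) a :=
        ((ContinuousLinearMap.snd ℝ X ℝ).comp q₂).hasFDerivAt
      have h3 : HasFDerivAt (fun p : Y × X × ℝ => Λ p.1) ((fderiv ℝ Λ a.1).comp q₁) a :=
        ((hΛ.differentiable (by simp)) a.1).hasFDerivAt.comp a q₁.hasFDerivAt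
      refine (h2.smul h3).congr_fderiv ?_
      ext p <;> simp [a, v]
    have h4 : HasFDerivAt (fun p : Y × X × ℝ => p.1 - constCurve X p.2.1)
        (q₁ - ((constCurve X).comp (ContinuousLinearMap.fst ℝ X ℝ)).comp q₂) a :=
      (q₁ - ((constCurve X).comp (ContinuousLinearMap.fst ℝ X ℝ)).comp q₂).hasFDerivAt
    have h5 := (h4.sub h1).prodMk (f₂ := fun p : Y × X × ℝ => p.2) q₂.hasFDerivAt
    refine h5.congr_fderiv ?_
    have : q₁ - ((constCurve X).comp (ContinuousLinearMap.fst ℝ X ℝ)).comp q₂ -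
        ((ContinuousLinearMap.snd ℝ X ℝ).smulRight v).comp q₂ = q₁ - T.comp q₂ := by
      simp only [T, ContinuousLinearMap.add_comp]
      abel
    rw [this]
    rfl
  obtain ⟨e, hae, -, he, hes, -⟩ := exists_openPartialHomeomorph_contDiffOn (n := ∞)
    (by exact_mod_cast le_top) isOpen_univ hΘ.contDiffOn (mem_univ a) hA
  let j : X × ℝ → Y × X × ℝ := fun z => (0, z)
  have hj : ContDiff ℝ ∞ j := contDiff_const.prodMk contDiff_id
  refine ⟨j ⁻¹' e.target, e.open_target.preimage hj.continuous, ?_,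
    fun z => (e.symm (j z)).1, ?_, ?_⟩
  · have : e a = j (x₀, 0) := by simp [he, Θ, a, j]
    rw [mem_preimage, ← this]
    exact e.map_source hae
  · exact contDiff_fst.comp_contDiffOn (hes.comp hj.contDiffOn fun z hz => hz)
  · intro z hz t
    have h1 : Θ (e.symm (j z)) = j z := by rw [← he, e.right_inv hz]
    have h2 : (e.symm (j z)).2 = z := congrArg Prod.snd h1
    have h3 := congrArg Prod.fst h1
    simp only [Θ, j, h2] at h3
    rw [sub_sub, sub_eq_zero] at h3
    have h4 := congrArg (fun α : Y => α t) h3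
    exact h4

end Inverse

/-! ### Division by a coordinate, and extension of locally defined smooth maps -/

section Hadamard

variable {X Y : Type} [NormedAddCommGroup X] [NormedSpace ℝ X]
  [NormedAddCommGroup Y] [NormedSpace ℝ Y] [CompleteSpace Y]

/-- Integration over `[0, 1]` of a smooth function along the segments `t ↦ (x, t c)`. -/
lemma contDiff_integral_segment {G : X × ℝ → Y} (hG : ContDiff ℝ ∞ G) :
    ContDiff ℝ ∞ fun z : X × ℝ => ∫ t in (0 : ℝ)..1, G (z.1, t * z.2) := by
  have hG' : ContDiff ℝ ∞ fun y : ℝ × X × ℝ => G (y.2.1, y.1 * y.2.2) := by fun_prop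
  have h : ContDiff ℝ ∞ fun z : X × ℝ =>
      primitive Y (timeSuperposition _ hG'.continuous (constCurve _ z)) 1 :=
    (ContinuousMap.evalCLM ℝ (1 : unitInterval)).contDiff.comp
      ((primitive Y).contDiff.comp ((contDiff_timeSuperposition hG').comp (constCurve _).contDiff))
  convert h using 2 with z
  rw [primitive_apply]
  refine intervalIntegral.integral_congr fun t ht => ?_
  rw [uIcc_of_le zero_le_one] at ht
  simp [projIcc_of_mem _ ht]

/-- Hadamard's lemma: a smooth function that vanishes on `{c = 0}` is divisible by `c`. -/
lemma exists_contDiff_eq_smul {G : X × ℝ → Y} (hG : ContDiff ℝ ∞ G) (h0 : ∀ x, G (x, 0) = 0) :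
    ∃ h : X × ℝ → Y, ContDiff ℝ ∞ h ∧ ∀ z, G z = z.2 • h z := by
  let G' : X × ℝ → Y := fun z => fderiv ℝ G z (0, 1)
  have hG' : ContDiff ℝ ∞ G' := (hG.fderiv_right (by simp)).clm_apply contDiff_const
  refine ⟨_, contDiff_integral_segment hG', fun z => ?_⟩
  have hd : ∀ t : ℝ, HasDerivAt (fun t : ℝ => G (z.1, t * z.2)) (z.2 • G' (z.1, t * z.2)) t := by
    intro t
    have h1 : HasDerivAt (fun t : ℝ => (z.1, t * z.2)) ((0 : X), z.2) t := by
      simpa using (hasDerivAt_const t z.1).prodMk ((hasDerivAt_id t).mul_const z.2)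
    have h2 := ((hG.differentiable (by simp)) (z.1, t * z.2)).hasFDerivAt.comp_hasDerivAt t h1
    refine h2.congr_deriv ?_
    have : ((0 : X), z.2) = z.2 • ((0 : X), (1 : ℝ)) := by simp
    rw [this, map_smul]
  have hc : Continuous fun t : ℝ => z.2 • G' (z.1, t * z.2) := by
    have := hG'.continuous
    fun_prop
  have := intervalIntegral.integral_eq_sub_of_hasDerivAt (a := 0) (b := 1) (fun t _ => hd t)
    (hc.intervalIntegrable _ _)
  simp only [one_mul, zero_mul, h0, sub_zero] at this
  rw [← this, intervalIntegral.integral_smul]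

/-- A smooth function near a point of a finite-dimensional space is, near that point, the
restriction of a globally defined smooth function, which keeps a convex constraint that holds for
the values of the function and for a given default value. The extension interpolates between the
function and the default value. -/
lemma exists_contDiff_extension {E : Type} [NormedAddCommGroup E] [NormedSpace ℝ E]
    [FiniteDimensional ℝ E] {f : E → Y} {U : Set E} (hU : IsOpen U) (hf : ContDiffOn ℝ ∞ f U)
    {x₀ : E} (hx₀ : x₀ ∈ U) (y₀ : Y) {S : Set Y} (hS : Convex ℝ S) (hy₀ : y₀ ∈ S)
    (hfS : ∀ x ∈ U, f x ∈ S) :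
    ∃ F : E → Y, ContDiff ℝ ∞ F ∧ (∀ᶠ x in 𝓝 x₀, F x = f x) ∧ (∀ x, F x ∈ S) ∧
      ∀ x, F x = y₀ ∨ ∃ c : ℝ, x ∈ U ∧ F x = c • f x + (1 - c) • y₀ := by
  obtain ⟨r, hr, hrU⟩ := Metric.nhds_basis_closedBall.mem_iff.1 (hU.mem_nhds hx₀)
  let χ : ContDiffBump x₀ := ⟨r / 2, r, by positivity, by linarith⟩
  have hsupp : ∀ x, x ∉ U → x ∉ tsupport χ := fun x hx h => by
    rw [χ.tsupport_eq] at h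
    exact hx (hrU h)
  refine ⟨fun x => χ x • f x + (1 - χ x) • y₀, ?_, ?_, fun x => ?_, fun x => ?_⟩
  · refine contDiff_iff_contDiffAt.2 fun x => ?_
    by_cases hx : x ∈ U
    · have := hf.contDiffAt (hU.mem_nhds hx)
      have h2 : ContDiffAt ℝ ∞ χ x := χ.contDiffAt
      exact (h2.smul this).add ((contDiffAt_const.sub h2).smul contDiffAt_const)
    · have h1 : χ =ᶠ[𝓝 x] 0 := notMem_tsupport_iff_eventuallyEq.1 (hsupp x hx)
      refine contDiffAt_const (c := y₀) |>.congr_of_eventuallyEq ?_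
      filter_upwards [h1] with y hy
      simp [hy]
  · filter_upwards [χ.eventuallyEq_one] with x hx
    simp [hx]
  · by_cases hx : x ∈ U
    · exact hS (hfS x hx) hy₀ χ.nonneg (by linarith [χ.le_one (x := x)]) (by ring)
    · have : χ x = 0 := image_eq_zero_of_notMem_tsupport (hsupp x hx)
      simpa [this] using hy₀
  · by_cases hx : x ∈ U
    · exact Or.inr ⟨χ x, hx, rfl⟩
    · have : χ x = 0 := image_eq_zero_of_notMem_tsupport (hsupp x hx)
      left; simp [this]

end Hadamard

/-! ### Two lemmas on `C^k` functions: series, and extension by zero -/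

section CkLemmas

/-- Termwise differentiation of a series of smooth functions on an open connected set. -/
lemma contDiffOn_tsum_of_isPreconnected {E : Type} [NormedAddCommGroup E] [NormedSpace ℝ E]
    {s : Set E} (hs : IsOpen s) (hs' : IsPreconnected s) {u : ℕ → ℝ} (hu : Summable u) (k : ℕ) :
    ∀ {F : Type} [NormedAddCommGroup F] [NormedSpace ℝ F] [CompleteSpace F] {f : ℕ → E → F},
      (∀ n, ContDiff ℝ ∞ (f n)) →
      (∀ j ≤ k, ∃ C, ∀ n, ∀ x ∈ s, ‖iteratedFDeriv ℝ j (f n) x‖ ≤ C * u n) →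
      ContDiffOn ℝ k (fun x => ∑' n, f n x) s ∧
      ∀ j ≤ k, ∀ x ∈ s, ‖iteratedFDeriv ℝ j (fun x => ∑' n, f n x) x‖ ≤
        ∑' n, ‖iteratedFDeriv ℝ j (f n) x‖ := by
  have hzero : ∀ {F : Type} [NormedAddCommGroup F] [NormedSpace ℝ F] {f : ℕ → E → F},
      (∃ C, ∀ n, ∀ x ∈ s, ‖iteratedFDeriv ℝ 0 (f n) x‖ ≤ C * u n) →
      ∃ v : ℕ → ℝ, Summable v ∧ ∀ n, ∀ x ∈ s, ‖f n x‖ ≤ v n := by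
    rintro F _ _ f ⟨C, hC⟩
    exact ⟨fun n => C * u n, hu.mul_left C, fun n x hx => by simpa using hC n x hx⟩
  induction k with
  | zero =>
    intro F _ _ _ f hf hb
    obtain ⟨v, hv, hfv⟩ := hzero (hb 0 le_rfl)
    refine ⟨?_, fun j hj x hx => ?_⟩
    · rw [Nat.cast_zero, contDiffOn_zero]
      exact continuousOn_tsum (fun n => (hf n).continuous.continuousOn) hv hfv
    · obtain rfl : j = 0 := by omega
      simp only [norm_iteratedFDeriv_zero]
      exact norm_tsum_le_tsum_norm (Summable.of_nonneg_of_le (fun _ => norm_nonneg _)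
        (fun n => hfv n x hx) hv)
  | succ k ih =>
    intro F _ _ _ f hf hb
    obtain ⟨v, hv, hfv⟩ := hzero (hb 0 (by omega))
    have hf' : ∀ n, ContDiff ℝ ∞ (fderiv ℝ (f n)) := fun n => (hf n).fderiv_right (by simp)
    have hb' : ∀ j ≤ k, ∃ C, ∀ n, ∀ x ∈ s, ‖iteratedFDeriv ℝ j (fderiv ℝ (f n)) x‖ ≤ C * u n := by
      intro j hj
      obtain ⟨C, hC⟩ := hb (j + 1) (by omega)
      exact ⟨C, fun n x hx => by rw [norm_iteratedFDeriv_fderiv]; exact hC n x hx⟩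
    obtain ⟨v', hv', hfv'⟩ := hzero (hb' 0 (by omega))
    have hder : ∀ x ∈ s, HasFDerivAt (fun x => ∑' n, f n x) (∑' n, fderiv ℝ (f n) x) x := by
      intro x hx
      refine hasFDerivAt_tsum_of_isPreconnected hv' hs hs'
        (fun n y _ => ((hf n).differentiable (by simp) y).hasFDerivAt) hfv' hx ?_ hx
      exact Summable.of_norm_bounded hv fun n => hfv n x hx
    obtain ⟨h1, h2⟩ := ih hf' hb'
    refine ⟨?_, fun j hj x hx => ?_⟩
    · refine (contDiffOn_succ_iff_fderiv_of_isOpen hs).2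
        ⟨fun x hx => (hder x hx).differentiableAt.differentiableWithinAt,
          fun h => absurd h (WithTop.coe_ne_top (a := (k : ℕ∞))), ?_⟩
      exact h1.congr fun x hx => (hder x hx).fderiv
    · cases j with
      | zero =>
        simp only [norm_iteratedFDeriv_zero]
        exact norm_tsum_le_tsum_norm (Summable.of_nonneg_of_le (fun _ => norm_nonneg _)
          (fun n => hfv n x hx) hv)
      | succ j =>
        have h3 : fderiv ℝ (fun x => ∑' n, f n x) =ᶠ[𝓝 x] fun x => ∑' n, fderiv ℝ (f n) x := by
          filter_upwards [hs.mem_nhds hx] with y hy using (hder y hy).fderiv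
        rw [← norm_iteratedFDeriv_fderiv, (h3.iteratedFDeriv ℝ j).eq_of_nhds]
        refine (h2 j (by omega) x hx).trans (le_of_eq ?_)
        simp only [norm_iteratedFDeriv_fderiv]

/-- A `C^k` function on the upper half of an open set whose derivatives are bounded by `c ^ 2`
extends by zero to a `C^k` function. -/
lemma contDiffOn_extend_zero {X : Type} [NormedAddCommGroup X] [NormedSpace ℝ X]
    {O : Set (X × ℝ)} (hO : IsOpen O) (k : ℕ) :
    ∀ {F : Type} [NormedAddCommGroup F] [NormedSpace ℝ F] {f : X × ℝ → F},
      ContDiffOn ℝ k f (O ∩ {z | 0 < z.2}) →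
      (∀ j ≤ k, ∃ C, ∀ z ∈ O, 0 < z.2 → ‖iteratedFDeriv ℝ j f z‖ ≤ C * z.2 ^ 2) →
      ContDiffOn ℝ k (fun z => if 0 < z.2 then f z else 0) O := by
  have hpos : IsOpen {z : X × ℝ | 0 < z.2} := isOpen_lt continuous_const continuous_snd
  have hneg : IsOpen {z : X × ℝ | z.2 < 0} := isOpen_lt continuous_snd continuous_const
  have evpos : ∀ {F : Type} [NormedAddCommGroup F] (f : X × ℝ → F) (z : X × ℝ), 0 < z.2 →
      (fun z => if 0 < z.2 then f z else 0) =ᶠ[𝓝 z] f := by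
    intro F _ f z hz
    filter_upwards [hpos.mem_nhds hz] with y hy
    exact if_pos hy
  have evneg : ∀ {F : Type} [NormedAddCommGroup F] (f : X × ℝ → F) (z : X × ℝ), z.2 < 0 →
      (fun z => if 0 < z.2 then f z else 0) =ᶠ[𝓝 z] fun _ => 0 := by
    intro F _ f z hz
    filter_upwards [hneg.mem_nhds hz] with y hy
    exact if_neg (not_lt.2 (le_of_lt hy))
  -- the extension vanishes to second order along `{c = 0}`
  have hder0 : ∀ {F : Type} [NormedAddCommGroup F] [NormedSpace ℝ F] (f : X × ℝ → F) (z : X × ℝ),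
      z ∈ O → z.2 = 0 → (∃ C, ∀ z ∈ O, 0 < z.2 → ‖iteratedFDeriv ℝ 0 f z‖ ≤ C * z.2 ^ 2) →
      HasFDerivAt (fun z => if 0 < z.2 then f z else 0) (0 : X × ℝ →L[ℝ] F) z := by
    rintro F _ _ f z hz hz0 ⟨C, hC⟩
    have h1 : (fun z => if 0 < z.2 then f z else 0) =O[𝓝 z] fun y => ‖y - z‖ ^ 2 := by
      refine Asymptotics.IsBigO.of_bound |C| ?_
      filter_upwards [hO.mem_nhds hz] with y hy
      by_cases h : 0 < y.2
      · rw [if_pos h]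
        have h2 := hC y hy h
        rw [norm_iteratedFDeriv_zero] at h2
        have h3 : |y.2| ≤ ‖y - z‖ := by
          have := norm_snd_le (y - z)
          simpa [hz0] using this
        rw [Real.norm_of_nonneg (by positivity)]
        calc ‖f y‖ ≤ C * y.2 ^ 2 := h2
          _ ≤ |C| * y.2 ^ 2 := by gcongr; exact le_abs_self C
          _ = |C| * |y.2| ^ 2 := by rw [sq_abs]
          _ ≤ |C| * ‖y - z‖ ^ 2 := by gcongr
      · rw [if_neg h, norm_zero]; positivity
    exact h1.hasFDerivAt (by norm_num)
  induction k with
  | zero =>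
    intro F _ _ f hf hb
    rw [Nat.cast_zero, contDiffOn_zero] at *
    intro z hz
    refine ContinuousAt.continuousWithinAt ?_
    rcases lt_trichotomy 0 z.2 with h | h | h
    · exact ((hf.continuousAt ((hO.inter hpos).mem_nhds ⟨hz, h⟩)).congr (evpos f z h).symm)
    · exact (hder0 f z hz h.symm (hb 0 le_rfl)).continuousAt
    · exact continuousAt_const.congr (evneg f z h).symm
  | succ k ih =>
    intro F _ _ f hf hb
    have hf₁ : ContDiffOn ℝ ((k : WithTop ℕ∞) + 1) f (O ∩ {z | 0 < z.2}) := hf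
    obtain ⟨hd, -, hf'⟩ := (contDiffOn_succ_iff_fderiv_of_isOpen (hO.inter hpos)).1 hf₁
    have hder : ∀ z ∈ O, HasFDerivAt (fun z => if 0 < z.2 then f z else 0)
        (if 0 < z.2 then fderiv ℝ f z else 0) z := by
      intro z hz
      rcases lt_trichotomy 0 z.2 with h | h | h
      · rw [if_pos h]
        exact ((hd z ⟨hz, h⟩).differentiableAt
          ((hO.inter hpos).mem_nhds ⟨hz, h⟩)).hasFDerivAt.congr_of_eventuallyEq (evpos f z h)
      · rw [if_neg (by simp [← h])]
        exact hder0 f z hz h.symm (hb 0 (by omega))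
      · rw [if_neg (not_lt.2 h.le)]
        exact (hasFDerivAt_const (0 : F) z).congr_of_eventuallyEq (evneg f z h)
    refine (contDiffOn_succ_iff_fderiv_of_isOpen hO).2
      ⟨fun z hz => (hder z hz).differentiableAt.differentiableWithinAt,
        fun h => absurd h (WithTop.coe_ne_top (a := (k : ℕ∞))), ?_⟩
    refine (ih hf' fun j hj => ?_).congr fun z hz => (hder z hz).fderiv
    obtain ⟨C, hC⟩ := hb (j + 1) (by omega)
    exact ⟨C, fun z hz h => by rw [norm_iteratedFDeriv_fderiv]; exact hC z hz h⟩

end CkLemmas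

/-! ### Limits of the orbits of a parabolic map -/

section Parabolic

variable {X : Type} [NormedAddCommGroup X] [NormedSpace ℝ X]

/-- A map of `X × ℝ` that is tangent to the identity to second order along `X × {0}`. -/
def parabolicMap (a : X × ℝ → X) (b : X × ℝ → ℝ) (z : X × ℝ) : X × ℝ :=
  (z.1 + z.2 ^ 2 • a z, z.2 - z.2 ^ 2 * b z)

lemma contDiff_parabolicMap {a : X × ℝ → X} {b : X × ℝ → ℝ} (ha : ContDiff ℝ ∞ a)
    (hb : ContDiff ℝ ∞ b) : ContDiff ℝ ∞ (parabolicMap a b) := by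
  unfold parabolicMap; fun_prop

lemma contDiff_parabolicMap_iterate {a : X × ℝ → X} {b : X × ℝ → ℝ} (ha : ContDiff ℝ ∞ a)
    (hb : ContDiff ℝ ∞ b) (n : ℕ) : ContDiff ℝ ∞ (parabolicMap a b)^[n] := by
  induction n with
  | zero => exact contDiff_id
  | succ n ih => rw [Function.iterate_succ']; exact (contDiff_parabolicMap ha hb).comp ih

/-- Formal conjugation: to every order there is an approximately invariant smooth function that
restricts to the identity on `X × {0}`. -/
lemma exists_approx_invariant [CompleteSpace X] {a : X × ℝ → X} {b : X × ℝ → ℝ}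
    (ha : ContDiff ℝ ∞ a) (hb : ContDiff ℝ ∞ b) (hbpos : ∀ z, 0 < b z) (N : ℕ) :
    ∃ Φ h : X × ℝ → X, ContDiff ℝ ∞ Φ ∧ ContDiff ℝ ∞ h ∧ (∀ x, Φ (x, 0) = x) ∧
      ∀ z, Φ (parabolicMap a b z) - Φ z = z.2 ^ (N + 2) • h z := by
  induction N with
  | zero => exact ⟨Prod.fst, a, contDiff_fst, ha, fun x => rfl, fun z => by simp [parabolicMap]⟩
  | succ N ih =>
    obtain ⟨Φ, h, hΦ, hh, hΦ0, hΦh⟩ := ih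
    -- the coefficient of `z.2 ^ (N + 1)` that removes the leading error term
    let c : X × ℝ → X := fun z => ((N + 1) * b (z.1, 0))⁻¹ • h (z.1, 0)
    have hb0 : ∀ x, ((N : ℝ) + 1) * b (x, 0) ≠ 0 := fun x =>
      (mul_pos (by positivity) (hbpos _)).ne'
    have hc : ContDiff ℝ ∞ c := by
      have h1 : ContDiff ℝ ∞ fun z : X × ℝ => ((N : ℝ) + 1) * b (z.1, 0) := by fun_prop
      have h2 : ContDiff ℝ ∞ fun z : X × ℝ => h (z.1, 0) := by fun_prop
      exact (h1.inv fun z => hb0 z.1).smul h2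
    have hP := contDiff_parabolicMap ha hb
    let Q : X × ℝ → X := fun z => z.2 • h z + (1 - z.2 * b z) ^ (N + 1) • c (parabolicMap a b z) - c z
    have hQ : ContDiff ℝ ∞ Q := by
      have h1 : ContDiff ℝ ∞ fun z => c (parabolicMap a b z) := hc.comp hP
      have h2 : ContDiff ℝ ∞ fun z : X × ℝ => (1 - z.2 * b z) ^ (N + 1) := by fun_prop
      exact ((contDiff_snd.smul hh).add (h2.smul h1)).sub hc
    have hQ0 : ∀ x, Q (x, 0) = 0 := fun x => by simp [Q, parabolicMap]
    obtain ⟨Q₁, hQ₁, hQQ₁⟩ := exists_contDiff_eq_smul hQ hQ0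
    have hQ₁0 : ∀ x, Q₁ (x, 0) = 0 := by
      intro x
      have hd1 : HasDerivAt (fun t : ℝ => Q (x, t)) (Q₁ (x, 0)) 0 := by
        have h1 : HasDerivAt (fun t : ℝ => Q₁ (x, t)) (deriv (fun t : ℝ => Q₁ (x, t)) 0) 0 := by
          have : ContDiff ℝ ∞ fun t : ℝ => Q₁ (x, t) := by fun_prop
          exact ((this.differentiable (by simp)) 0).hasDerivAt
        have h2 := (hasDerivAt_id' (0 : ℝ)).fun_smul h1
        simp only [hQQ₁]
        simpa using h2
      have hd2 : HasDerivAt (fun t : ℝ => Q (x, t)) 0 0 := by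
        have e1 : HasDerivAt (fun t : ℝ => t • h (x, t)) (h (x, 0)) 0 := by
          have h1 : HasDerivAt (fun t : ℝ => h (x, t)) (deriv (fun t : ℝ => h (x, t)) 0) 0 := by
            have : ContDiff ℝ ∞ fun t : ℝ => h (x, t) := by fun_prop
            exact ((this.differentiable (by simp)) 0).hasDerivAt
          simpa using (hasDerivAt_id' (0 : ℝ)).fun_smul h1
        have e2 : HasDerivAt (fun t : ℝ => (1 - t * b (x, t)) ^ (N + 1)) (-((N + 1) * b (x, 0))) 0 := by
          have h1 : HasDerivAt (fun t : ℝ => b (x, t)) (deriv (fun t : ℝ => b (x, t)) 0) 0 := by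
            have : ContDiff ℝ ∞ fun t : ℝ => b (x, t) := by fun_prop
            exact ((this.differentiable (by simp)) 0).hasDerivAt
          have := (((hasDerivAt_id' (0 : ℝ)).fun_mul h1).const_sub 1).fun_pow (N + 1)
          simpa using this
        have e3 : HasDerivAt (fun t : ℝ => c (parabolicMap a b (x, t))) 0 0 := by
          have h0 : HasDerivAt (fun t : ℝ => t ^ 2) 0 0 := by
            simpa using hasDerivAt_pow 2 (0 : ℝ)
          have h1 : HasDerivAt (fun t : ℝ => x + t ^ 2 • a (x, t)) 0 0 := by
            have h2 : HasDerivAt (fun t : ℝ => a (x, t)) (deriv (fun t : ℝ => a (x, t)) 0) 0 := by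
              have : ContDiff ℝ ∞ fun t : ℝ => a (x, t) := by fun_prop
              exact ((this.differentiable (by simp)) 0).hasDerivAt
            simpa using (h0.smul h2).const_add x
          have h3 : ∀ t : ℝ, c (parabolicMap a b (x, t)) = (fun y => c (y, 0)) (x + t ^ 2 • a (x, t)) :=
            fun t => rfl
          simp only [h3]
          have h4 : ContDiff ℝ ∞ fun y : X => c (y, 0) := by fun_prop
          have h5 := ((h4.differentiable (by simp)) (x + (0 : ℝ) ^ 2 • a (x, 0))).hasFDerivAt.comp_hasDerivAt
            (0 : ℝ) h1
          simpa [Function.comp_def] using h5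
        have e4 := (e1.add (e2.smul e3)).sub (hasDerivAt_const (0 : ℝ) (c (x, 0)))
        have e5 : h (x, 0) + ((1 - (0 : ℝ) * b (x, 0)) ^ (N + 1) • (0 : X) +
            (-((N + 1) * b (x, 0))) • c (parabolicMap a b (x, 0))) - 0 = 0 := by
          have h6 : c (parabolicMap a b (x, 0)) = ((N + 1) * b (x, 0))⁻¹ • h (x, 0) := by
            simp [c, parabolicMap]
          rw [h6, smul_smul, neg_mul, mul_inv_cancel₀ (hb0 x)]
          simp
        rw [e5] at e4
        exact e4
      exact hd1.unique hd2
    obtain ⟨Q₂, hQ₂, hQQ₂⟩ := exists_contDiff_eq_smul hQ₁ hQ₁0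
    refine ⟨fun z => Φ z + z.2 ^ (N + 1) • c z, Q₂, ?_, hQ₂, fun x => by simp [hΦ0], fun z => ?_⟩
    · have h1 : ContDiff ℝ ∞ fun z : X × ℝ => z.2 ^ (N + 1) := by fun_prop
      exact hΦ.add (h1.smul hc)
    · have h1 : (parabolicMap a b z).2 = z.2 * (1 - z.2 * b z) := by simp [parabolicMap]; ring
      have h2 : Φ (parabolicMap a b z) = Φ z + z.2 ^ (N + 2) • h z := by rw [← hΦh]; abel
      have h3 : z.2 ^ (N + 1 + 2) • Q₂ z = z.2 ^ (N + 1) • Q z := by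
        rw [hQQ₁, hQQ₂]; simp only [smul_smul]; ring_nf
      rw [h3]
      beta_reduce
      rw [h1, h2]
      simp only [Q, smul_sub, smul_add, smul_smul, mul_pow]
      rw [show z.2 ^ (N + 1) * z.2 = z.2 ^ (N + 2) by ring]
      abel

/-- The `i`-th derivative of a function with a factor `c ^ (N + i)` still has the size `c ^ N`. -/
lemma exists_norm_iteratedFDeriv_pow_smul_le {K : Set (X × ℝ)} (hK : IsCompact K)
    (hK0 : ∀ z ∈ K, 0 ≤ z.2) (i : ℕ) :
    ∀ {Y : Type} [NormedAddCommGroup Y] [NormedSpace ℝ Y] {h : X × ℝ → Y}, ContDiff ℝ ∞ h →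
      ∀ N : ℕ, ∃ C, 0 ≤ C ∧ ∀ z ∈ K,
        ‖iteratedFDeriv ℝ i (fun z : X × ℝ => z.2 ^ (N + i) • h z) z‖ ≤ C * z.2 ^ N := by
  induction i with
  | zero =>
    intro Y _ _ h hh N
    obtain ⟨C, hC⟩ := hK.exists_bound_of_continuousOn hh.continuous.continuousOn
    refine ⟨max C 0, le_max_right _ _, fun z hz => ?_⟩
    rw [norm_iteratedFDeriv_zero, add_zero, norm_smul, norm_pow, Real.norm_of_nonneg (hK0 z hz),
      mul_comm]
    exact mul_le_mul_of_nonneg_right ((hC z hz).trans (le_max_left _ _)) (by have := hK0 z hz; positivity)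
  | succ i ih =>
    intro Y _ _ h hh N
    let h' : X × ℝ → X × ℝ →L[ℝ] Y := fun z =>
      ((N + i + 1 : ℕ) : ℝ) • (ContinuousLinearMap.snd ℝ X ℝ).smulRight (h z) + z.2 • fderiv ℝ h z
    have hh' : ContDiff ℝ ∞ h' := by
      have h1 : ContDiff ℝ ∞ (fderiv ℝ h) := hh.fderiv_right (by simp)
      have h2 : ContDiff ℝ ∞ fun z : X × ℝ => (ContinuousLinearMap.snd ℝ X ℝ).smulRight (h z) :=
        ContDiff.smulRight (f := fun _ => ContinuousLinearMap.snd ℝ X ℝ) contDiff_const hh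
      exact (ContDiff.const_smul ((N + i + 1 : ℕ) : ℝ) h2).add (contDiff_snd.smul h1)
    obtain ⟨C, hC0, hC⟩ := ih hh' N
    refine ⟨C, hC0, fun z hz => ?_⟩
    rw [← norm_iteratedFDeriv_fderiv]
    convert hC z hz using 3
    funext y
    have h1 : HasFDerivAt (fun z : X × ℝ => z.2 ^ (N + i + 1))
        ((((N + i + 1 : ℕ) : ℝ) * y.2 ^ (N + i)) • ContinuousLinearMap.snd ℝ X ℝ) y := by
      simpa using (ContinuousLinearMap.snd ℝ X ℝ).hasFDerivAt.pow (N + i + 1)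
    have h2 := h1.smul ((hh.differentiable (by simp)) y).hasFDerivAt
    have h3 := h2.fderiv
    simp only [← add_assoc]
    refine h3.trans ?_
    ext v <;> simp [h', smul_smul, pow_succ]
    ring_nf
    rw [add_comm]

/-- A box on which the orbits of a parabolic map are controlled: the map moves the points of the
inner box `ball x₀ r × [0, ε)` within `ball x₀ (2 r) × [0, ε)`. -/
structure ParabolicBox (a : X × ℝ → X) (b : X × ℝ → ℝ) (x₀ : X) (r ε β A : ℝ) : Prop where
  r_pos : 0 < r
  ε_pos : 0 < ε
  ε_le : ε ≤ 1
  β_pos : 0 < β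
  A_nonneg : 0 ≤ A
  le_b : ∀ z ∈ Metric.closedBall x₀ (2 * r) ×ˢ Icc 0 ε, β ≤ b z
  b_le : ∀ z ∈ Metric.closedBall x₀ (2 * r) ×ˢ Icc 0 ε, z.2 * b z ≤ 1 / 2
  a_le : ∀ z ∈ Metric.closedBall x₀ (2 * r) ×ˢ Icc 0 ε, ‖a z‖ ≤ A
  A_le : A * ε ≤ β * r

lemma exists_parabolicBox [FiniteDimensional ℝ X] {a : X × ℝ → X} {b : X × ℝ → ℝ}
    (ha : Continuous a) (hb : Continuous b) (hbpos : ∀ z, 0 < b z) (x₀ : X) {R : ℝ} (hR : 0 < R) :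
    ∃ r ε β A, ParabolicBox a b x₀ r ε β A ∧ r ≤ R ∧ ε ≤ R := by
  have hK : IsCompact (Metric.closedBall x₀ (2 * R) ×ˢ Icc (0 : ℝ) 1) :=
    (isCompact_closedBall _ _).prod isCompact_Icc
  have hne : (Metric.closedBall x₀ (2 * R) ×ˢ Icc (0 : ℝ) 1).Nonempty :=
    ⟨(x₀, 0), by simp [hR.le]⟩
  obtain ⟨A, hA⟩ := hK.exists_bound_of_continuousOn ha.continuousOn
  obtain ⟨B, hB⟩ := hK.exists_bound_of_continuousOn hb.continuousOn
  obtain ⟨y, -, hy⟩ := hK.exists_isMinOn hne hb.continuousOn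
  have hA0 : 0 ≤ A := (norm_nonneg _).trans (hA _ hne.some_mem)
  have hB0 : 0 ≤ B := (norm_nonneg _).trans (hB _ hne.some_mem)
  have hβ := hbpos y
  let ε := min (min 1 R) (min (1 / (2 * (B + 1))) (b y * R / (A + 1)))
  have hε : 0 < ε := by positivity
  have e1 : ε ≤ 1 := (min_le_left _ _).trans (min_le_left _ _)
  have e2 : ε ≤ R := (min_le_left _ _).trans (min_le_right _ _)
  have e3 : ε ≤ 1 / (2 * (B + 1)) := (min_le_right _ _).trans (min_le_left _ _)
  have e4 : ε ≤ b y * R / (A + 1) := (min_le_right _ _).trans (min_le_right _ _)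
  have hsub : Metric.closedBall x₀ (2 * R) ×ˢ Icc (0 : ℝ) ε ⊆
      Metric.closedBall x₀ (2 * R) ×ˢ Icc (0 : ℝ) 1 :=
    prod_mono le_rfl (Icc_subset_Icc_right e1)
  rw [le_div_iff₀ (by positivity)] at e3 e4
  refine ⟨R, ε, b y, A, ⟨hR, hε, e1, hβ, hA0, fun z hz => hy (hsub hz), fun z hz => ?_,
    fun z hz => hA z (hsub hz), by nlinarith⟩, le_rfl, e2⟩
  have h1 := (le_abs_self _).trans (hB z (hsub hz))
  have h2 := hz.2.1
  have h3 := hz.2.2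
  nlinarith [hbpos z]

namespace ParabolicBox

variable {a : X × ℝ → X} {b : X × ℝ → ℝ} {x₀ : X} {r ε β A : ℝ}

lemma step_le (B : ParabolicBox a b x₀ r ε β A) {z : X × ℝ}
    (hz : z ∈ Metric.closedBall x₀ (2 * r) ×ˢ Icc 0 ε) :
    z.2 / 2 ≤ (parabolicMap a b z).2 ∧ (parabolicMap a b z).2 + β * z.2 ^ 2 ≤ z.2 := by
  have h1 := B.le_b z hz
  have h2 := B.b_le z hz
  have h3 : 0 ≤ z.2 := hz.2.1
  constructor
  · simp only [parabolicMap]; nlinarith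
  · simp only [parabolicMap]; nlinarith [mul_le_mul_of_nonneg_left h1 (sq_nonneg z.2)]

/-- The orbits that start in the inner box stay in the outer one, and the displacement of the first
component is controlled by the decrease of the second one. -/
lemma orbit (B : ParabolicBox a b x₀ r ε β A) {z : X × ℝ}
    (hz : z ∈ Metric.ball x₀ r ×ˢ Ico 0 ε) (n : ℕ) :
    (parabolicMap a b)^[n] z ∈ Metric.closedBall x₀ (2 * r) ×ˢ Icc 0 ε ∧
      ((parabolicMap a b)^[n] z).2 ≤ z.2 ∧ (0 < z.2 → 0 < ((parabolicMap a b)^[n] z).2) ∧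
      β * ‖((parabolicMap a b)^[n] z).1 - z.1‖ ≤ A * (z.2 - ((parabolicMap a b)^[n] z).2) := by
  have hz1 : ‖z.1 - x₀‖ < r := mem_ball_iff_norm.1 hz.1
  have hz2 : 0 ≤ z.2 := hz.2.1
  have hz3 : z.2 < ε := hz.2.2
  have hr := B.r_pos
  have hβ := B.β_pos
  have hA := B.A_nonneg
  have hAε := B.A_le
  -- the first components stay in the box because the total displacement is at most `A ε / β`
  have key : ∀ x : X × ℝ, 0 ≤ x.2 → x.2 ≤ z.2 → β * ‖x.1 - z.1‖ ≤ A * (z.2 - x.2) →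
      x ∈ Metric.closedBall x₀ (2 * r) ×ˢ Icc 0 ε := by
    intro x h1 h2 h3
    have h4 : ‖x.1 - z.1‖ ≤ r := by
      have h5 : β * ‖x.1 - z.1‖ ≤ β * r := h3.trans (le_trans (by gcongr; linarith) hAε)
      exact le_of_mul_le_mul_left h5 hβ
    refine ⟨?_, h1, by linarith⟩
    rw [mem_closedBall_iff_norm]
    calc ‖x.1 - x₀‖ = ‖(x.1 - z.1) + (z.1 - x₀)‖ := by congr 1; abel
      _ ≤ ‖x.1 - z.1‖ + ‖z.1 - x₀‖ := norm_add_le _ _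
      _ ≤ 2 * r := by linarith
  induction n with
  | zero =>
    exact ⟨key z hz2 le_rfl (by simp), le_rfl, id, by simp⟩
  | succ n ih =>
    obtain ⟨h1, h2, h3, h4⟩ := ih
    rw [Function.iterate_succ_apply']
    set x := (parabolicMap a b)^[n] z
    obtain ⟨s1, s2⟩ := B.step_le h1
    have hx : 0 ≤ x.2 := h1.2.1
    have s3 : ‖(parabolicMap a b x).1 - x.1‖ ≤ x.2 ^ 2 * A := by
      have := B.a_le x h1
      simp only [parabolicMap, add_sub_cancel_left, norm_smul, norm_pow, Real.norm_eq_abs, sq_abs]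
      gcongr
    have t1 : 0 ≤ (parabolicMap a b x).2 := by linarith
    have t2 : (parabolicMap a b x).2 ≤ z.2 := by nlinarith [sq_nonneg x.2]
    have t3 : β * ‖(parabolicMap a b x).1 - z.1‖ ≤ A * (z.2 - (parabolicMap a b x).2) := by
      have e1 : ‖(parabolicMap a b x).1 - z.1‖ ≤
          ‖(parabolicMap a b x).1 - x.1‖ + ‖x.1 - z.1‖ := norm_sub_le_norm_sub_add_norm_sub _ _ _
      have e2 : A * (β * x.2 ^ 2) ≤ A * (x.2 - (parabolicMap a b x).2) :=
        mul_le_mul_of_nonneg_left (by linarith) hA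
      nlinarith [mul_le_mul_of_nonneg_left e1 hβ.le, mul_le_mul_of_nonneg_left s3 hβ.le]
    exact ⟨key _ t1 t2 t3, t2, fun h => by have := h3 h; linarith, t3⟩

lemma inv_step (B : ParabolicBox a b x₀ r ε β A) {z : X × ℝ}
    (hz : z ∈ Metric.closedBall x₀ (2 * r) ×ˢ Icc 0 ε) (hpos : 0 < z.2) :
    z.2⁻¹ * (1 + β * z.2) ≤ (parabolicMap a b z).2⁻¹ := by
  obtain ⟨h1, h2⟩ := B.step_le hz
  have h3 : 0 < (parabolicMap a b z).2 := by linarith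
  have hβ := B.β_pos
  rw [le_inv_comm₀ (by positivity) h3, mul_inv, inv_inv, ← div_eq_mul_inv, le_div_iff₀ (by positivity)]
  have h4 : 0 < β * z.2 := mul_pos hβ hpos
  calc (parabolicMap a b z).2 * (1 + β * z.2) ≤ (z.2 - β * z.2 ^ 2) * (1 + β * z.2) := by
        gcongr; linarith
    _ = z.2 - (β * z.2) ^ 2 * z.2 := by ring
    _ ≤ z.2 := by have := mul_pos (pow_pos h4 2) hpos; linarith

/-- The second component of the orbit decays at least like `1 / n`, because its reciprocal grows by at
least `β` in each step. -/
lemma orbit_le (B : ParabolicBox a b x₀ r ε β A) {z : X × ℝ}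
    (hz : z ∈ Metric.ball x₀ r ×ˢ Ico 0 ε) (n : ℕ) :
    ((parabolicMap a b)^[n] z).2 ≤ (1 + n * β)⁻¹ := by
  have hβ := B.β_pos
  obtain ⟨h1, h2, h3, -⟩ := B.orbit hz n
  rcases hz.2.1.eq_or_lt with h0 | h0
  · exact (h2.trans_eq h0.symm).trans (by positivity)
  · have h4 : 1 + n * β ≤ ((parabolicMap a b)^[n] z).2⁻¹ := by
      clear h1 h2 h3
      induction n with
      | zero =>
        simp only [Nat.cast_zero, zero_mul, add_zero, Function.iterate_zero, id_eq]
        exact (one_le_inv₀ h0).2 (hz.2.2.le.trans B.ε_le)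
      | succ n ih =>
        obtain ⟨h1, h2, h3, -⟩ := B.orbit hz n
        have := B.inv_step h1 (h3 h0)
        rw [Function.iterate_succ_apply']
        have e : ((parabolicMap a b)^[n] z).2⁻¹ * (1 + β * ((parabolicMap a b)^[n] z).2) =
            ((parabolicMap a b)^[n] z).2⁻¹ + β := by
          have := (h3 h0).ne'
          field_simp
        push_cast
        linarith
    rw [le_inv_comm₀ (h3 h0) (by positivity)]
    exact h4

lemma summable_bound (hβ : 0 < β) : Summable fun n : ℕ => ((1 + n * β)⁻¹) ^ 2 := by
  rw [← summable_nat_add_iff 1]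
  have h1 : Summable fun n : ℕ => (β⁻¹) ^ 2 * (1 / ((n + 1 : ℕ) : ℝ) ^ 2) :=
    ((summable_nat_add_iff 1).2 (Real.summable_one_div_nat_pow.2 one_lt_two)).mul_left _
  refine Summable.of_nonneg_of_le (fun n => by positivity) (fun n => ?_) h1
  rw [one_div, ← inv_pow, ← mul_pow, ← mul_inv]
  gcongr
  nlinarith

/-- The derivatives of the iterates grow at most like a power of the reciprocal of the second
component: the top-order term is multiplied by at most `1 + O(c)` in each step, which is compensated
by the growth of `c⁻¹` by a factor of at least `1 + β c`. -/
lemma exists_norm_iteratedFDeriv_iterate_le [FiniteDimensional ℝ X]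
    (B : ParabolicBox a b x₀ r ε β A) (ha : ContDiff ℝ ∞ a) (hb : ContDiff ℝ ∞ b) (k : ℕ) :
    ∃ C : ℝ, 1 ≤ C ∧ ∃ M : ℕ, ∀ i, 1 ≤ i → i ≤ k → ∀ z ∈ Metric.ball x₀ r ×ˢ Ioo 0 ε, ∀ n,
      ‖iteratedFDeriv ℝ i (parabolicMap a b)^[n] z‖ ≤
        C * (((parabolicMap a b)^[n] z).2⁻¹) ^ M := by
  set P := parabolicMap a b with hPdef
  have hP : ContDiff ℝ ∞ P := contDiff_parabolicMap ha hb
  have hPn : ∀ n, ContDiff ℝ ∞ P^[n] := contDiff_parabolicMap_iterate ha hb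
  have hβ := B.β_pos
  set K := Metric.closedBall x₀ (2 * r) ×ˢ Icc 0 ε with hKdef
  have hK : IsCompact K := (isCompact_closedBall _ _).prod isCompact_Icc
  have hsub : Metric.ball x₀ r ×ˢ Ioo 0 ε ⊆ Metric.ball x₀ r ×ˢ Ico 0 ε :=
    prod_mono le_rfl Ioo_subset_Ico_self
  have hone : ∀ z ∈ Metric.ball x₀ r ×ˢ Ioo 0 ε, ∀ n, 1 ≤ (P^[n] z).2⁻¹ := by
    intro z hz n
    obtain ⟨h1, h2, h3, -⟩ := B.orbit (hsub hz) n
    exact (one_le_inv₀ (h3 hz.2.1)).2 (h1.2.2.trans B.ε_le)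
  -- first derivatives of a single step
  have hDP : ∃ c, 0 ≤ c ∧ ∀ z ∈ K, ‖fderiv ℝ P z‖ ≤ 1 + c * z.2 := by
    let V : X × ℝ → X × ℝ := fun z => (a z, -b z)
    have hV : ContDiff ℝ ∞ V := ha.prodMk hb.neg
    let T : X × ℝ → X × ℝ →L[ℝ] X × ℝ := fun z =>
      z.2 • fderiv ℝ V z + (2 : ℝ) • (ContinuousLinearMap.snd ℝ X ℝ).smulRight (V z)
    have hT : Continuous T := by
      have h1 : Continuous (fderiv ℝ V) := hV.continuous_fderiv (by simp)
      have h2 : ContDiff ℝ ∞ fun z : X × ℝ => (ContinuousLinearMap.snd ℝ X ℝ).smulRight (V z) :=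
        ContDiff.smulRight (f := fun _ => ContinuousLinearMap.snd ℝ X ℝ) contDiff_const hV
      exact (continuous_snd.smul h1).add (h2.continuous.const_smul (2 : ℝ))
    obtain ⟨c, hc⟩ := hK.exists_bound_of_continuousOn hT.continuousOn
    refine ⟨max c 0, le_max_right _ _, fun z hz => ?_⟩
    have h1 : HasFDerivAt P (ContinuousLinearMap.id ℝ _ + z.2 • T z) z := by
      have e : P = fun z => z + z.2 ^ 2 • V z := by
        funext z; simp [P, parabolicMap, V, Prod.ext_iff, sub_eq_add_neg]
      rw [e]
      have h2 : HasFDerivAt (fun z : X × ℝ => z.2 ^ 2)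
          ((2 * z.2) • ContinuousLinearMap.snd ℝ X ℝ) z := by
        simpa using (ContinuousLinearMap.snd ℝ X ℝ).hasFDerivAt.pow 2
      have h3 := (hasFDerivAt_id z).add (h2.smul ((hV.differentiable (by simp)) z).hasFDerivAt)
      refine h3.congr_fderiv ?_
      congr 1
      ext v <;> simp [T, smul_smul, pow_two] <;> ring_nf <;> simp
    rw [h1.fderiv]
    refine (norm_add_le _ _).trans (add_le_add ContinuousLinearMap.norm_id_le ?_)
    rw [norm_smul, Real.norm_of_nonneg hz.2.1, mul_comm]
    exact mul_le_mul_of_nonneg_right ((hc z hz).trans (le_max_left _ _)) hz.2.1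
  obtain ⟨c, hc0, hc⟩ := hDP
  induction k with
  | zero => exact ⟨1, le_rfl, 0, fun i h1 h2 => by omega⟩
  | succ k ih =>
    obtain ⟨C, hC1, M, hCM⟩ := ih
    -- bounds for the derivatives of `P`
    have hCP : ∃ CP, 0 ≤ CP ∧ ∀ i ≤ k, ∀ z ∈ K, ‖iteratedFDeriv ℝ i (fderiv ℝ P) z‖ ≤ CP := by
      have h1 : ∀ i, ∃ Ci, 0 ≤ Ci ∧ ∀ z ∈ K, ‖iteratedFDeriv ℝ i (fderiv ℝ P) z‖ ≤ Ci := by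
        intro i
        have h2 : Continuous (iteratedFDeriv ℝ i (fderiv ℝ P)) :=
          (hP.fderiv_right (m := ∞) (by simp)).continuous_iteratedFDeriv (by exact_mod_cast le_top)
        obtain ⟨Ci, hCi⟩ := hK.exists_bound_of_continuousOn h2.continuousOn
        exact ⟨max Ci 0, le_max_right _ _, fun z hz => (hCi z hz).trans (le_max_left _ _)⟩
      choose Ci h0 hCi using h1
      refine ⟨∑ i ∈ Finset.range (k + 1), Ci i, Finset.sum_nonneg fun i _ => h0 i,
        fun i hi z hz => (hCi i z hz).trans ?_⟩
      exact Finset.single_le_sum (f := Ci) (fun i _ => h0 i) (Finset.mem_range.2 (by omega))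
    obtain ⟨CP, hCP0, hCP⟩ := hCP
    let C' : ℝ := 2 ^ k * (k.factorial * CP * C ^ k) * C
    let M' : ℕ := M * (k + 1)
    have hC'0 : 0 ≤ C' := by positivity
    -- the recursive inequality
    have hrec : ∀ z ∈ Metric.ball x₀ r ×ˢ Ioo 0 ε, ∀ n,
        ‖iteratedFDeriv ℝ (k + 1) P^[n + 1] z‖ ≤
          (1 + c * (P^[n] z).2) * ‖iteratedFDeriv ℝ (k + 1) P^[n] z‖ +
            C' * ((P^[n] z).2⁻¹) ^ M' := by
      intro z hz n
      obtain ⟨h1, h2, h3, -⟩ := B.orbit (hsub hz) n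
      have hs := hone z hz n
      set σ := (P^[n] z).2⁻¹ with hσ
      have hDn : ContDiff ℝ ∞ (fderiv ℝ P^[n]) := (hPn n).fderiv_right (by simp)
      have hDPn : ContDiff ℝ ∞ (fderiv ℝ P ∘ P^[n]) := (hP.fderiv_right (by simp)).comp (hPn n)
      have hcomp : fderiv ℝ P^[n + 1] =
          fun y => ContinuousLinearMap.compL ℝ (X × ℝ) (X × ℝ) (X × ℝ) ((fderiv ℝ P ∘ P^[n]) y)
            (fderiv ℝ P^[n] y) := by
        funext y
        rw [Function.iterate_succ']
        exact fderiv_comp y (hP.differentiable (by simp) _) ((hPn n).differentiable (by simp) _)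
      rw [← norm_iteratedFDeriv_fderiv, hcomp]
      refine (ContinuousLinearMap.norm_iteratedFDeriv_le_of_bilinear_of_le_one _ hDPn hDn z
        (n := k) (by exact_mod_cast le_top) (ContinuousLinearMap.norm_compL_le ..)).trans ?_
      rw [Finset.sum_range_succ', add_comm]
      refine add_le_add ?_ ?_
      · rw [Nat.choose_zero_right, Nat.cast_one, one_mul, norm_iteratedFDeriv_zero, Nat.sub_zero,
          norm_iteratedFDeriv_fderiv]
        exact mul_le_mul_of_nonneg_right (hc _ h1) (norm_nonneg _)
      · have hterm : ∀ i ∈ Finset.range k, ((k.choose (i + 1) : ℕ) : ℝ) *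
            ‖iteratedFDeriv ℝ (i + 1) (fderiv ℝ P ∘ P^[n]) z‖ *
              ‖iteratedFDeriv ℝ (k - (i + 1)) (fderiv ℝ P^[n]) z‖ ≤
            (k.choose (i + 1) : ℕ) * ((k.factorial * CP * C ^ k) * C * σ ^ M') := by
          intro i hi
          have hik : i + 1 ≤ k := by simpa using Finset.mem_range.1 hi
          have hD : 1 ≤ C * σ ^ M := one_le_mul_of_one_le_of_one_le hC1 (one_le_pow₀ hs)
          have e1 : ‖iteratedFDeriv ℝ (i + 1) (fderiv ℝ P ∘ P^[n]) z‖ ≤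
              (i + 1).factorial * CP * (C * σ ^ M) ^ (i + 1) := by
            refine norm_iteratedFDeriv_comp_le (N := ∞) (hP.fderiv_right (by simp)) (hPn n)
              (by exact_mod_cast le_top) z (fun j hj => hCP j (hj.trans hik) _ h1) fun j hj hj' => ?_
            exact (hCM j hj (hj'.trans hik) z hz n).trans (le_self_pow₀ hD (by omega))
          have e2 : ‖iteratedFDeriv ℝ (k - (i + 1)) (fderiv ℝ P^[n]) z‖ ≤ C * σ ^ M := by
            rw [norm_iteratedFDeriv_fderiv]
            exact hCM _ (by omega) (by omega) z hz n
          rw [mul_assoc]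
          refine mul_le_mul_of_nonneg_left ?_ (by positivity)
          calc _ ≤ ((i + 1).factorial * CP * (C * σ ^ M) ^ (i + 1)) * (C * σ ^ M) := by gcongr
            _ ≤ (k.factorial * CP * (C * σ ^ M) ^ k) * (C * σ ^ M) := by
                gcongr
            _ = (k.factorial * CP * C ^ k) * C * σ ^ M' := by
                simp only [M', mul_pow, ← pow_mul, mul_add, pow_add, mul_one]; ring
        refine (Finset.sum_le_sum hterm).trans ?_
        rw [← Finset.sum_mul]
        have hsum : ∑ i ∈ Finset.range k, ((k.choose (i + 1) : ℕ) : ℝ) ≤ 2 ^ k := by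
          have h5 := Nat.sum_range_choose k
          rw [Finset.sum_range_succ'] at h5
          have h6 : ∑ i ∈ Finset.range k, k.choose (i + 1) ≤ 2 ^ k := by omega
          exact_mod_cast h6
        refine (mul_le_mul_of_nonneg_right hsum (by positivity)).trans (le_of_eq ?_)
        simp only [C']; ring
    -- the bound propagates, for large exponents
    obtain ⟨m, hm⟩ := exists_nat_ge ((c + 1) / β)
    let M'' : ℕ := max m (M' + 1)
    let C'' : ℝ := max C' 1
    have hM'' : c + 1 ≤ M'' * β := by
      rw [div_le_iff₀ hβ] at hm
      refine hm.trans (mul_le_mul_of_nonneg_right ?_ hβ.le)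
      exact_mod_cast le_max_left _ _
    have hbound : ∀ z ∈ Metric.ball x₀ r ×ˢ Ioo 0 ε, ∀ n,
        ‖iteratedFDeriv ℝ (k + 1) P^[n] z‖ ≤ C'' * ((P^[n] z).2⁻¹) ^ M'' := by
      intro z hz n
      induction n with
      | zero =>
        have h1 : ‖iteratedFDeriv ℝ (k + 1) (P^[0]) z‖ ≤ 1 := by
          rw [← norm_iteratedFDeriv_fderiv, Function.iterate_zero]
          have h2 : fderiv ℝ (id : X × ℝ → X × ℝ) = fun _ => ContinuousLinearMap.id ℝ _ := by
            funext y; exact fderiv_id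
          rw [h2]
          cases k with
          | zero => rw [norm_iteratedFDeriv_zero]; exact ContinuousLinearMap.norm_id_le
          | succ k => rw [iteratedFDeriv_succ_const]; simp
        exact h1.trans (one_le_mul_of_one_le_of_one_le (le_max_right _ _)
          (one_le_pow₀ (hone z hz 0)))
      | succ n ihn =>
        obtain ⟨h1, h2, h3, -⟩ := B.orbit (hsub hz) n
        have hpos := h3 hz.2.1
        have hs := hone z hz n
        have hstep := B.inv_step h1 hpos
        rw [← hPdef, ← Function.iterate_succ_apply' P] at hstep
        have hr := hrec z hz n
        generalize (P^[n] z).2 = ρ at *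
        have hC'' : C' ≤ C'' := le_max_left _ _
        have hC''0 : 0 ≤ C'' := zero_le_one.trans (le_max_right _ _)
        have hbern : 1 + M'' * (β * ρ) ≤ (1 + β * ρ) ^ M'' :=
          one_add_mul_le_pow (by nlinarith) _
        have hpow : ρ⁻¹ ^ M' ≤ ρ * ρ⁻¹ ^ M'' := by
          calc ρ⁻¹ ^ M' = ρ * ρ⁻¹ ^ (M' + 1) := by
                rw [pow_succ, mul_comm ρ, mul_assoc, inv_mul_cancel₀ hpos.ne', mul_one]
            _ ≤ ρ * ρ⁻¹ ^ M'' := by gcongr; exact le_max_right _ _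
        have hrhs : 0 ≤ ρ⁻¹ ^ M'' := by positivity
        calc _ ≤ (1 + c * ρ) * (C'' * ρ⁻¹ ^ M'') + C' * ρ⁻¹ ^ M' := by
              refine hr.trans ?_
              gcongr
          _ ≤ (1 + c * ρ) * (C'' * ρ⁻¹ ^ M'') + C'' * (ρ * ρ⁻¹ ^ M'') := by gcongr
          _ = C'' * ((1 + (c + 1) * ρ) * ρ⁻¹ ^ M'') := by ring
          _ ≤ C'' * ((1 + M'' * (β * ρ)) * ρ⁻¹ ^ M'') := by
              gcongr C'' * (?_ * _)
              nlinarith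
          _ ≤ C'' * ((1 + β * ρ) ^ M'' * ρ⁻¹ ^ M'') := by gcongr
          _ = C'' * (ρ⁻¹ * (1 + β * ρ)) ^ M'' := by rw [mul_pow]; ring
          _ ≤ _ := by gcongr
    refine ⟨max C C'', hC1.trans (le_max_left _ _), max M M'', fun i hi1 hi2 z hz n => ?_⟩
    have hs := hone z hz n
    rcases Nat.lt_or_ge i (k + 1) with h | h
    · refine (hCM i hi1 (by omega) z hz n).trans ?_
      gcongr
      exacts [le_max_left _ _, le_max_left _ _]
    · obtain rfl : i = k + 1 := by omega
      refine (hbound z hz n).trans ?_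
      gcongr
      exacts [le_max_right _ _, le_max_right _ _]

lemma iterate_of_snd_eq_zero (a : X × ℝ → X) (b : X × ℝ → ℝ) (x : X) (n : ℕ) :
    (parabolicMap a b)^[n] (x, 0) = (x, 0) :=
  Function.iterate_fixed (by simp [parabolicMap]) n

lemma exists_tendsto_iterate [CompleteSpace X] (B : ParabolicBox a b x₀ r ε β A) {z : X × ℝ}
    (hz : z ∈ Metric.ball x₀ r ×ˢ Ico 0 ε) :
    ∃ w, Tendsto (fun n => (parabolicMap a b)^[n] z) atTop (𝓝 (w, 0)) := by
  have hsum := (summable_bound B.β_pos).mul_right A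
  have h1 : ∀ n, dist ((parabolicMap a b)^[n] z).1 ((parabolicMap a b)^[n + 1] z).1 ≤
      ((1 + n * β)⁻¹) ^ 2 * A := by
    intro n
    have hA := B.A_nonneg
    obtain ⟨h1, -⟩ := B.orbit hz n
    have h2 := B.orbit_le hz n
    have h3 : 0 ≤ ((parabolicMap a b)^[n] z).2 := h1.2.1
    rw [Function.iterate_succ_apply', dist_comm, dist_eq_norm]
    have := B.a_le _ h1
    simp only [parabolicMap, add_sub_cancel_left, norm_smul, norm_pow, Real.norm_eq_abs, sq_abs]
    gcongr
  obtain ⟨w, hw⟩ := cauchySeq_tendsto_of_complete (cauchySeq_of_dist_le_of_summable _ h1 hsum)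
  refine ⟨w, hw.prodMk_nhds ?_⟩
  have h2 : Tendsto (fun n : ℕ => (1 + n * β)⁻¹) atTop (𝓝 0) := by
    refine tendsto_inv_atTop_zero.comp (tendsto_atTop_add_const_left _ _ ?_)
    exact tendsto_natCast_atTop_atTop.atTop_mul_const B.β_pos
  exact squeeze_zero (fun n => (B.orbit hz n).1.2.1) (fun n => B.orbit_le hz n) h2

end ParabolicBox

/-- Orbits of a parabolic map that start near `(x₀, 0)` with nonnegative second component converge
to a point of `X × {0}`, and the limit depends smoothly on the initial point, up to the boundary: to
every order `k`, it has a `C^k` extension to a fixed full neighbourhood. -/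
theorem exists_parabolic_limit [FiniteDimensional ℝ X] {a : X × ℝ → X} {b : X × ℝ → ℝ}
    (ha : ContDiff ℝ ∞ a) (hb : ContDiff ℝ ∞ b) (hbpos : ∀ z, 0 < b z) (x₀ : X)
    {V : Set (X × ℝ)} (hV : V ∈ 𝓝 (x₀, (0 : ℝ))) :
    ∃ O : Set (X × ℝ), IsOpen O ∧ (x₀, 0) ∈ O ∧ ∃ L : X × ℝ → X,
      (∀ z ∈ O, 0 ≤ z.2 → (∀ n, (parabolicMap a b)^[n] z ∈ V ∧ 0 ≤ ((parabolicMap a b)^[n] z).2) ∧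
        Tendsto (fun n => (parabolicMap a b)^[n] z) atTop (𝓝 (L z, 0))) ∧
      ∀ k : ℕ, ∃ F : X × ℝ → X, ContDiffOn ℝ k F O ∧ (∀ z ∈ O, 0 ≤ z.2 → F z = L z) ∧
        ∀ x, F (x, 0) = x := by
  have : CompleteSpace X := FiniteDimensional.complete ℝ X
  obtain ⟨R, hR, hRV⟩ := Metric.nhds_basis_closedBall.mem_iff.1 hV
  obtain ⟨r, ε, β, A, B, hrR, hεR⟩ :=
    exists_parabolicBox ha.continuous hb.continuous hbpos x₀ (R := R / 2) (by positivity)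
  have hε := B.ε_pos
  have hr := B.r_pos
  have hβ := B.β_pos
  set P := parabolicMap a b with hPdef
  have hPn : ∀ n, ContDiff ℝ ∞ P^[n] := contDiff_parabolicMap_iterate ha hb
  let O : Set (X × ℝ) := Metric.ball x₀ r ×ˢ Ioo (-ε) ε
  have hO : IsOpen O := Metric.isOpen_ball.prod isOpen_Ioo
  have hmem : ∀ z ∈ O, 0 ≤ z.2 → z ∈ Metric.ball x₀ r ×ˢ Ico 0 ε :=
    fun z hz h => ⟨hz.1, h, hz.2.2⟩
  have hlim : ∀ z, ∃ w, z ∈ O → 0 ≤ z.2 → Tendsto (fun n => P^[n] z) atTop (𝓝 (w, 0)) := by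
    intro z
    by_cases h : z ∈ O ∧ 0 ≤ z.2
    · obtain ⟨w, hw⟩ := B.exists_tendsto_iterate (hmem z h.1 h.2)
      exact ⟨w, fun _ _ => hw⟩
    · exact ⟨0, fun h1 h2 => absurd ⟨h1, h2⟩ h⟩
  choose L hL using hlim
  refine ⟨O, hO, ⟨Metric.mem_ball_self hr, by simp [hε]⟩, L, fun z hz h => ⟨fun n => ?_,
    hL z hz h⟩, fun k => ?_⟩
  · obtain ⟨h1, -⟩ := B.orbit (hmem z hz h) n
    refine ⟨hRV ?_, h1.2.1⟩
    have h2 : dist (P^[n] z).1 x₀ ≤ 2 * r := h1.1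
    have h3 := h1.2.1
    have h4 := h1.2.2
    rw [Metric.mem_closedBall, Prod.dist_eq, max_le_iff, Real.dist_eq, sub_zero, abs_of_nonneg h3]
    exact ⟨by linarith, by linarith⟩
  -- the limit is an approximately invariant function plus a rapidly convergent series
  obtain ⟨C, hC1, M, hCM⟩ := B.exists_norm_iteratedFDeriv_iterate_le ha hb k
  obtain ⟨Φ, h, hΦ, hh, hΦ0, hΦh⟩ := exists_approx_invariant ha hb hbpos (2 + M * k + k)
  rw [← hPdef] at hΦh hCM
  let τ : X × ℝ → X := fun z => z.2 ^ (2 + M * k + k + 2) • h z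
  have hτ : ContDiff ℝ ∞ τ := by
    have h1 : ContDiff ℝ ∞ fun z : X × ℝ => z.2 ^ (2 + M * k + k + 2) := by fun_prop
    exact h1.smul hh
  let S : X × ℝ → X := fun z => ∑' n, (τ ∘ P^[n]) z
  let s : Set (X × ℝ) := Metric.ball x₀ r ×ˢ Ioo 0 ε
  have hsO : s = O ∩ {z | 0 < z.2} := by
    ext z
    simp only [s, O, mem_prod, mem_Ioo, mem_inter_iff, mem_ofPred_eq]
    constructor
    · rintro ⟨h1, h2, h3⟩; exact ⟨⟨h1, by linarith, h3⟩, h2⟩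
    · rintro ⟨⟨h1, h2, h3⟩, h4⟩; exact ⟨h1, h4, h3⟩
  have hs : IsOpen s := Metric.isOpen_ball.prod isOpen_Ioo
  have hs' : IsPreconnected s := ((convex_ball _ _).prod (convex_Ioo _ _)).isPreconnected
  have hsI : ∀ z ∈ s, z ∈ Metric.ball x₀ r ×ˢ Ico 0 ε := fun z hz => ⟨hz.1, hz.2.1.le, hz.2.2⟩
  have hK : IsCompact (Metric.closedBall x₀ (2 * r) ×ˢ Icc 0 ε) :=
    (isCompact_closedBall _ _).prod isCompact_Icc
  have hder : ∀ j ≤ k, ∃ D, 0 ≤ D ∧ ∀ n, ∀ z ∈ s,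
      ‖iteratedFDeriv ℝ j (τ ∘ P^[n]) z‖ ≤ D * (P^[n] z).2 ^ 4 := by
    intro j hj
    have h1 : ∀ i, ∃ Ci, 0 ≤ Ci ∧ (i ≤ k → ∀ z ∈ Metric.closedBall x₀ (2 * r) ×ˢ Icc 0 ε,
        ‖iteratedFDeriv ℝ i τ z‖ ≤ Ci * z.2 ^ (M * k + 4)) := by
      intro i
      obtain ⟨Ci, hCi0, hCi⟩ := exists_norm_iteratedFDeriv_pow_smul_le hK (fun z hz => hz.2.1) i hh
        (2 + M * k + k + 2 - i)
      refine ⟨Ci, hCi0, fun hi z hz => ?_⟩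
      have e : 2 + M * k + k + 2 - i + i = 2 + M * k + k + 2 := by omega
      rw [e] at hCi
      refine (hCi z hz).trans (mul_le_mul_of_nonneg_left ?_ hCi0)
      exact pow_le_pow_of_le_one hz.2.1 (hz.2.2.trans B.ε_le) (by omega)
    choose Ci hCi0 hCi using h1
    let Cτ := ∑ i ∈ Finset.range (k + 1), Ci i
    have hCτ0 : 0 ≤ Cτ := Finset.sum_nonneg fun i _ => hCi0 i
    refine ⟨j.factorial * Cτ * C ^ j, by positivity, fun n z hz => ?_⟩
    obtain ⟨o1, o2, o3, -⟩ := B.orbit (hsI z hz) n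
    have hpos := o3 hz.2.1
    have hone : 1 ≤ (P^[n] z).2⁻¹ := (one_le_inv₀ hpos).2 (o1.2.2.trans B.ε_le)
    have hD : 1 ≤ C * ((P^[n] z).2⁻¹) ^ M := one_le_mul_of_one_le_of_one_le hC1 (one_le_pow₀ hone)
    refine (norm_iteratedFDeriv_comp_le (N := ∞) hτ (hPn n) (by exact_mod_cast le_top) z
      (C := Cτ * (P^[n] z).2 ^ (M * k + 4)) (D := C * ((P^[n] z).2⁻¹) ^ M) (fun i hi => ?_)
      (fun i hi1 hi2 => ?_)).trans ?_
    · refine (hCi i (hi.trans hj) _ o1).trans ?_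
      have : Ci i ≤ Cτ := Finset.single_le_sum (f := Ci) (fun i _ => hCi0 i)
        (Finset.mem_range.2 (by omega))
      gcongr
    · exact (hCM i hi1 (hi2.trans hj) z hz n).trans (le_self_pow₀ hD (by omega))
    · generalize (P^[n] z).2 = ρ at *
      have e1 : ρ ^ (M * k + 4) * (ρ⁻¹ ^ M) ^ j ≤ ρ ^ 4 := by
        rw [← pow_mul, pow_add]
        calc ρ ^ (M * k) * ρ ^ 4 * ρ⁻¹ ^ (M * j) ≤ ρ ^ (M * k) * ρ ^ 4 * ρ⁻¹ ^ (M * k) := by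
              gcongr
          _ = (ρ * ρ⁻¹) ^ (M * k) * ρ ^ 4 := by rw [mul_pow]; ring
          _ = ρ ^ 4 := by rw [mul_inv_cancel₀ hpos.ne', one_pow, one_mul]
      calc _ = (j.factorial * Cτ * C ^ j) * (ρ ^ (M * k + 4) * (ρ⁻¹ ^ M) ^ j) := by
            rw [mul_pow]; ring
        _ ≤ _ := by gcongr
  have hu := ParabolicBox.summable_bound hβ
  have hρu : ∀ z ∈ s, ∀ n, (P^[n] z).2 ^ 4 ≤ z.2 ^ 2 * ((1 + n * β)⁻¹) ^ 2 := by
    intro z hz n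
    obtain ⟨o1, o2, o3, -⟩ := B.orbit (hsI z hz) n
    have h1 := B.orbit_le (hsI z hz) n
    have h2 : 0 ≤ (P^[n] z).2 := o1.2.1
    calc (P^[n] z).2 ^ 4 = (P^[n] z).2 ^ 2 * (P^[n] z).2 ^ 2 := by ring
      _ ≤ _ := by gcongr
  have hder' : ∀ j ≤ k, ∃ D, ∀ n, ∀ z ∈ s,
      ‖iteratedFDeriv ℝ j (τ ∘ P^[n]) z‖ ≤ D * ((1 + n * β)⁻¹) ^ 2 := by
    intro j hj
    obtain ⟨D, hD0, hD⟩ := hder j hj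
    refine ⟨D, fun n z hz => (hD n z hz).trans (mul_le_mul_of_nonneg_left ?_ hD0)⟩
    refine (hρu z hz n).trans (mul_le_of_le_one_left (by positivity) ?_)
    exact pow_le_one₀ hz.2.1.le (hz.2.2.le.trans B.ε_le)
  obtain ⟨hS1, hS2⟩ := contDiffOn_tsum_of_isPreconnected hs hs' hu k (f := fun n => τ ∘ P^[n])
    (fun n => hτ.comp (hPn n)) hder'
  have hS3 : ContDiffOn ℝ k (fun z => if 0 < z.2 then S z else 0) O := by
    refine contDiffOn_extend_zero hO k (hsO ▸ hS1) fun j hj => ?_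
    obtain ⟨D, hD0, hD⟩ := hder j hj
    refine ⟨D * ∑' n : ℕ, ((1 + n * β)⁻¹) ^ 2, fun z hz hz0 => ?_⟩
    have hzs : z ∈ s := hsO ▸ ⟨hz, hz0⟩
    have hb : ∀ n, ‖iteratedFDeriv ℝ j (τ ∘ P^[n]) z‖ ≤ D * z.2 ^ 2 * ((1 + n * β)⁻¹) ^ 2 := by
      intro n
      refine (hD n z hzs).trans ?_
      rw [mul_assoc]
      exact mul_le_mul_of_nonneg_left (hρu z hzs n) hD0
    have hsum' := hu.mul_left (D * z.2 ^ 2)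
    refine (hS2 j hj z hzs).trans ?_
    calc _ ≤ ∑' n : ℕ, D * z.2 ^ 2 * ((1 + n * β)⁻¹) ^ 2 :=
          Summable.tsum_le_tsum hb (Summable.of_nonneg_of_le (fun n => norm_nonneg _) hb hsum') hsum'
      _ = _ := by rw [tsum_mul_left]; ring
  refine ⟨fun z => Φ z + if 0 < z.2 then S z else 0, ?_, fun z hz hz0 => ?_, fun x => by simp [hΦ0]⟩
  · exact (contDiff_infty.1 hΦ k).contDiffOn.add hS3
  · have hL' := hL z hz hz0
    beta_reduce
    rcases hz0.eq_or_lt with h0 | h0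
    · rw [if_neg (by simp [← h0]), add_zero]
      have hz' : z = (z.1, 0) := Prod.ext rfl h0.symm
      have h1 : ∀ n, P^[n] z = (z.1, 0) := fun n => by
        rw [hz']; exact ParabolicBox.iterate_of_snd_eq_zero a b _ n
      have h2 : Tendsto (fun n => P^[n] z) atTop (𝓝 (z.1, 0)) := by
        simp only [h1]; exact tendsto_const_nhds
      have h3 := congrArg Prod.fst (tendsto_nhds_unique h2 hL')
      change z.1 = L z at h3
      rw [← h3, hz', hΦ0]
    · rw [if_pos h0]
      have hzs : z ∈ s := hsO ▸ ⟨hz, h0⟩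
      have h1 : HasSum (fun n => (τ ∘ P^[n]) z) (L z - Φ z) := by
        have hsm : Summable fun n => (τ ∘ P^[n]) z := by
          obtain ⟨D, hD⟩ := hder' 0 (Nat.zero_le _)
          refine Summable.of_norm_bounded (hu.mul_left D) fun n => ?_
          simpa using hD n z hzs
        have h2 : Tendsto (fun n => ∑ i ∈ Finset.range n, (τ ∘ P^[i]) z) atTop
            (𝓝 (L z - Φ z)) := by
          have h3 : ∀ n, ∑ i ∈ Finset.range n, (τ ∘ P^[i]) z = Φ (P^[n] z) - Φ z := by
            intro n
            have h4 : ∀ i, (τ ∘ P^[i]) z = Φ (P^[i + 1] z) - Φ (P^[i] z) := fun i => by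
              rw [Function.iterate_succ_apply', hΦh]; rfl
            simp only [h4]
            exact Finset.sum_range_sub (fun i => Φ (P^[i] z)) n
          simp only [h3]
          refine Tendsto.sub_const ?_ _
          have h5 := (hΦ.continuous.tendsto (L z, 0)).comp hL'
          rwa [hΦ0] at h5
        rw [← tendsto_nhds_unique hsm.hasSum.tendsto_sum_nat h2]
        exact hsm.hasSum
      simp only [S, h1.tsum_eq]
      abel

end Parabolic

/-! ### Trajectories of a smooth vector field on an open set -/

section Trajectories

variable {E : Type} [NormedAddCommGroup E] [NormedSpace ℝ E]

/-- `y` solves `y' = f(y)` on `[0, T]` with values in `U`. -/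
def IsTrajectoryOn (f : E → E) (U : Set E) (T : ℝ) (y : ℝ → E) : Prop :=
  ∀ t ∈ Icc 0 T, y t ∈ U ∧ HasDerivWithinAt y (f (y t)) (Icc 0 T) t

/-- `y` solves `y' = f(y)` on `[0, ∞)` with values in `U`. -/
def IsTrajectory (f : E → E) (U : Set E) (y : ℝ → E) : Prop :=
  ∀ t ∈ Ici (0 : ℝ), y t ∈ U ∧ HasDerivWithinAt y (f (y t)) (Ici 0) t

variable {f : E → E} {U : Set E} {T : ℝ} {y y₁ y₂ : ℝ → E}

lemma IsTrajectoryOn.restrict (h : IsTrajectoryOn f U T y) {T' : ℝ} (hT : T' ≤ T) :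
    IsTrajectoryOn f U T' y := fun t ht =>
  ⟨(h t ⟨ht.1, ht.2.trans hT⟩).1,
    (h t ⟨ht.1, ht.2.trans hT⟩).2.mono (Icc_subset_Icc_right hT)⟩

lemma IsTrajectory.restrict (h : IsTrajectory f U y) (T : ℝ) : IsTrajectoryOn f U T y :=
  fun t ht => ⟨(h t ht.1).1, (h t ht.1).2.mono Icc_subset_Ici_self⟩

lemma IsTrajectory.shift (h : IsTrajectory f U y) {s : ℝ} (hs : 0 ≤ s) :
    IsTrajectory f U fun t => y (t + s) := by
  intro t ht
  have ht' : (0 : ℝ) ≤ t := ht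
  have h1 := h (t + s) (by simp only [mem_Ici]; linarith)
  refine ⟨h1.1, ?_⟩
  have h2 : HasDerivWithinAt (fun t : ℝ => t + s) 1 (Ici 0) t :=
    ((hasDerivAt_id' t).add_const s).hasDerivWithinAt
  have h3 := h1.2.scomp t h2 (fun r hr => by
    simp only [mem_Ici] at hr ⊢; linarith)
  simpa [Function.comp_def] using h3

lemma IsTrajectoryOn.continuousOn (h : IsTrajectoryOn f U T y) : ContinuousOn y (Icc 0 T) :=
  fun t ht => (h t ht).2.continuousWithinAt

lemma exists_lipschitzOnWith_of_isCompact (hU : IsOpen U) (hf : ContDiffOn ℝ ∞ f U) {C : Set E}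
    (hC : IsCompact C) (hCU : C ⊆ U) : ∃ K, LipschitzOnWith K f C := by
  refine LocallyLipschitzOn.exists_lipschitzOnWith_of_compact hC fun x hx => ?_
  have h1 : ContDiffAt ℝ 1 f x :=
    (hf.contDiffAt (hU.mem_nhds (hCU hx))).of_le (by exact_mod_cast le_top)
  obtain ⟨K, t, ht, hK⟩ := h1.exists_lipschitzOnWith
  exact ⟨K, t, mem_nhdsWithin_of_mem_nhds ht, hK⟩

lemma IsTrajectoryOn.eqOn (hU : IsOpen U) (hf : ContDiffOn ℝ ∞ f U)
    (h₁ : IsTrajectoryOn f U T y₁) (h₂ : IsTrajectoryOn f U T y₂) (h0 : y₁ 0 = y₂ 0) :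
    EqOn y₁ y₂ (Icc 0 T) := by
  have hC : IsCompact (y₁ '' Icc 0 T ∪ y₂ '' Icc 0 T) :=
    (isCompact_Icc.image_of_continuousOn h₁.continuousOn).union
      (isCompact_Icc.image_of_continuousOn h₂.continuousOn)
  obtain ⟨K, hK⟩ := exists_lipschitzOnWith_of_isCompact hU hf hC (by
    rintro _ (⟨t, ht, rfl⟩ | ⟨t, ht, rfl⟩)
    exacts [(h₁ t ht).1, (h₂ t ht).1])
  have hder : ∀ {y : ℝ → E}, IsTrajectoryOn f U T y → ∀ t ∈ Ico 0 T,
      HasDerivWithinAt y (f (y t)) (Ici t) t := fun h t ht =>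
    ((h t (Ico_subset_Icc_self ht)).2.mono (Icc_subset_Icc_left ht.1)).mono_of_mem_nhdsWithin
      (Icc_mem_nhdsGE ht.2)
  exact ODE_solution_unique_of_mem_Icc_right (v := fun _ => f)
    (s := fun _ => y₁ '' Icc 0 T ∪ y₂ '' Icc 0 T) (fun _ _ => hK) h₁.continuousOn (hder h₁)
    (fun t ht => Or.inl ⟨t, Ico_subset_Icc_self ht, rfl⟩) h₂.continuousOn (hder h₂)
    (fun t ht => Or.inr ⟨t, Ico_subset_Icc_self ht, rfl⟩) h0

lemma IsTrajectory.eqOn (hU : IsOpen U) (hf : ContDiffOn ℝ ∞ f U)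
    (h₁ : IsTrajectory f U y₁) (h₂ : IsTrajectory f U y₂) (h0 : y₁ 0 = y₂ 0) :
    EqOn y₁ y₂ (Ici 0) := fun t ht =>
  (h₁.restrict t).eqOn hU hf (h₂.restrict t) h0 ⟨ht, le_rfl⟩

/-- Concatenation of trajectories. -/
lemma IsTrajectoryOn.concat {T₁ T₂ : ℝ} (h₁ : IsTrajectoryOn f U T₁ y₁)
    (h₂ : IsTrajectoryOn f U T₂ y₂) (hT₁ : 0 ≤ T₁) (hT₂ : 0 ≤ T₂) (h : y₂ 0 = y₁ T₁) :
    IsTrajectoryOn f U (T₁ + T₂) fun t => if t ≤ T₁ then y₁ t else y₂ (t - T₁) := by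
  set y : ℝ → E := fun t => if t ≤ T₁ then y₁ t else y₂ (t - T₁) with hy
  have e1 : ∀ t ≤ T₁, y t = y₁ t := fun t ht => if_pos ht
  have e2 : ∀ t, T₁ ≤ t → y t = y₂ (t - T₁) := by
    intro t ht
    rcases ht.eq_or_lt with rfl | h'
    · simp [hy, h]
    · exact if_neg (not_le.2 h')
  have d1 : ∀ t ∈ Icc 0 T₁, HasDerivWithinAt y (f (y t)) (Icc 0 T₁) t := fun t ht => by
    rw [e1 t ht.2]
    exact (h₁ t ht).2.congr (fun s hs => e1 s hs.2) (e1 t ht.2)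
  have d2 : ∀ t ∈ Icc T₁ (T₁ + T₂), HasDerivWithinAt y (f (y t)) (Icc T₁ (T₁ + T₂)) t := by
    intro t ht
    have ht' : t - T₁ ∈ Icc 0 T₂ := ⟨by linarith [ht.1], by linarith [ht.2]⟩
    rw [e2 t ht.1]
    have h3 : HasDerivWithinAt (fun t : ℝ => t - T₁) 1 (Icc T₁ (T₁ + T₂)) t :=
      ((hasDerivAt_id' t).sub_const T₁).hasDerivWithinAt
    have hm : MapsTo (fun t : ℝ => t - T₁) (Icc T₁ (T₁ + T₂)) (Icc 0 T₂) := fun r hr =>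
      ⟨by linarith [hr.1], by linarith [hr.2]⟩
    have h4 := (h₂ _ ht').2.scomp t h3 hm
    rw [one_smul] at h4
    exact h4.congr (fun s hs => e2 s hs.1) (e2 t ht.1)
  intro t ht
  refine ⟨?_, ?_⟩
  · rcases le_total t T₁ with h' | h'
    · rw [e1 t h']; exact (h₁ t ⟨ht.1, h'⟩).1
    · rw [e2 t h']; exact (h₂ _ ⟨by linarith, by linarith [ht.2]⟩).1
  · rcases lt_trichotomy t T₁ with h' | h' | h'
    · exact (d1 t ⟨ht.1, h'.le⟩).mono_of_mem_nhdsWithin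
        (mem_nhdsWithin.2 ⟨Iio T₁, isOpen_Iio, h', fun s hs => ⟨hs.2.1, le_of_lt hs.1⟩⟩)
    · have h5 := (d1 t ⟨ht.1, h'.le⟩).union (d2 t ⟨h'.ge, ht.2⟩)
      rwa [Icc_union_Icc_eq_Icc hT₁ (by linarith)] at h5
    · exact (d2 t ⟨h'.le, ht.2⟩).mono_of_mem_nhdsWithin
        (mem_nhdsWithin.2 ⟨Ioi T₁, isOpen_Ioi, h', fun s hs => ⟨le_of_lt hs.1, hs.2.2⟩⟩)

/-- Trajectories on all intervals `[0, n]` are restrictions of one trajectory on `[0, ∞)`. -/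
lemma exists_isTrajectory (hU : IsOpen U) (hf : ContDiffOn ℝ ∞ f U) {x : E}
    (h : ∀ n : ℕ, ∃ y, y 0 = x ∧ IsTrajectoryOn f U n y) :
    ∃ y, y 0 = x ∧ IsTrajectory f U y := by
  choose y hy0 hy using h
  let N : ℝ → ℕ := fun t => ⌈t⌉₊ + 1
  have hN : ∀ t, t < N t := fun t => (Nat.le_ceil t).trans_lt (by simp [N])
  have heq : ∀ n : ℕ, ∀ s ∈ Icc (0 : ℝ) n, y (N s) s = y n s := by
    intro n s hs
    have h1 := ((hy (N s)).restrict (T' := min (N s) n) (min_le_left _ _)).eqOn hU hf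
      ((hy n).restrict (min_le_right _ _)) (by rw [hy0, hy0])
    exact h1 ⟨hs.1, le_min (hN s).le hs.2⟩
  refine ⟨fun t => y (N t) t, hy0 _, fun t ht => ?_⟩
  have h1 := hy (N t) t ⟨ht, (hN t).le⟩
  refine ⟨h1.1, ?_⟩
  have h2 : HasDerivWithinAt (fun s => y (N s) s) (f (y (N t) t)) (Icc 0 (N t)) t :=
    h1.2.congr (fun s hs => heq _ s hs) rfl
  exact h2.mono_of_mem_nhdsWithin
    (mem_nhdsWithin.2 ⟨Iio (N t), isOpen_Iio, hN t, fun s hs => ⟨hs.2, le_of_lt hs.1⟩⟩)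

lemma IsTrajectoryOn.reverse (h : IsTrajectoryOn f U T y) :
    IsTrajectoryOn (fun x => -f x) U T fun t => y (T - t) := by
  intro t ht
  have ht' : T - t ∈ Icc 0 T := ⟨by linarith [ht.2], by linarith [ht.1]⟩
  refine ⟨(h _ ht').1, ?_⟩
  have h3 : HasDerivWithinAt (fun t : ℝ => T - t) (-1) (Icc 0 T) t :=
    ((hasDerivAt_id' t).const_sub T).hasDerivWithinAt
  have hm : MapsTo (fun t : ℝ => T - t) (Icc 0 T) (Icc 0 T) := fun r hr =>
    ⟨by linarith [hr.2], by linarith [hr.1]⟩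
  have h4 := (h _ ht').2.scomp t h3 hm
  simpa [Function.comp_def] using h4

/-- The flow for time `T` is defined and smooth near `x`. -/
def HasSmoothFlow (f : E → E) (U : Set E) (T : ℝ) (x : E) : Prop :=
  ∃ V : Set E, IsOpen V ∧ x ∈ V ∧ ∃ ψ : E → E, ContDiffOn ℝ ∞ ψ V ∧
    ∀ z ∈ V, ∃ y, y 0 = z ∧ y T = ψ z ∧ IsTrajectoryOn f U T y

lemma HasSmoothFlow.concat {T₁ T₂ : ℝ} {x : E} (hT₁ : 0 ≤ T₁) (hT₂ : 0 ≤ T₂)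
    (hy : IsTrajectoryOn f U T₁ y) (hU : IsOpen U) (hf : ContDiffOn ℝ ∞ f U) (hx : y 0 = x)
    (h₁ : HasSmoothFlow f U T₁ x) (h₂ : HasSmoothFlow f U T₂ (y T₁)) :
    HasSmoothFlow f U (T₁ + T₂) x := by
  obtain ⟨V₁, hV₁, hx₁, ψ₁, hψ₁, hs₁⟩ := h₁
  obtain ⟨V₂, hV₂, hx₂, ψ₂, hψ₂, hs₂⟩ := h₂
  have hψx : ψ₁ x = y T₁ := by
    obtain ⟨z, hz0, hzT, hz⟩ := hs₁ x hx₁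
    rw [← hzT]
    exact hz.eqOn hU hf hy (by rw [hz0, hx]) ⟨hT₁, le_rfl⟩
  refine ⟨V₁ ∩ ψ₁ ⁻¹' V₂, hψ₁.continuousOn.isOpen_inter_preimage hV₁ hV₂, ⟨hx₁, by
    rwa [mem_preimage, hψx]⟩, ψ₂ ∘ ψ₁, hψ₂.comp (hψ₁.mono inter_subset_left) fun z hz => hz.2,
    fun z hz => ?_⟩
  obtain ⟨u, hu0, huT, hu⟩ := hs₁ z hz.1
  obtain ⟨w, hw0, hwT, hw⟩ := hs₂ (ψ₁ z) hz.2
  refine ⟨_, ?_, ?_, hu.concat hw hT₁ hT₂ (by rw [hw0, huT])⟩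
  · simp [hT₁, hu0]
  · rcases hT₂.eq_or_lt with rfl | h
    · simp only [add_zero, le_refl, if_true, huT, Function.comp_apply]
      rw [← hwT, hw0]
    · simp [h, hwT]

/-- Short-time smooth flows exist near every point. -/
lemma exists_hasSmoothFlow_nhds [FiniteDimensional ℝ E] (hU : IsOpen U)
    (hf : ContDiffOn ℝ ∞ f U) {x : E} (hx : x ∈ U) :
    ∃ V ∈ 𝓝 x, ∃ ε > 0, ∀ z ∈ V, ∀ τ ∈ Icc 0 ε, HasSmoothFlow f U τ z := by
  have : CompleteSpace E := FiniteDimensional.complete ℝ E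
  obtain ⟨F, hF, hFf, -⟩ := exists_contDiff_extension hU hf hx (0 : E) convex_univ (mem_univ _)
    (fun _ _ => mem_univ _)
  obtain ⟨W, hW, hWo, hxW⟩ := eventually_nhds_iff.1 (hFf.and (hU.mem_nhds hx))
  have hg : ContDiff ℝ ∞ fun p : ℝ × E => F p.2 := by fun_prop
  obtain ⟨O, hO, hxO, α, hα, heq⟩ := exists_contDiffOn_perturbation hg x
  obtain ⟨r, hr, hrW⟩ := Metric.isOpen_iff.1 hWo x hxW
  -- near `(x, 0)` the curves stay in `W`
  have hconst : α (x, 0) = constCurve E x := by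
    ext t; rw [heq _ hxO]; simp
  have hO' : IsOpen (O ∩ α ⁻¹' Metric.ball (constCurve E x) r) :=
    hα.continuousOn.isOpen_inter_preimage hO Metric.isOpen_ball
  have hxO' : (x, (0 : ℝ)) ∈ O ∩ α ⁻¹' Metric.ball (constCurve E x) r :=
    ⟨hxO, by rw [mem_preimage, hconst]; exact Metric.mem_ball_self hr⟩
  obtain ⟨V, hV, J, hJ, hVJ⟩ := mem_nhds_prod_iff.1 (hO'.mem_nhds hxO')
  obtain ⟨V', hV'V, hV'o, hxV'⟩ := mem_nhds_iff.1 hV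
  obtain ⟨ε, hε, hεJ⟩ := Metric.nhds_basis_closedBall.mem_iff.1 hJ
  refine ⟨V', hV'o.mem_nhds hxV', ε, hε, fun z hz τ hτ => ?_⟩
  have hτJ : τ ∈ J := hεJ (by simpa [abs_of_nonneg hτ.1] using hτ.2)
  have hmem : ∀ z ∈ V', (z, τ) ∈ O ∧ α (z, τ) ∈ Metric.ball (constCurve E x) r :=
    fun z hz => hVJ ⟨hV'V hz, hτJ⟩
  refine ⟨V', hV'o, hz, fun z => α (z, τ) 1, ?_, fun z hz => ?_⟩
  · have h1 : ContDiffOn ℝ ∞ (fun z : E => α (z, τ)) V' :=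
      hα.comp (contDiff_id.prodMk contDiff_const).contDiffOn fun z hz => (hmem z hz).1
    exact (ContinuousMap.evalCLM ℝ (1 : unitInterval)).contDiff.comp_contDiffOn h1
  · have heq' := heq _ (hmem z hz).1
    have hW' : ∀ t, α (z, τ) t ∈ W := fun t => by
      apply hrW
      have := (hmem z hz).2
      exact lt_of_le_of_lt (ContinuousMap.dist_apply_le_dist (f := α (z, τ)) (g := constCurve E x) t) this
    rcases hτ.1.eq_or_lt with h0 | h0
    · refine ⟨fun _ => z, rfl, ?_, ?_⟩
      · beta_reduce; rw [heq', ← h0]; simp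
      · intro t ht
        have ht0 : Icc 0 τ ⊆ {t} := by
          rw [← h0] at ht ⊢
          rw [Icc_self] at ht ⊢
          rw [mem_singleton_iff.1 ht]
        refine ⟨?_, (HasFDerivWithinAt.of_subsingleton
          (subsingleton_singleton.anti ht0))⟩
        have h2 := (hW _ (hW' 0)).2
        rwa [heq', ← h0, zero_smul, add_zero] at h2
    · refine ⟨fun t => α (z, τ) (projIcc 0 1 zero_le_one (t / τ)), ?_, ?_, fun t ht => ?_⟩
      · have : (projIcc (0 : ℝ) 1 zero_le_one (0 / τ)) = 0 := by rw [zero_div]; exact projIcc_left _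
        beta_reduce
        rw [this, heq']; simp [primitive_apply]
      · beta_reduce
        rw [div_self h0.ne']
        congr 1
        exact projIcc_right _
      · refine ⟨(hW _ (hW' _)).2, ?_⟩
        have ht' : t / τ ∈ Icc (0 : ℝ) 1 := ⟨div_nonneg ht.1 h0.le, (div_le_one h0).2 ht.2⟩
        have h1 := hasDerivWithinAt_of_eq_primitive heq' ht'
        have h2 : HasDerivWithinAt (fun t : ℝ => t / τ) (1 / τ) (Icc 0 τ) t :=
          ((hasDerivAt_id' t).div_const τ).hasDerivWithinAt
        have hm : MapsTo (fun t : ℝ => t / τ) (Icc 0 τ) (Icc 0 1) := fun s hs =>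
          ⟨div_nonneg hs.1 h0.le, (div_le_one h0).2 hs.2⟩
        have h3 := h1.scomp t h2 hm
        refine h3.congr_deriv ?_
        rw [smul_smul, one_div, inv_mul_cancel₀ h0.ne', one_smul]
        exact (hW _ (hW' _)).1

/-- On compact sets the short-time flows have a uniform time of existence. -/
lemma exists_hasSmoothFlow_of_isCompact [FiniteDimensional ℝ E] (hU : IsOpen U)
    (hf : ContDiffOn ℝ ∞ f U) {K : Set E} (hK : IsCompact K) (hKU : K ⊆ U) :
    ∃ ε > 0, ∀ z ∈ K, ∀ τ ∈ Icc 0 ε, HasSmoothFlow f U τ z := by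
  refine hK.induction_on (p := fun s => ∃ ε > 0, ∀ z ∈ s, ∀ τ ∈ Icc 0 ε, HasSmoothFlow f U τ z)
    ⟨1, one_pos, by simp⟩ (fun s t hst ⟨ε, h1, h2⟩ => ⟨ε, h1, fun z hz => h2 z (hst hz)⟩) ?_ ?_
  · rintro s t ⟨ε, h1, h2⟩ ⟨ε', h1', h2'⟩
    refine ⟨min ε ε', lt_min h1 h1', ?_⟩
    rintro z (hz | hz) τ hτ
    · exact h2 z hz τ ⟨hτ.1, hτ.2.trans (min_le_left _ _)⟩
    · exact h2' z hz τ ⟨hτ.1, hτ.2.trans (min_le_right _ _)⟩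
  · intro x hx
    obtain ⟨V, hV, h⟩ := exists_hasSmoothFlow_nhds hU hf (hKU hx)
    exact ⟨V, mem_nhdsWithin_of_mem_nhds hV, h⟩

/-- Smooth dependence on initial conditions along a given trajectory. -/
theorem IsTrajectoryOn.hasSmoothFlow [FiniteDimensional ℝ E] (hU : IsOpen U)
    (hf : ContDiffOn ℝ ∞ f U) (hT : 0 ≤ T) (hy : IsTrajectoryOn f U T y) :
    HasSmoothFlow f U T (y 0) := by
  have hK : IsCompact (y '' Icc 0 T) := isCompact_Icc.image_of_continuousOn hy.continuousOn
  obtain ⟨ε, hε, h⟩ := exists_hasSmoothFlow_of_isCompact hU hf hK (by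
    rintro _ ⟨t, ht, rfl⟩; exact (hy t ht).1)
  obtain ⟨n, hn⟩ := exists_nat_ge (T / ε)
  have hn0 : (0 : ℝ) < n + 1 := by positivity
  have hstep0 : 0 ≤ T / (n + 1) := by positivity
  have hstep : T / (n + 1) ≤ ε := by
    rw [div_le_iff₀ hε] at hn
    rw [div_le_iff₀ hn0]; nlinarith
  have key : ∀ k : ℕ, k ≤ n + 1 → HasSmoothFlow f U (k * (T / (n + 1))) (y 0) := by
    intro k
    induction k with
    | zero =>
      intro _
      rw [Nat.cast_zero, zero_mul]
      exact h _ ⟨0, ⟨le_rfl, hT⟩, rfl⟩ 0 ⟨le_rfl, hε.le⟩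
    | succ k ih =>
      intro hk
      have hk' : (k : ℝ) * (T / (n + 1)) ≤ T := by
        have : (k : ℝ) ≤ n + 1 := by exact_mod_cast (Nat.le_succ k).trans hk
        calc (k : ℝ) * (T / (n + 1)) ≤ (n + 1) * (T / (n + 1)) := by gcongr
          _ = T := by field_simp
      have h1 := HasSmoothFlow.concat (by positivity) hstep0 (hy.restrict hk') hU hf rfl
        (ih (by omega)) (h _ ⟨_, ⟨by positivity, hk'⟩, rfl⟩ _ ⟨hstep0, hstep⟩)
      have e : ((k + 1 : ℕ) : ℝ) * (T / (n + 1)) = k * (T / (n + 1)) + T / (n + 1) := by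
        push_cast; ring
      rwa [e]
  have := key (n + 1) le_rfl
  have e : ((n + 1 : ℕ) : ℝ) * (T / (n + 1)) = T := by push_cast; field_simp
  rwa [e] at this

/-- If trajectories starting at `x` cannot leave compact sets in finite time, then there is a
trajectory on `[0, ∞)`. -/
theorem exists_isTrajectory_of_isCompact [FiniteDimensional ℝ E] (hU : IsOpen U)
    (hf : ContDiffOn ℝ ∞ f U) {x : E} (hx : x ∈ U)
    (h : ∀ T : ℝ, ∃ K ⊆ U, IsCompact K ∧ ∀ T' ∈ Icc 0 T, ∀ y, y 0 = x → IsTrajectoryOn f U T' y →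
      y T' ∈ K) :
    ∃ y, y 0 = x ∧ IsTrajectory f U y := by
  refine exists_isTrajectory hU hf fun N => ?_
  obtain ⟨K, hKU, hK, hmem⟩ := h N
  obtain ⟨ε, hε, hflow⟩ := exists_hasSmoothFlow_of_isCompact hU hf hK hKU
  have key : ∀ k : ℕ, ∃ y, y 0 = x ∧ IsTrajectoryOn f U (min (k * ε) N) y := by
    intro k
    induction k with
    | zero =>
      refine ⟨fun _ => x, rfl, fun t ht => ⟨hx, ?_⟩⟩
      have ht0 : Icc 0 (min (((0 : ℕ) : ℝ) * ε) N) ⊆ {t} := by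
        have e : min (((0 : ℕ) : ℝ) * ε) N = 0 := by simp
        rw [e, Icc_self] at ht ⊢
        rw [mem_singleton_iff.1 ht]
      exact (HasFDerivWithinAt.of_subsingleton (subsingleton_singleton.anti ht0))
    | succ k ih =>
      obtain ⟨y, hy0, hy⟩ := ih
      set T' := min ((k : ℝ) * ε) N
      have hT' : T' ∈ Icc (0 : ℝ) N := ⟨by positivity, min_le_right _ _⟩
      obtain ⟨V, -, hxV, ψ, -, hs⟩ := hflow _ (hmem T' hT' y hy0 hy) ε ⟨hε.le, le_rfl⟩
      obtain ⟨z, hz0, -, hz⟩ := hs _ hxV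
      refine ⟨_, ?_, (hy.concat hz hT'.1 hε.le hz0).restrict ?_⟩
      · simp [hT'.1, hy0]
      · push_cast
        rcases le_total ((k : ℝ) * ε) N with h | h
        · refine (min_le_left _ _).trans (le_of_eq ?_)
          simp only [T', min_eq_left h]; ring
        · refine (min_le_right _ _).trans ?_
          simp only [T', min_eq_right h]; linarith
  obtain ⟨k, hk⟩ := exists_nat_ge (N / ε)
  obtain ⟨y, hy0, hy⟩ := key k
  rw [div_le_iff₀ hε] at hk
  exact ⟨y, hy0, by rwa [min_eq_right hk] at hy⟩

/-- The flow along a trajectory is a local diffeomorphism. -/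
theorem IsTrajectoryOn.exists_openPartialHomeomorph [FiniteDimensional ℝ E] (hU : IsOpen U)
    (hf : ContDiffOn ℝ ∞ f U) (hT : 0 ≤ T) (hy : IsTrajectoryOn f U T y) :
    ∃ e : OpenPartialHomeomorph E E, y 0 ∈ e.source ∧ e (y 0) = y T ∧
      ContDiffOn ℝ ∞ e e.source ∧ ContDiffOn ℝ ∞ e.symm e.target ∧
      ∀ z ∈ e.source, ∃ u, u 0 = z ∧ u T = e z ∧ IsTrajectoryOn f U T u := by
  obtain ⟨V, hV, hxV, ψ, hψ, hs⟩ := hy.hasSmoothFlow hU hf hT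
  have hf' : ContDiffOn ℝ ∞ (fun x => -f x) U := hf.neg
  have h1 := hy.reverse.hasSmoothFlow hU hf' hT
  rw [sub_zero] at h1
  obtain ⟨V', hV', hxV', ψ', hψ', hs'⟩ := h1
  have hψx : ψ (y 0) = y T := by
    obtain ⟨z, hz0, hzT, hz⟩ := hs _ hxV
    rw [← hzT]
    exact hz.eqOn hU hf hy hz0 ⟨hT, le_rfl⟩
  have hl : ∀ z ∈ V, ψ z ∈ V' → ψ' (ψ z) = z := by
    intro z hz hz'
    obtain ⟨u, hu0, huT, hu⟩ := hs z hz
    obtain ⟨w, hw0, hwT, hw⟩ := hs' _ hz'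
    have := hw.eqOn hU hf' hu.reverse (by rw [hw0, sub_zero, huT]) ⟨hT, le_rfl⟩
    rw [← hwT, this]
    beta_reduce
    rw [sub_self, hu0]
  have hr : ∀ z ∈ V', ψ' z ∈ V → ψ (ψ' z) = z := by
    intro z hz hz'
    obtain ⟨u, hu0, huT, hu⟩ := hs' z hz
    obtain ⟨w, hw0, hwT, hw⟩ := hs _ hz'
    have hu' := hu.reverse
    simp only [neg_neg] at hu'
    have := hw.eqOn hU hf hu' (by rw [hw0, sub_zero, huT]) ⟨hT, le_rfl⟩
    rw [← hwT, this]
    beta_reduce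
    rw [sub_self, hu0]
  have hso : IsOpen (V ∩ ψ ⁻¹' V') := hψ.continuousOn.isOpen_inter_preimage hV hV'
  have hto : IsOpen (V' ∩ ψ' ⁻¹' V) := hψ'.continuousOn.isOpen_inter_preimage hV' hV
  let e : OpenPartialHomeomorph E E :=
    { toFun := ψ
      invFun := ψ'
      source := V ∩ ψ ⁻¹' V'
      target := V' ∩ ψ' ⁻¹' V
      map_source' := fun z hz => ⟨hz.2, by rw [mem_preimage, hl z hz.1 hz.2]; exact hz.1⟩
      map_target' := fun z hz => ⟨hz.2, by rw [mem_preimage, hr z hz.1 hz.2]; exact hz.1⟩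
      left_inv' := fun z hz => hl z hz.1 hz.2
      right_inv' := fun z hz => hr z hz.1 hz.2
      open_source := hso
      open_target := hto
      continuousOn_toFun := hψ.continuousOn.mono inter_subset_left
      continuousOn_invFun := hψ'.continuousOn.mono inter_subset_left }
  exact ⟨e, ⟨hxV, by rwa [mem_preimage, hψx]⟩, hψx, hψ.mono inter_subset_left,
    hψ'.mono inter_subset_left, fun z hz => hs z hz.1⟩

end Trajectories

/-! ### The reduced system with its angle -/

section Calculus

variable {E F : Type} [NormedAddCommGroup E] [NormedSpace ℝ E] [NormedAddCommGroup F]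
  [NormedSpace ℝ F]

lemma hasDerivWithinAt_fst {y : ℝ → E × F} {y' : E × F} {s : Set ℝ} {t : ℝ}
    (h : HasDerivWithinAt y y' s t) : HasDerivWithinAt (fun t => (y t).1) y'.1 s t :=
  (ContinuousLinearMap.fst ℝ E F).hasFDerivAt.comp_hasDerivWithinAt t h

lemma hasDerivWithinAt_snd {y : ℝ → E × F} {y' : E × F} {s : Set ℝ} {t : ℝ}
    (h : HasDerivWithinAt y y' s t) : HasDerivWithinAt (fun t => (y t).2) y'.2 s t :=
  (ContinuousLinearMap.snd ℝ E F).hasFDerivAt.comp_hasDerivWithinAt t h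

lemma hasDerivWithinAt_Ici_of_Icc {f : ℝ → E} {f' : E} {T t : ℝ} (ht : t ∈ Ico 0 T)
    (h : HasDerivWithinAt f f' (Icc 0 T) t) : HasDerivWithinAt f f' (Ici t) t :=
  (h.mono (Icc_subset_Icc_left ht.1)).mono_of_mem_nhdsWithin (Icc_mem_nhdsGE ht.2)

lemma le_add_mul_of_hasDerivWithinAt_le {f f' : ℝ → ℝ} {T c : ℝ}
    (h : ∀ t ∈ Icc 0 T, HasDerivWithinAt f (f' t) (Icc 0 T) t)
    (hc : ∀ t ∈ Icc 0 T, f' t ≤ c) : ∀ t ∈ Icc 0 T, f t ≤ f 0 + c * t := by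
  intro t ht
  refine image_le_of_deriv_right_le_deriv_boundary (B' := fun _ => c)
    (B := fun t => f 0 + c * t) (fun t ht => (h t ht).continuousWithinAt)
    (fun t ht => hasDerivWithinAt_Ici_of_Icc ht (h t (Ico_subset_Icc_self ht))) (by simp)
    (by fun_prop) (fun t _ => ?_) (fun t ht => hc t (Ico_subset_Icc_self ht)) ht
  simpa using (((hasDerivAt_id' t).const_mul c).const_add (f 0)).hasDerivWithinAt

/-- A solution of `x' = m(t) f(x)` is a time change of the solution of `y' = f(y)`. -/
lemma IsTrajectory.eq_comp_of_timeChange {f : E → E} {U : Set E} (hU : IsOpen U)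
    (hf : ContDiffOn ℝ ∞ f U) {y : ℝ → E} (hy : IsTrajectory f U y) {x : ℝ → E} {m σ : ℝ → ℝ}
    (hm : ContinuousOn m (Icc 0 1))
    (hσ : ∀ t ∈ Icc (0 : ℝ) 1, 0 ≤ σ t ∧ HasDerivWithinAt σ (m t) (Icc 0 1) t)
    (hx : ∀ t ∈ Icc (0 : ℝ) 1, x t ∈ U ∧ HasDerivWithinAt x (m t • f (x t)) (Icc 0 1) t)
    (h0 : x 0 = y (σ 0)) : ∀ t ∈ Icc (0 : ℝ) 1, x t = y (σ t) := by
  have hyσ : ∀ t ∈ Icc (0 : ℝ) 1,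
      HasDerivWithinAt (fun t => y (σ t)) (m t • f (y (σ t))) (Icc 0 1) t := fun t ht =>
    (hy _ (hσ t ht).1).2.scomp t (hσ t ht).2 fun s hs => (hσ s hs).1
  have hxc : ContinuousOn x (Icc 0 1) := fun t ht => (hx t ht).2.continuousWithinAt
  have hyc : ContinuousOn (fun t => y (σ t)) (Icc 0 1) := fun t ht =>
    (hyσ t ht).continuousWithinAt
  obtain ⟨K, hK⟩ := exists_lipschitzOnWith_of_isCompact hU hf
    ((isCompact_Icc.image_of_continuousOn hxc).union (isCompact_Icc.image_of_continuousOn hyc)) (by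
    rintro _ (⟨t, ht, rfl⟩ | ⟨t, ht, rfl⟩)
    exacts [(hx t ht).1, (hy _ (hσ t ht).1).1])
  obtain ⟨M, hM⟩ := isCompact_Icc.exists_bound_of_continuousOn hm
  exact ODE_solution_unique_of_mem_Icc_right (v := fun t x => m t • f x) (K := M.toNNReal * K)
    (s := fun _ => x '' Icc 0 1 ∪ (fun t => y (σ t)) '' Icc 0 1)
    (fun t ht => by
      refine LipschitzOnWith.of_dist_le_mul fun a ha b hb => ?_
      have h1 := hK.dist_le_mul a ha b hb
      have h2 := hM t (Ico_subset_Icc_self ht)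
      have h3 : M ≤ M.toNNReal := Real.le_coe_toNNReal M
      rw [dist_eq_norm, ← smul_sub, norm_smul, ← dist_eq_norm, NNReal.coe_mul, mul_assoc]
      exact mul_le_mul (h2.trans h3) h1 dist_nonneg (by positivity)) hxc
    (fun t ht => hasDerivWithinAt_Ici_of_Icc ht (hx t (Ico_subset_Icc_self ht)).2)
    (fun t ht => Or.inl ⟨t, Ico_subset_Icc_self ht, rfl⟩) hyc
    (fun t ht => hasDerivWithinAt_Ici_of_Icc ht (hyσ t (Ico_subset_Icc_self ht)))
    (fun t ht => Or.inr ⟨t, Ico_subset_Icc_self ht, rfl⟩) h0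

end Calculus

/-- The reduced system together with the polar angle `θ`, `θ' = 1 / r₁²`. -/
noncomputable def extField (δ : ℝ) (x : (ℝ × ℝ × ℝ) × ℝ) : (ℝ × ℝ × ℝ) × ℝ :=
  (vectorField δ x.1, (x.1.1 ^ 2)⁻¹)

/-- The open set `{r₁ > 0}` of the extended phase space. -/
def extDomain : Set ((ℝ × ℝ × ℝ) × ℝ) := {x | 0 < x.1.1}

/-- The open set `{r₁ > 0}` of the phase space. -/
def posDomain : Set (ℝ × ℝ × ℝ) := {p | 0 < p.1}

/-- The eccentricity vector in the rotating frame, `Z = (1 / r₁ - 1) - i v`; `|Z|² = 2 H`. -/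
noncomputable def rotEcc (p : ℝ × ℝ × ℝ) : ℂ := ⟨p.1⁻¹ - 1, -p.2.1⟩

/-- The inverse of `p ↦ (rotEcc p, l)`. -/
noncomputable def ofRotEcc (z : ℂ × ℝ) : ℝ × ℝ × ℝ := ((1 + z.1.re)⁻¹, -z.1.im, z.2)

@[simp] lemma rotEcc_re (p : ℝ × ℝ × ℝ) : (rotEcc p).re = p.1⁻¹ - 1 := rfl
@[simp] lemma rotEcc_im (p : ℝ × ℝ × ℝ) : (rotEcc p).im = -p.2.1 := rfl

lemma rotEcc_ofRotEcc (z : ℂ × ℝ) : rotEcc (ofRotEcc z) = z.1 := by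
  apply Complex.ext <;> simp [ofRotEcc]

lemma ofRotEcc_rotEcc (p : ℝ × ℝ × ℝ) : ofRotEcc (rotEcc p, p.2.2) = p := by
  simp [ofRotEcc]

lemma isOpen_extDomain : IsOpen extDomain :=
  isOpen_lt continuous_const (by fun_prop)

lemma isOpen_posDomain : IsOpen posDomain :=
  isOpen_lt continuous_const (by fun_prop)

lemma contDiffOn_vectorField (δ : ℝ) : ContDiffOn ℝ ∞ (vectorField δ) posDomain := by
  have h : ∀ p ∈ posDomain, p.1 ^ 3 ≠ 0 := fun p hp => pow_ne_zero _ (ne_of_gt hp)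
  unfold vectorField
  fun_prop (disch := assumption)

lemma contDiffOn_extField (δ : ℝ) : ContDiffOn ℝ ∞ (extField δ) extDomain := by
  have h : ∀ p ∈ extDomain, p.1.1 ^ 2 ≠ 0 := fun p hp => pow_ne_zero _ (ne_of_gt hp)
  refine ContDiffOn.prodMk ((contDiffOn_vectorField δ).comp contDiff_fst.contDiffOn
    fun x hx => hx) ?_
  exact ContDiffOn.inv (by fun_prop) h

/-- The explicit solution of `l' = -δ l⁴`. -/
noncomputable def radialDecay (δ l₀ s : ℝ) : ℝ := l₀ * (1 + 3 * δ * l₀ ^ 3 * s) ^ (-(1 / 3) : ℝ)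

lemma hasDerivAt_radialDecay {δ l₀ s : ℝ} (h : 0 < 1 + 3 * δ * l₀ ^ 3 * s) :
    HasDerivAt (radialDecay δ l₀) (-δ * radialDecay δ l₀ s ^ 4) s := by
  have h1 : HasDerivAt (fun s => 1 + 3 * δ * l₀ ^ 3 * s) (3 * δ * l₀ ^ 3) s := by
    simpa using ((hasDerivAt_id' s).const_mul (3 * δ * l₀ ^ 3)).const_add 1
  refine ((h1.rpow_const (Or.inl h.ne')).const_mul l₀).congr_deriv ?_
  have h2 : (1 + 3 * δ * l₀ ^ 3 * s) ^ (-(1 / 3) - 1 : ℝ) =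
      ((1 + 3 * δ * l₀ ^ 3 * s) ^ (-(1 / 3) : ℝ)) ^ 4 := by
    rw [← Real.rpow_mul_natCast h.le]; norm_num
  rw [h2, radialDecay]; ring

lemma radialDecay_nonneg {δ l₀ s : ℝ} (hδ : 0 < δ) (hl : 0 ≤ l₀) (hs : 0 ≤ s) :
    0 ≤ radialDecay δ l₀ s := by unfold radialDecay; positivity

lemma radialDecay_le {δ l₀ s : ℝ} (hδ : 0 < δ) (hl : 0 ≤ l₀) (hs : 0 ≤ s) :
    radialDecay δ l₀ s ≤ l₀ := by
  have h1 : (1 : ℝ) ≤ 1 + 3 * δ * l₀ ^ 3 * s := by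
    have : 0 ≤ 3 * δ * l₀ ^ 3 * s := by positivity
    linarith
  have := Real.rpow_le_one_of_one_le_of_nonpos h1 (z := -(1 / 3)) (by norm_num)
  unfold radialDecay
  nlinarith

lemma tendsto_radialDecay {δ l₀ : ℝ} (hδ : 0 < δ) (hl : 0 ≤ l₀) :
    Tendsto (radialDecay δ l₀) atTop (𝓝 0) := by
  rcases hl.eq_or_lt with rfl | hl
  · have : radialDecay δ 0 = fun _ => 0 := by ext s; simp [radialDecay]
    rw [this]; exact tendsto_const_nhds
  · have h1 : Tendsto (fun s => 1 + 3 * δ * l₀ ^ 3 * s) atTop atTop :=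
      tendsto_atTop_add_const_left _ _ (tendsto_id.const_mul_atTop (by positivity))
    have h2 := ((tendsto_rpow_neg_atTop (y := 1 / 3) (by norm_num)).comp h1).const_mul l₀
    rw [mul_zero] at h2
    exact h2

section Components

variable {δ T : ℝ} {Y : ℝ → (ℝ × ℝ × ℝ) × ℝ}

lemma IsTrajectoryOn.ang_eq (hδ : 0 < δ) (h : IsTrajectoryOn (extField δ) extDomain T Y)
    (h0 : 0 ≤ (Y 0).1.2.2) {t : ℝ} (ht : t ∈ Icc 0 T) :
    (Y t).1.2.2 = radialDecay δ (Y 0).1.2.2 t := by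
  have h1 : IsTrajectoryOn (fun l : ℝ => -δ * l ^ 4) univ T fun t => (Y t).1.2.2 := fun t ht =>
    ⟨mem_univ _, hasDerivWithinAt_snd (hasDerivWithinAt_snd (hasDerivWithinAt_fst (h t ht).2))⟩
  have h2 : IsTrajectoryOn (fun l : ℝ => -δ * l ^ 4) univ T (radialDecay δ (Y 0).1.2.2) := by
    refine fun t ht => ⟨mem_univ _, (hasDerivAt_radialDecay ?_).hasDerivWithinAt⟩
    have := ht.1
    positivity
  refine h1.eqOn isOpen_univ (by fun_prop) h2 ?_ ht
  simp [radialDecay]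

lemma IsTrajectory.ang_eq (hδ : 0 < δ) (h : IsTrajectory (extField δ) extDomain Y)
    (h0 : 0 ≤ (Y 0).1.2.2) {t : ℝ} (ht : 0 ≤ t) :
    (Y t).1.2.2 = radialDecay δ (Y 0).1.2.2 t :=
  (h.restrict t).ang_eq hδ h0 ⟨ht, le_rfl⟩

/-- The time derivative of `|Z|² = 2 H`. -/
lemma IsTrajectoryOn.hasDerivWithinAt_energy (h : IsTrajectoryOn (extField δ) extDomain T Y)
    {t : ℝ} (ht : t ∈ Icc 0 T) :
    HasDerivWithinAt (fun t => Complex.normSq (rotEcc (Y t).1)) (-4 * δ * (Y t).1.2.2 ^ 3 *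
      (((Y t).1.1⁻¹ - 1) * (Y t).1.1⁻¹ + (Y t).1.2.1 ^ 2)) (Icc 0 T) t := by
  have hr : 0 < (Y t).1.1 := (h t ht).1
  have h1 := hasDerivWithinAt_fst (h t ht).2
  have hr' := hasDerivWithinAt_fst h1
  have hv' := hasDerivWithinAt_fst (hasDerivWithinAt_snd h1)
  have h2 := ((hr'.fun_inv hr.ne').sub_const 1).fun_pow 2
  have h3 := (h2.fun_add (hv'.fun_pow 2))
  refine (h3.congr_deriv ?_).congr (fun s _ => ?_) ?_
  · have hne := hr.ne'
    simp only [extField, vectorField, Nat.cast_ofNat, Nat.add_one_sub_one, pow_one]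
    field_simp
    ring
  · simp only [Complex.normSq_apply, rotEcc_re, rotEcc_im]; ring
  · simp only [Complex.normSq_apply, rotEcc_re, rotEcc_im]; ring

/-- The growth rate of `2 H` is at most `δ l³`: it is `-4 δ l³ (x² - x + v²)` with `x = 1 / r₁`, and
`x² - x ≥ -1 / 4`. -/
lemma IsTrajectoryOn.energy_le (hδ : 0 < δ) (h : IsTrajectoryOn (extField δ) extDomain T Y)
    (h0 : 0 ≤ (Y 0).1.2.2) {t : ℝ} (ht : t ∈ Icc 0 T) :
    Complex.normSq (rotEcc (Y t).1) ≤
      Complex.normSq (rotEcc (Y 0).1) + δ * (Y 0).1.2.2 ^ 3 * t := by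
  refine le_add_mul_of_hasDerivWithinAt_le (f := fun t => Complex.normSq (rotEcc (Y t).1))
    (f' := fun t => -4 * δ * (Y t).1.2.2 ^ 3 *
      (((Y t).1.1⁻¹ - 1) * (Y t).1.1⁻¹ + (Y t).1.2.1 ^ 2)) (fun t ht => ?_) (fun t ht => ?_) t ht
  · exact h.hasDerivWithinAt_energy ht
  · have hl : 0 ≤ (Y t).1.2.2 := by
      rw [h.ang_eq hδ h0 ht]; exact radialDecay_nonneg hδ h0 ht.1
    have hl' : (Y t).1.2.2 ≤ (Y 0).1.2.2 := by
      rw [h.ang_eq hδ h0 ht]; exact radialDecay_le hδ h0 ht.1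
    have h1 : δ * (Y t).1.2.2 ^ 3 ≤ δ * (Y 0).1.2.2 ^ 3 := by gcongr
    have h2 : 0 ≤ δ * (Y t).1.2.2 ^ 3 := by positivity
    nlinarith [sq_nonneg ((Y t).1.1⁻¹ - 1 / 2), sq_nonneg (Y t).1.2.1,
      mul_nonneg h2 (sq_nonneg ((Y t).1.1⁻¹ - 1 / 2)), mul_nonneg h2 (sq_nonneg (Y t).1.2.1)]

/-- Solutions of the reduced system in the phase space exist for all forward times: the bound on `H`
keeps `v` bounded and `r₁` away from `0`, and then `r₁` grows at most exponentially. -/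
theorem exists_isTrajectory_extField (hδ : 0 < δ) {p : ℝ × ℝ × ℝ} (hp : p ∈ phaseSpace) (θ : ℝ) :
    ∃ Y, Y 0 = (p, θ) ∧ IsTrajectory (extField δ) extDomain Y := by
  refine exists_isTrajectory_of_isCompact isOpen_extDomain (contDiffOn_extField δ)
    (x := (p, θ)) hp.1 fun T => ?_
  rcases lt_or_ge T 0 with hT | hT
  · exact ⟨∅, empty_subset _, isCompact_empty, fun T' hT' => absurd (hT'.1.trans hT'.2)
      (not_le.2 hT)⟩
  obtain ⟨B, hB, hB'⟩ : ∃ B : ℝ, 0 ≤ B ∧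
      Complex.normSq (rotEcc p) + δ * p.2.2 ^ 3 * T ≤ B ^ 2 := by
    have h1 := Complex.normSq_nonneg (rotEcc p)
    have h2 := hp.2
    exact ⟨√(Complex.normSq (rotEcc p) + δ * p.2.2 ^ 3 * T), by positivity,
      (Real.sq_sqrt (by positivity)).ge⟩
  set c : ℝ := 2 * δ * p.2.2 ^ 3
  have hc : 0 ≤ c := by have := hp.2; positivity
  refine ⟨(Icc (1 + B)⁻¹ (Real.exp (c * T) * (p.1 + B * T)) ×ˢ Icc (-B) B ×ˢ Icc 0 p.2.2) ×ˢ
    Icc θ (θ + (1 + B) ^ 2 * T), ?_, ?_, ?_⟩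
  · rintro x ⟨⟨⟨h1, -⟩, -⟩, -⟩
    exact lt_of_lt_of_le (by positivity) h1
  · exact ((isCompact_Icc.prod (isCompact_Icc.prod isCompact_Icc)).prod isCompact_Icc)
  intro T' hT' y hy0 hy
  have hl0 : 0 ≤ (y 0).1.2.2 := by rw [hy0]; exact hp.2
  have hl : ∀ t ∈ Icc 0 T', (y t).1.2.2 ∈ Icc 0 p.2.2 := fun t ht => by
    rw [hy.ang_eq hδ hl0 ht, hy0]
    exact ⟨radialDecay_nonneg hδ hp.2 ht.1, radialDecay_le hδ hp.2 ht.1⟩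
  have hZ : ∀ t ∈ Icc 0 T', ((y t).1.1⁻¹ - 1) ^ 2 + (y t).1.2.1 ^ 2 ≤ B ^ 2 := fun t ht => by
    have h1 := hy.energy_le hδ hl0 ht
    rw [hy0] at h1
    have h2 : δ * p.2.2 ^ 3 * t ≤ δ * p.2.2 ^ 3 * T := by
      have := hp.2
      have := ht.2.trans hT'.2
      gcongr
    have h3 : Complex.normSq (rotEcc (y t).1) = ((y t).1.1⁻¹ - 1) ^ 2 + (y t).1.2.1 ^ 2 := by
      rw [Complex.normSq_apply, rotEcc_re, rotEcc_im]; ring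
    rw [← h3]; dsimp only at h1; linarith
  have hv : ∀ t ∈ Icc 0 T', (y t).1.2.1 ∈ Icc (-B) B := fun t ht =>
    abs_le.1 (abs_le_of_sq_le_sq (by nlinarith [hZ t ht, sq_nonneg ((y t).1.1⁻¹ - 1)]) hB)
  have hr0 : ∀ t ∈ Icc 0 T', 0 < (y t).1.1 := fun t ht => (hy t ht).1
  have hr : ∀ t ∈ Icc 0 T', (y t).1.1⁻¹ ≤ 1 + B := fun t ht => by
    have := abs_le.1 (abs_le_of_sq_le_sq (b := B) (a := (y t).1.1⁻¹ - 1)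
      (by nlinarith [hZ t ht, sq_nonneg (y t).1.2.1]) hB)
    linarith [this.2]
  have hd := fun t ht => hasDerivWithinAt_fst (hasDerivWithinAt_fst (hy t ht).2)
  have hθ := fun t ht => hasDerivWithinAt_snd (hy t ht).2
  have hmem : T' ∈ Icc 0 T' := ⟨hT'.1, le_rfl⟩
  refine ⟨⟨⟨?_, ?_⟩, hv _ hmem, hl _ hmem⟩, ?_, ?_⟩
  · exact inv_le_of_inv_le₀ (hr0 _ hmem) (hr _ hmem)
  · have h1 := le_add_mul_of_hasDerivWithinAt_le (T := T') (c := B)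
      (f := fun t => Real.exp (-(c * t)) * (y t).1.1)
      (f' := fun t => Real.exp (-(c * t)) * (-c) * (y t).1.1 +
        Real.exp (-(c * t)) * ((y t).1.2.1 + 2 * δ * (y t).1.1 * (y t).1.2.2 ^ 3))
      (fun t ht => by
        have h2 : HasDerivAt (fun t => Real.exp (-(c * t))) (Real.exp (-(c * t)) * (-c)) t := by
          simpa using (((hasDerivAt_id' t).const_mul c).fun_neg).exp
        exact h2.hasDerivWithinAt.fun_mul (hd t ht)) (fun t ht => by
        have h3 : Real.exp (-(c * t)) ≤ 1 := Real.exp_le_one_iff.2 (by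
          have := ht.1; have : 0 ≤ c * t := by positivity
          linarith)
        have h4 : 0 < Real.exp (-(c * t)) := Real.exp_pos _
        have h5 := hv t ht
        have h6 : (y t).1.1 * (y t).1.2.2 ^ 3 ≤ (y t).1.1 * p.2.2 ^ 3 := by
          have := hl t ht
          have := this.1
          have := (hl t ht).2
          have := (hr0 t ht).le
          gcongr
        have h7 : -c * (y t).1.1 + ((y t).1.2.1 + 2 * δ * (y t).1.1 * (y t).1.2.2 ^ 3) ≤ B := by
          simp only [c]; nlinarith [h5.2]
        calc _ = Real.exp (-(c * t)) *
              (-c * (y t).1.1 + ((y t).1.2.1 + 2 * δ * (y t).1.1 * (y t).1.2.2 ^ 3)) := by ring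
          _ ≤ Real.exp (-(c * t)) * B := by gcongr
          _ ≤ 1 * B := by gcongr
          _ = B := one_mul B) T' hmem
    simp only [hy0, mul_zero, neg_zero, Real.exp_zero, one_mul] at h1
    have h2 : (y T').1.1 = Real.exp (c * T') * (Real.exp (-(c * T')) * (y T').1.1) := by
      rw [← mul_assoc, ← Real.exp_add]; simp
    rw [h2]
    have := hT'.2
    have := hp.1.le
    have h3 : p.1 + B * T' ≤ p.1 + B * T := by gcongr
    calc _ ≤ Real.exp (c * T') * (p.1 + B * T) := by gcongr; exact h1.trans h3
      _ ≤ _ := by gcongr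
  · have h1 := le_add_mul_of_hasDerivWithinAt_le (T := T') (c := 0) (f := fun t => -(y t).2)
      (fun t ht => (hθ t ht).fun_neg) (fun t ht => by
        have := hr0 t ht
        simp only [extField]; rw [neg_nonpos]; positivity) T' hmem
    simp only [hy0] at h1
    linarith
  · have h1 := le_add_mul_of_hasDerivWithinAt_le (T := T') (c := (1 + B) ^ 2)
      (f := fun t => (y t).2) hθ (fun t ht => by
        have := hr0 t ht
        have := hr t ht
        simp only [extField]
        rw [← inv_pow]; gcongr) T' hmem
    simp only [hy0] at h1
    refine h1.trans ?_
    have := hT'.2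
    gcongr

end Components

/-! ### The period map in the angle -/

/-- `1 + Re (e^{-iτ} w)`, which is `1 / r₁` at polar angle `τ` when `w = e^{iτ} Z`. -/
noncomputable def invRadius (τ : ℝ) (w : ℂ) : ℝ := 1 + (Complex.exp (-(τ * Complex.I)) * w).re

lemma norm_cexp_neg (τ : ℝ) : ‖Complex.exp (-(τ * Complex.I))‖ = 1 := by
  rw [← neg_mul, ← Complex.ofReal_neg, Complex.norm_exp_ofReal_mul_I]

lemma one_sub_le_invRadius {τ R : ℝ} {w : ℂ} (hw : ‖w‖ ≤ R) : 1 - R ≤ invRadius τ w := by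
  have h := Complex.abs_re_le_norm (Complex.exp (-(τ * Complex.I)) * w)
  rw [norm_mul, norm_cexp_neg, one_mul] at h
  have := (abs_le.1 (h.trans hw)).1
  unfold invRadius; linarith

lemma invRadius_le {τ R : ℝ} {w : ℂ} (hw : ‖w‖ ≤ R) : invRadius τ w ≤ 1 + R := by
  have h := Complex.abs_re_le_norm (Complex.exp (-(τ * Complex.I)) * w)
  rw [norm_mul, norm_cexp_neg, one_mul] at h
  have := (abs_le.1 (h.trans hw)).2
  unfold invRadius; linarith

lemma contDiff_cexp_mul_I (c : ℝ) :
    ContDiff ℝ ∞ fun τ : ℝ => Complex.exp (((c * τ : ℝ) : ℂ) * Complex.I) :=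
  ((Complex.ofRealCLM.contDiff.comp (contDiff_const.mul contDiff_id)).mul contDiff_const).cexp

lemma contDiff_cexp_neg_mul_I (c : ℝ) :
    ContDiff ℝ ∞ fun τ : ℝ => Complex.exp (-(((c * τ : ℝ) : ℂ) * Complex.I)) :=
  ((Complex.ofRealCLM.contDiff.comp (contDiff_const.mul contDiff_id)).mul contDiff_const).neg.cexp

lemma contDiff_invRadius (c : ℝ) : ContDiff ℝ ∞ fun q : ℝ × ℂ => invRadius (c * q.1) q.2 := by
  have h : ContDiff ℝ ∞ fun q : ℝ × ℂ => Complex.exp (-(((c * q.1 : ℝ) : ℂ) * Complex.I)) * q.2 :=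
    ((contDiff_cexp_neg_mul_I c).comp contDiff_fst).mul contDiff_snd
  exact contDiff_const.add (Complex.reCLM.contDiff.comp h)

lemma hasDerivAt_cexp_mul_I (τ : ℝ) : HasDerivAt (fun τ : ℝ => Complex.exp (τ * Complex.I))
    (Complex.I * Complex.exp (τ * Complex.I)) τ := by
  have h := (((hasDerivAt_id' τ).ofReal_comp).mul_const Complex.I).cexp
  refine h.congr_deriv ?_
  push_cast; ring

lemma hasDerivAt_cexp_neg_mul_I (τ : ℝ) :
    HasDerivAt (fun τ : ℝ => Complex.exp (-(τ * Complex.I)))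
      (-Complex.I * Complex.exp (-(τ * Complex.I))) τ := by
  have h := (((hasDerivAt_id' τ).ofReal_comp).mul_const Complex.I).fun_neg.cexp
  refine h.congr_deriv ?_
  push_cast; ring

/-- The integrand of the averaged equation is the derivative of `-i e^{iτ} / (1 + Re(e^{-iτ}w))`,
so that its mean over a period vanishes. -/
lemma hasDerivAt_averaging_primitive {w : ℂ} {τ : ℝ} (h : invRadius τ w ≠ 0) :
    HasDerivAt (fun τ : ℝ => (invRadius τ w)⁻¹ • (-Complex.I * Complex.exp (τ * Complex.I)))
      ((invRadius τ w ^ 2)⁻¹ • (Complex.exp (τ * Complex.I) + w)) τ := by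
  have h1 : HasDerivAt (fun τ => invRadius τ w)
      (-Complex.I * Complex.exp (-(τ * Complex.I)) * w).re τ :=
    (Complex.reCLM.hasFDerivAt.comp_hasDerivAt τ
      ((hasDerivAt_cexp_neg_mul_I τ).mul_const w)).const_add 1
  have h2 := (h1.fun_inv h).fun_smul ((hasDerivAt_cexp_mul_I τ).const_mul (-Complex.I))
  refine h2.congr_deriv ?_
  set E := Complex.exp (τ * Complex.I) with hE
  set E' := Complex.exp (-(τ * Complex.I)) with hE'
  have hEE : E * E' = 1 := by rw [hE, hE', ← Complex.exp_add]; simp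
  have h3 : (-Complex.I * E' * w).re = (E' * w).im := by
    rw [mul_assoc, neg_mul, Complex.neg_re, Complex.I_mul_re]; ring
  have h4 : E + w = E * ((invRadius τ w : ℂ) + Complex.I * (E' * w).im) := by
    have h5 : (invRadius τ w : ℂ) + Complex.I * (E' * w).im = 1 + E' * w := by
      apply Complex.ext <;> simp [invRadius, hE']
    rw [h5, mul_add, ← mul_assoc, hEE]; ring
  rw [h3, h4]
  have h6 : (invRadius τ w : ℂ) ≠ 0 := by exact_mod_cast h
  simp only [Complex.real_smul]
  push_cast
  field_simp
  ring_nf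
  rw [Complex.I_sq]
  ring

lemma integral_averaging_eq_zero {w : ℂ} {R : ℝ} (hR : R < 1) (hw : ‖w‖ ≤ R) :
    ∫ s in (0 : ℝ)..1, (invRadius (2 * Real.pi * s) w ^ 2)⁻¹ •
      (Complex.exp (((2 * Real.pi * s : ℝ) : ℂ) * Complex.I) + w) = 0 := by
  have hne : ∀ τ, invRadius τ w ≠ 0 := fun τ => by
    have := one_sub_le_invRadius (τ := τ) hw; intro h; linarith
  have hpi := Real.pi_ne_zero
  have h1 := intervalIntegral.integral_eq_sub_of_hasDerivAt (a := 0) (b := 1)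
    (f := fun s => (2 * Real.pi)⁻¹ • ((invRadius (2 * Real.pi * s) w)⁻¹ • (-Complex.I *
      Complex.exp (((2 * Real.pi * s : ℝ) : ℂ) * Complex.I))))
    (f' := fun s => (invRadius (2 * Real.pi * s) w ^ 2)⁻¹ •
      (Complex.exp (((2 * Real.pi * s : ℝ) : ℂ) * Complex.I) + w)) (fun s _ => by
      have h2 := HasDerivAt.scomp s (hasDerivAt_averaging_primitive (hne (2 * Real.pi * s)))
        ((hasDerivAt_id' s).const_mul (2 * Real.pi))
      refine (h2.const_smul (2 * Real.pi)⁻¹).congr_deriv ?_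
      rw [smul_smul]
      rw [mul_one, inv_mul_cancel₀ (by positivity), one_smul]) (by
      refine Continuous.intervalIntegrable ?_ _ _
      have h3 : Continuous fun s => invRadius (2 * Real.pi * s) w :=
        (contDiff_invRadius (2 * Real.pi)).continuous.comp (by fun_prop : Continuous fun s : ℝ => (s, w))
      exact ((h3.pow 2).inv₀ fun s => pow_ne_zero _ (hne _)).smul
        ((contDiff_cexp_mul_I (2 * Real.pi)).continuous.add continuous_const))
  rw [h1]
  simp [invRadius, Complex.exp_neg, Complex.exp_two_pi_mul_I]

/-- A globally smooth function that agrees with `d⁻²` away from the singularity at `0`. -/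
lemma exists_contDiff_eq_inv_sq {d₀ : ℝ} (h : 0 < d₀) :
    ∃ φ : ℝ → ℝ, ContDiff ℝ ∞ φ ∧ ∀ d, d₀ ≤ d → φ d = (d ^ 2)⁻¹ := by
  refine ⟨fun d => Real.smoothTransition (2 * d / d₀ - 1) * (d ^ 2)⁻¹, ?_, fun d hd => ?_⟩
  · rw [contDiff_iff_contDiffAt]
    intro d
    rcases eq_or_ne d 0 with rfl | hd
    · have h1 : (fun d => Real.smoothTransition (2 * d / d₀ - 1) * (d ^ 2)⁻¹) =ᶠ[𝓝 0]
          fun _ => 0 := by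
        filter_upwards [Iio_mem_nhds (show (0 : ℝ) < d₀ / 2 by positivity)] with d hd
        rw [Real.smoothTransition.zero_of_nonpos, zero_mul]
        have : 2 * d / d₀ ≤ 1 := by
          rw [div_le_one h]; simp only [mem_Iio] at hd; linarith
        linarith
      exact contDiffAt_const.congr_of_eventuallyEq h1
    · exact ((Real.smoothTransition.contDiff.comp (by fun_prop)).contDiffAt).mul
        ((contDiffAt_id.pow 2).inv (pow_ne_zero _ hd))
  · beta_reduce
    rw [Real.smoothTransition.one_of_one_le, one_mul]
    have : 1 ≤ d / d₀ := (one_le_div h).2 hd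
    rw [mul_div_assoc]; linarith

/-- The equations for `w = e^{iθ} Z` and `κ = l / l₀` with the time variable `θ / 2π`, without the
factor `l₀³`. -/
noncomputable def periodField (δ : ℝ) (q : ℝ × ℂ × ℝ) : ℂ × ℝ :=
  ((-(4 * Real.pi * δ * q.2.2 ^ 3)) • ((invRadius (2 * Real.pi * q.1) q.2.1 ^ 2)⁻¹ •
      (Complex.exp (((2 * Real.pi * q.1 : ℝ) : ℂ) * Complex.I) + q.2.1)),
    -(2 * Real.pi * δ * q.2.2 ^ 4) * (invRadius (2 * Real.pi * q.1) q.2.1 ^ 2)⁻¹)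

lemma exists_contDiff_eq_periodField (δ : ℝ) {R : ℝ} (hR : R < 1) :
    ∃ g : ℝ × ℂ × ℝ → ℂ × ℝ, ContDiff ℝ ∞ g ∧ ∀ q, ‖q.2.1‖ ≤ R → g q = periodField δ q := by
  obtain ⟨φ, hφ, hφ'⟩ := exists_contDiff_eq_inv_sq (sub_pos.2 hR)
  refine ⟨fun q => ((-(4 * Real.pi * δ * q.2.2 ^ 3)) • (φ (invRadius (2 * Real.pi * q.1) q.2.1) •
      (Complex.exp (((2 * Real.pi * q.1 : ℝ) : ℂ) * Complex.I) + q.2.1)),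
    -(2 * Real.pi * δ * q.2.2 ^ 4) * φ (invRadius (2 * Real.pi * q.1) q.2.1)), ?_, fun q hq => ?_⟩
  · have h1 : ContDiff ℝ ∞ fun q : ℝ × ℂ × ℝ => φ (invRadius (2 * Real.pi * q.1) q.2.1) :=
      hφ.comp (ContDiff.comp (g := fun q : ℝ × ℂ => invRadius (2 * Real.pi * q.1) q.2)
        (f := fun q : ℝ × ℂ × ℝ => (q.1, q.2.1)) (contDiff_invRadius (2 * Real.pi))
        (contDiff_fst.prodMk contDiff_snd.fst))
    have h2 : ContDiff ℝ ∞ fun q : ℝ × ℂ × ℝ =>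
        Complex.exp (((2 * Real.pi * q.1 : ℝ) : ℂ) * Complex.I) + q.2.1 :=
      ((contDiff_cexp_mul_I (2 * Real.pi)).comp contDiff_fst).add contDiff_snd.fst
    have h3 : ContDiff ℝ ∞ fun q : ℝ × ℂ × ℝ => -(4 * Real.pi * δ * q.2.2 ^ 3) :=
      (contDiff_const.mul (contDiff_snd.snd.pow 3)).neg
    have h4 : ContDiff ℝ ∞ fun q : ℝ × ℂ × ℝ => -(2 * Real.pi * δ * q.2.2 ^ 4) :=
      (contDiff_const.mul (contDiff_snd.snd.pow 4)).neg
    exact (h3.smul (h1.smul h2)).prodMk (h4.mul h1)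
  · simp only [periodField, hφ' _ (one_sub_le_invRadius hq)]

lemma invRadius_pos {τ : ℝ} {w : ℂ} (hw : ‖w‖ < 1) : 0 < invRadius τ w := by
  have := one_sub_le_invRadius (τ := τ) (le_refl ‖w‖); linarith

lemma continuous_inv_sq_invRadius {w : ℂ} (hw : ‖w‖ < 1) :
    Continuous fun s => (invRadius (2 * Real.pi * s) w ^ 2)⁻¹ := by
  have h1 : Continuous fun s : ℝ => (s, w) := by fun_prop
  have h2 : Continuous fun s : ℝ => invRadius (2 * Real.pi * s) w :=
    Continuous.comp (g := fun q : ℝ × ℂ => invRadius (2 * Real.pi * q.1) q.2)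
      (contDiff_invRadius (2 * Real.pi)).continuous h1
  exact (h2.pow 2).inv₀ fun s => pow_ne_zero _ (invRadius_pos hw).ne'

lemma integral_inv_sq_invRadius_pos {δ : ℝ} (hδ : 0 < δ) {w : ℂ} (hw : ‖w‖ < 1) :
    0 < ∫ s in (0 : ℝ)..1, 2 * Real.pi * δ * (invRadius (2 * Real.pi * s) w ^ 2)⁻¹ := by
  have hpi := Real.pi_pos
  refine intervalIntegral.intervalIntegral_pos_of_pos
    (((continuous_inv_sq_invRadius hw).const_mul (2 * Real.pi * δ)).intervalIntegrable _ _)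
    (fun s => ?_) one_pos
  have := invRadius_pos (τ := 2 * Real.pi * s) hw
  positivity

/-- The average of the equations over one period at `l = 0`: to first order in `l³` the eccentricity
does not drift, and `l` decreases. -/
lemma integral_periodField (δ : ℝ) {w : ℂ} (hw : ‖w‖ < 1) :
    ∫ s in (0 : ℝ)..1, periodField δ (s, w, 1) = (0, -(∫ s in (0 : ℝ)..1, 2 * Real.pi * δ *
      (invRadius (2 * Real.pi * s) w ^ 2)⁻¹)) := by
  have hDi := continuous_inv_sq_invRadius hw
  have hc0 : Continuous fun s : ℝ =>
      Complex.exp (((2 * Real.pi * s : ℝ) : ℂ) * Complex.I) + w :=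
    (contDiff_cexp_mul_I (2 * Real.pi)).continuous.add continuous_const
  have hc1 : Continuous fun s => (periodField δ (s, w, 1)).1 := by
    simp only [periodField]
    exact (hDi.smul hc0).const_smul (-(4 * Real.pi * δ * 1 ^ 3))
  have hc2 : Continuous fun s => (periodField δ (s, w, 1)).2 := by
    simp only [periodField]
    exact hDi.const_mul (-(2 * Real.pi * δ * 1 ^ 4))
  have h2 := (ContinuousLinearMap.fst ℝ ℂ ℝ).intervalIntegral_comp_comm
    ((hc1.prodMk hc2).intervalIntegrable (μ := MeasureTheory.volume) 0 1)
  have h3 := (ContinuousLinearMap.snd ℝ ℂ ℝ).intervalIntegral_comp_comm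
    ((hc1.prodMk hc2).intervalIntegrable (μ := MeasureTheory.volume) 0 1)
  refine Prod.ext ?_ ?_
  · refine h2.symm.trans ?_
    have h4 := integral_averaging_eq_zero hw le_rfl
    simp only [periodField, ContinuousLinearMap.coe_fst']
    rw [intervalIntegral.integral_smul, h4, smul_zero]
  · refine h3.symm.trans ?_
    rw [← intervalIntegral.integral_neg]
    refine intervalIntegral.integral_congr fun s _ => ?_
    simp [periodField]

/-- The solutions over one period of the angle near `l = 0`, and the normal form of the period
map in the variables `(w, l³)`. -/
lemma exists_periodCurves {δ : ℝ} (hδ : 0 < δ) {x₀ : ℂ} (hx₀ : ‖x₀‖ < 1) :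
    ∃ W : Set (ℂ × ℝ), IsOpen W ∧ (x₀, (0 : ℝ)) ∈ W ∧
    ∃ β : ℂ × ℝ → C(unitInterval, ℂ × ℝ), ContinuousOn β W ∧
      (∀ z ∈ W, ∀ t, ‖(β z t).1‖ < 1) ∧ (∀ z ∈ W, β z 0 = (z.1, 1)) ∧
      (∀ z ∈ W, z.2 = 0 → β z = constCurve (ℂ × ℝ) (z.1, 1)) ∧
      (∀ z ∈ W, ∀ t ∈ Icc (0 : ℝ) 1, HasDerivWithinAt (fun s => β z (projIcc 0 1 zero_le_one s))
        (z.2 • periodField δ (t, β z (projIcc 0 1 zero_le_one t))) (Icc 0 1) t) ∧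
      ∃ (a : ℂ × ℝ → ℂ) (b : ℂ × ℝ → ℝ), ContDiff ℝ ∞ a ∧ ContDiff ℝ ∞ b ∧ (∀ z, 0 < b z) ∧
        ∀ z ∈ W, parabolicMap a b z = ((β z 1).1, z.2 * (β z 1).2 ^ 3) := by
  obtain ⟨R, hR0, hR⟩ := exists_between hx₀
  obtain ⟨g, hg, hgR⟩ := exists_contDiff_eq_periodField δ hR
  obtain ⟨V, hV, hxV, α, hα, hαeq⟩ := exists_contDiffOn_perturbation hg (x₀, (1 : ℝ))
  let ι : ℂ × ℝ → (ℂ × ℝ) × ℝ := fun z => ((z.1, 1), z.2)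
  have hι : ContDiff ℝ ∞ ι := by fun_prop
  have hV₀ : IsOpen (ι ⁻¹' V) := hV.preimage hι.continuous
  have hβ₀ : ContDiffOn ℝ ∞ (fun z => α (ι z)) (ι ⁻¹' V) :=
    hα.comp hι.contDiffOn fun z hz => hz
  have hconst : ∀ z ∈ ι ⁻¹' V, z.2 = 0 → α (ι z) = constCurve (ℂ × ℝ) (z.1, 1) := by
    intro z hz hz0
    ext t : 1
    rw [hαeq _ hz]; simp [ι, hz0]
  -- the neighbourhood in which all curves stay in the disc of radius `R`
  set W₀ : Set (ℂ × ℝ) := ι ⁻¹' V ∩ (fun z => α (ι z)) ⁻¹'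
    Metric.ball (constCurve (ℂ × ℝ) (x₀, 1)) (R - ‖x₀‖) with hW₀
  have hW₀o : IsOpen W₀ := hβ₀.continuousOn.isOpen_inter_preimage hV₀ Metric.isOpen_ball
  have hxW₀ : (x₀, (0 : ℝ)) ∈ W₀ := ⟨hxV, by
    rw [mem_preimage, hconst _ hxV rfl]; exact Metric.mem_ball_self (sub_pos.2 hR0)⟩
  have hbd : ∀ z ∈ W₀, ∀ t, ‖(α (ι z) t).1‖ < R := by
    intro z hz t
    have h1 := (ContinuousMap.dist_apply_le_dist (f := α (ι z))
      (g := constCurve (ℂ × ℝ) (x₀, 1)) t).trans_lt hz.2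
    have h2 : ‖(α (ι z) t).1 - x₀‖ < R - ‖x₀‖ := by
      rw [← dist_eq_norm]
      exact (le_max_left _ _).trans_lt h1
    have h3 := norm_add_le ((α (ι z) t).1 - x₀) x₀
    rw [sub_add_cancel] at h3
    linarith
  let G : ℂ × ℝ → ℂ × ℝ := fun z =>
    primitive (ℂ × ℝ) (timeSuperposition g hg.continuous (α (ι z))) 1
  have hGc : ContDiff ℝ ∞ fun γ : C(unitInterval, ℂ × ℝ) =>
      primitive (ℂ × ℝ) (timeSuperposition g hg.continuous γ) 1 :=
    (ContinuousMap.evalCLM ℝ (1 : unitInterval) :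
      C(unitInterval, ℂ × ℝ) →L[ℝ] ℂ × ℝ).contDiff.comp ((primitive (ℂ × ℝ)).contDiff.comp (contDiff_timeSuperposition hg))
  have hG : ContDiffOn ℝ ∞ G W₀ :=
    hGc.comp_contDiffOn (hβ₀.mono inter_subset_left)
  have hG1 : ∀ z ∈ W₀, α (ι z) 1 = (z.1 + z.2 • (G z).1, 1 + z.2 * (G z).2) := fun z hz => by
    rw [hαeq _ hz.1]; rfl
  have hG0 : ∀ z ∈ W₀, z.2 = 0 → G z = (0, -(∫ s in (0 : ℝ)..1, 2 * Real.pi * δ *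
      (invRadius (2 * Real.pi * s) z.1 ^ 2)⁻¹)) := by
    intro z hz hz0
    have hzR : ‖z.1‖ ≤ R := by
      have := hbd z hz 0
      rw [hconst z hz.1 hz0] at this
      exact this.le
    have h1 : G z = ∫ s in (0 : ℝ)..1, periodField δ (s, z.1, 1) := by
      simp only [G]
      rw [primitive_apply, hconst z hz.1 hz0]
      refine intervalIntegral.integral_congr fun s hs => ?_
      rw [uIcc_of_le (by simp)] at hs
      have hs' : ((projIcc (0 : ℝ) 1 zero_le_one s : unitInterval) : ℝ) = s :=
        congrArg Subtype.val (projIcc_of_mem zero_le_one hs)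
      have : timeSuperposition g hg.continuous (constCurve (ℂ × ℝ) (z.1, 1))
          (projIcc 0 1 zero_le_one s) = g ((projIcc (0 : ℝ) 1 zero_le_one s : unitInterval), z.1, 1) := rfl
      rw [this, hs', hgR _ hzR]
    rw [h1, integral_periodField δ (hzR.trans_lt hR)]
  have hG2neg : (G (x₀, 0)).2 < 0 := by
    rw [hG0 _ hxW₀ rfl]
    exact neg_lt_zero.2 (integral_inv_sq_invRadius_pos hδ hx₀)
  -- global extensions of the coefficients of the period map
  obtain ⟨F₁, hF₁, hF₁eq, -, hF₁alt⟩ := exists_contDiff_extension hW₀o (f := fun z => (G z).1)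
    hG.fst hxW₀ (0 : ℂ) convex_univ (mem_univ _) (fun _ _ => mem_univ _)
  obtain ⟨a, ha, haF⟩ := exists_contDiff_eq_smul hF₁ (fun x => by
    rcases hF₁alt (x, 0) with h | ⟨c, hc, h⟩
    · exact h
    · rw [h, hG0 _ hc rfl]; simp)
  let b₀ : ℂ × ℝ → ℝ := fun z =>
    -3 * (G z).2 - 3 * z.2 * (G z).2 ^ 2 - z.2 ^ 2 * (G z).2 ^ 3
  have hb₀ : ContDiffOn ℝ ∞ b₀ W₀ := by
    have h := hG.snd
    have h' : ContDiffOn ℝ ∞ (fun z : ℂ × ℝ => z.2) W₀ := contDiffOn_snd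
    exact ((contDiffOn_const.mul h).sub ((contDiffOn_const.mul h').mul (h.pow 2))).sub
      ((h'.pow 2).mul (h.pow 3))
  have hW₁o : IsOpen (W₀ ∩ b₀ ⁻¹' Ioi 0) :=
    hb₀.continuousOn.isOpen_inter_preimage hW₀o isOpen_Ioi
  obtain ⟨b, hb, hbeq, hbpos, -⟩ := exists_contDiff_extension hW₁o (hb₀.mono inter_subset_left)
    (x₀ := (x₀, (0 : ℝ))) ⟨hxW₀, by simp only [mem_preimage, mem_Ioi, b₀]; linarith⟩ (1 : ℝ)
    (convex_Ioi (0 : ℝ)) (by simp) (fun z hz => hz.2)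
  obtain ⟨W, hW, hWo, hxW⟩ := eventually_nhds_iff.1
    ((hF₁eq.and hbeq).and (hW₀o.mem_nhds hxW₀))
  refine ⟨W, hWo, hxW, fun z => α (ι z), hβ₀.continuousOn.mono fun z hz => (hW z hz).2.1,
    fun z hz t => (hbd z (hW z hz).2 t).trans hR, fun z hz => ?_,
    fun z hz => hconst z (hW z hz).2.1, fun z hz t ht => ?_, a, b, ha, hb, hbpos, fun z hz => ?_⟩
  · beta_reduce
    rw [hαeq _ (hW z hz).2.1]; simp [ι, primitive_apply]
  · have h1 := hasDerivWithinAt_of_eq_primitive (hαeq _ (hW z hz).2.1) ht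
    have hs' : ((projIcc (0 : ℝ) 1 zero_le_one t : unitInterval) : ℝ) = t :=
      congrArg Subtype.val (projIcc_of_mem zero_le_one ht)
    have : timeSuperposition g hg.continuous (α (ι z)) (projIcc 0 1 zero_le_one t) =
        g ((projIcc (0 : ℝ) 1 zero_le_one t : unitInterval), α (ι z) (projIcc 0 1 zero_le_one t)) :=
      rfl
    rw [this, hs', hgR _ (hbd z (hW z hz).2 _).le] at h1
    exact h1
  · obtain ⟨⟨h1, h2⟩, h3⟩ := hW z hz
    beta_reduce
    rw [hG1 z h3, parabolicMap, h2, ← h1, haF]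
    refine Prod.ext ?_ ?_
    · simp only [smul_smul]; ring_nf
    · simp only [b₀]; ring

/-! ### Convergence of the eccentricity in the fixed frame -/

/-- The eccentricity vector in the fixed frame, `e^{iθ} Z`. -/
noncomputable def fixedEcc (x : (ℝ × ℝ × ℝ) × ℝ) : ℂ :=
  Complex.exp (x.2 * Complex.I) * rotEcc x.1

/-- A solution of the equations in the angle variable over one period is a piece of a trajectory of
the reduced system. It takes at least time `1`, which guarantees that the periods exhaust all times. -/
lemma IsTrajectory.exists_time_of_period {δ : ℝ} {Y : ℝ → (ℝ × ℝ × ℝ) × ℝ}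
    (hY : IsTrajectory (extField δ) extDomain Y) {q : ℝ → ℂ × ℝ} (hqc : Continuous q)
    (hq1 : ∀ t, ‖(q t).1‖ < 1) {l : ℝ}
    (hq : ∀ t ∈ Icc (0 : ℝ) 1,
      HasDerivWithinAt q (l ^ 3 • periodField δ (t, q t)) (Icc 0 1) t)
    (hq0 : (q 0).2 = 1) {S : ℝ} (hS : 0 ≤ S) {n : ℕ}
    (hYS : Y S = (ofRotEcc ((q 0).1, l), 2 * Real.pi * n)) :
    ∃ S', S + 1 ≤ S' ∧ Y S' = (ofRotEcc ((q 1).1, l * (q 1).2), 2 * Real.pi * (n + 1 : ℕ)) ∧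
      ∀ s ∈ Icc S S', ∃ t ∈ Icc (0 : ℝ) 1, fixedEcc (Y s) = (q t).1 := by
  set D : ℝ → ℝ := fun t => invRadius (2 * Real.pi * t) (q t).1 with hD
  have hDpos : ∀ t, 0 < D t := fun t => invRadius_pos (hq1 t)
  have hDc : Continuous D :=
    Continuous.comp (g := fun q : ℝ × ℂ => invRadius (2 * Real.pi * q.1) q.2)
      (f := fun t => (t, (q t).1)) (contDiff_invRadius (2 * Real.pi)).continuous (by fun_prop)
  set m : ℝ → ℝ := fun t => 2 * Real.pi * (D t ^ 2)⁻¹ with hm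
  have hmc : Continuous m :=
    ((hDc.pow 2).inv₀ fun s => pow_ne_zero _ (hDpos s).ne').const_mul (2 * Real.pi)
  have hpi := Real.pi_gt_three
  have hm1 : ∀ t, 1 ≤ m t := fun t => by
    have h1 : D t ≤ 1 + 1 := invRadius_le (hq1 t).le
    have h2 : D t ^ 2 ≤ 4 := by nlinarith [hDpos t]
    have h3 : (4 : ℝ)⁻¹ ≤ (D t ^ 2)⁻¹ := inv_anti₀ (pow_pos (hDpos t) 2) h2
    simp only [hm]; nlinarith
  set σ : ℝ → ℝ := fun t => S + ∫ u in (0 : ℝ)..t, m u with hσ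
  have hσ' : ∀ t, HasDerivAt σ (m t) t := fun t =>
    (intervalIntegral.integral_hasDerivAt_right (hmc.intervalIntegrable _ _)
      (hmc.stronglyMeasurableAtFilter _ _) hmc.continuousAt).const_add S
  have hσ0 : σ 0 = S := by simp [hσ]
  have hσge : ∀ t, 0 ≤ t → S + t ≤ σ t := fun t ht => by
    have := intervalIntegral.integral_mono (μ := MeasureTheory.volume) ht
      (continuous_const.intervalIntegrable 0 t) (hmc.intervalIntegrable 0 t) hm1
    simp only [intervalIntegral.integral_const, sub_zero, smul_eq_mul, mul_one] at this
    simp only [hσ]; linarith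
  set Z : ℝ → ℂ := fun t => Complex.exp (-(((2 * Real.pi * t : ℝ) : ℂ) * Complex.I)) * (q t).1
    with hZ
  have hDZ : ∀ t, D t = 1 + (Z t).re := fun t => rfl
  set x : ℝ → (ℝ × ℝ × ℝ) × ℝ := fun t =>
    (ofRotEcc (Z t, l * (q t).2), 2 * Real.pi * n + 2 * Real.pi * t) with hx
  have hx' : ∀ t ∈ Icc (0 : ℝ) 1,
      x t ∈ extDomain ∧ HasDerivWithinAt x (m t • extField δ (x t)) (Icc 0 1) t := by
    intro t ht
    have hD0 := hDpos t
    have hDne := hD0.ne'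
    refine ⟨show (0 : ℝ) < (1 + (Z t).re)⁻¹ from inv_pos.2 hD0, ?_⟩
    have hw := hasDerivWithinAt_fst (hq t ht)
    have hκ := hasDerivWithinAt_snd (hq t ht)
    have hE := ((hasDerivAt_cexp_neg_mul_I (2 * Real.pi * t)).scomp t
      ((hasDerivAt_id' t).const_mul (2 * Real.pi))).hasDerivWithinAt (s := Icc 0 1)
    set k : ℝ := 4 * Real.pi * δ * l ^ 3 * (q t).2 ^ 3 * (D t ^ 2)⁻¹ with hk
    have hZ' : HasDerivWithinAt Z (⟨2 * Real.pi * (Z t).im - k * (1 + (Z t).re),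
        -(2 * Real.pi) * (Z t).re - k * (Z t).im⟩ : ℂ) (Icc 0 1) t := by
      refine (hE.fun_mul hw).congr_deriv ?_
      have h1 : Complex.exp (-(((2 * Real.pi * t : ℝ) : ℂ) * Complex.I)) *
          (Complex.exp (((2 * Real.pi * t : ℝ) : ℂ) * Complex.I) + (q t).1) = 1 + Z t := by
        rw [mul_add, ← Complex.exp_add]; simp [hZ]
      have h2 : Complex.exp (-(((2 * Real.pi * t : ℝ) : ℂ) * Complex.I)) *
          (l ^ 3 • periodField δ (t, q t)).1 = -k * (1 + Z t) := by
        rw [← h1]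
        simp only [periodField, Prod.smul_fst, Complex.real_smul, hk, hD]
        push_cast; ring
      rw [Function.comp_apply, h2, mul_one, Complex.real_smul, mul_assoc, mul_assoc,
        show Complex.exp (-(((2 * Real.pi * t : ℝ) : ℂ) * Complex.I)) * (q t).1 = Z t from rfl]
      apply Complex.ext
      · simp; ring
      · simp; ring
    have hre : HasDerivWithinAt (fun t => (Z t).re) _ (Icc 0 1) t :=
      Complex.reCLM.hasFDerivAt.comp_hasDerivWithinAt t hZ'
    have him : HasDerivWithinAt (fun t => (Z t).im) _ (Icc 0 1) t :=
      Complex.imCLM.hasFDerivAt.comp_hasDerivWithinAt t hZ'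
    have hθ : HasDerivWithinAt (fun t => 2 * Real.pi * n + 2 * Real.pi * t) (2 * Real.pi)
        (Icc 0 1) t := by
      simpa using (((hasDerivAt_id' t).const_mul (2 * Real.pi)).const_add
        (2 * Real.pi * n)).hasDerivWithinAt
    have hfin := ((((hre.const_add 1).fun_inv (by rw [← hDZ]; exact hDne)).prodMk
      (him.fun_neg.prodMk (hκ.const_mul l)))).prodMk hθ
    refine hfin.congr_deriv ?_
    have hDr : (Z t).re = D t - 1 := by rw [hDZ]; ring
    have hinv : invRadius (2 * Real.pi * t) (q t).1 = D t := rfl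
    simp only [hx, extField, vectorField, ofRotEcc, periodField, hm, hk, Prod.smul_mk,
      smul_eq_mul, Complex.reCLM_apply, Complex.imCLM_apply, hDr, hinv]
    refine Prod.ext (Prod.ext ?_ (Prod.ext ?_ ?_)) ?_
    · simp only [add_sub_cancel]; field_simp; ring
    · simp only [add_sub_cancel]; field_simp; ring
    · field_simp
    · simp only [add_sub_cancel]; field_simp
  have hmain := hY.eq_comp_of_timeChange isOpen_extDomain (contDiffOn_extField δ)
    (x := x) (m := m) (σ := σ) hmc.continuousOn
    (fun t ht => ⟨by have := hσge t ht.1; linarith [ht.1], (hσ' t).hasDerivWithinAt⟩) hx'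
    (by rw [hσ0, hYS]; simp [hx, hZ, hq0])
  refine ⟨σ 1, by have := hσge 1 zero_le_one; linarith, ?_, fun s hs => ?_⟩
  · rw [← hmain 1 ⟨zero_le_one, le_rfl⟩]
    simp only [hx, hZ, mul_one]
    rw [Complex.exp_neg]
    push_cast
    rw [Complex.exp_two_pi_mul_I]
    simp [mul_add]
  · have hcont : ContinuousOn σ (Icc 0 1) := fun t _ => (hσ' t).continuousAt.continuousWithinAt
    obtain ⟨t, ht, rfl⟩ := intermediate_value_Icc zero_le_one hcont (by rwa [hσ0])
    refine ⟨t, ht, ?_⟩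
    rw [← hmain t ht]
    simp only [fixedEcc, hx, rotEcc_ofRotEcc, hZ]
    rw [← mul_assoc, ← Complex.exp_add]
    have h1 : ((2 * Real.pi * n + 2 * Real.pi * t : ℝ) : ℂ) * Complex.I +
        -(((2 * Real.pi * t : ℝ) : ℂ) * Complex.I) = n * (2 * Real.pi * Complex.I) := by
      push_cast; ring
    rw [h1, Complex.exp_nat_mul_two_pi_mul_I, one_mul]

/-- Near `l = 0` and inside the unit disc the fixed-frame eccentricity converges along every
trajectory, and its limit, as a function of the initial `Z` and of `l³`, is smooth up to
`l = 0`. -/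
theorem exists_limit_fixedEcc {δ : ℝ} (hδ : 0 < δ) {x₀ : ℂ} (hx₀ : ‖x₀‖ < 1) :
    ∃ O : Set (ℂ × ℝ), IsOpen O ∧ (x₀, (0 : ℝ)) ∈ O ∧ ∃ L : ℂ × ℝ → ℂ,
      (∀ z ∈ O, 0 ≤ z.2 → ‖L z‖ < 1 ∧ ∀ l, l ^ 3 = z.2 → ∀ Y, Y 0 = (ofRotEcc (z.1, l), 0) →
        IsTrajectory (extField δ) extDomain Y →
        Tendsto (fun s => fixedEcc (Y s)) atTop (𝓝 (L z))) ∧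
      ∀ k : ℕ, ∃ F : ℂ × ℝ → ℂ, ContDiffOn ℝ k F O ∧ (∀ z ∈ O, 0 ≤ z.2 → F z = L z) ∧
        ∀ x, F (x, 0) = x := by
  obtain ⟨W, hW, hxW, β, hβ, hβ1, hβ0, hβc, hβ', a, b, ha, hb, hbpos, hP⟩ :=
    exists_periodCurves hδ hx₀
  obtain ⟨O, hO, hxO, L, hL, hF⟩ := exists_parabolic_limit ha hb hbpos x₀ (hW.mem_nhds hxW)
  obtain ⟨F₀, hF₀, hF₀L, hF₀0⟩ := hF 0
  set W' : Set ℂ := {y | ((y, (0 : ℝ)) ∈ W) ∧ ‖y‖ < 1} with hW'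
  have hW'o : IsOpen W' := (hW.preimage (by fun_prop)).inter (isOpen_lt continuous_norm
    continuous_const)
  refine ⟨O ∩ F₀ ⁻¹' W', hF₀.continuousOn.isOpen_inter_preimage hO hW'o, ⟨hxO, ?_⟩, L,
    fun z hz hz2 => ?_, fun k => ?_⟩
  · rw [mem_preimage, hF₀0]; exact ⟨hxW, hx₀⟩
  · have hLW : L z ∈ W' := by rw [← hF₀L z hz.1 hz2]; exact hz.2
    refine ⟨hLW.2, fun l hl Y hY0 hY => ?_⟩
    obtain ⟨hmem, hlim⟩ := hL z hz.1 hz2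
    set P := parabolicMap a b
    -- one period of the angle
    have hstep : ∀ (n : ℕ) (S l' : ℝ), 0 ≤ S → l' ^ 3 = (P^[n] z).2 →
        Y S = (ofRotEcc ((P^[n] z).1, l'), 2 * Real.pi * n) →
        ∃ S' l'', S + 1 ≤ S' ∧ l'' ^ 3 = (P^[n + 1] z).2 ∧
          Y S' = (ofRotEcc ((P^[n + 1] z).1, l''), 2 * Real.pi * (n + 1 : ℕ)) ∧
          ∀ s ∈ Icc S S', ∃ t, fixedEcc (Y s) = (β (P^[n] z) t).1 := by
      intro n S l' hS hl' hYS
      have hzW := (hmem n).1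
      have e0 : projIcc (0 : ℝ) 1 zero_le_one 0 = 0 := projIcc_left _
      have e1 : projIcc (0 : ℝ) 1 zero_le_one 1 = 1 := projIcc_right _
      obtain ⟨S', h1, h2, h3⟩ := hY.exists_time_of_period
        (q := fun s => β (P^[n] z) (projIcc 0 1 zero_le_one s)) (l := l')
        ((β (P^[n] z)).continuous.comp continuous_projIcc) (fun t => hβ1 _ hzW _)
        (fun t ht => by rw [hl']; exact hβ' _ hzW t ht)
        (by rw [e0, hβ0 _ hzW]) hS (n := n)
        (by rw [e0, hβ0 _ hzW]; exact hYS)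
      rw [e1] at h2
      have h4 := hP _ hzW
      have h5 : P^[n + 1] z = ((β (P^[n] z) 1).1, (P^[n] z).2 * (β (P^[n] z) 1).2 ^ 3) := by
        rw [Function.iterate_succ_apply', h4]
      refine ⟨S', l' * (β (P^[n] z) 1).2, h1, ?_, ?_, fun s hs => ?_⟩
      · rw [h5, mul_pow, hl']
      · rw [h2, h5]
      · obtain ⟨t, -, ht⟩ := h3 s hs
        exact ⟨_, ht⟩
    have hstart : ∀ n : ℕ, ∃ S l', 0 ≤ S ∧ l' ^ 3 = (P^[n] z).2 ∧
        Y S = (ofRotEcc ((P^[n] z).1, l'), 2 * Real.pi * n) := by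
      intro n
      induction n with
      | zero => exact ⟨0, l, le_rfl, hl, by simpa using hY0⟩
      | succ n ih =>
        obtain ⟨S, l', h1, h2, h3⟩ := ih
        obtain ⟨S', l'', h4, h5, h6, -⟩ := hstep n S l' h1 h2 h3
        exact ⟨S', l'', by linarith, h5, h6⟩
    rw [Metric.tendsto_atTop]
    intro ε hε
    have hβlim : Tendsto (fun n => β (P^[n] z)) atTop (𝓝 (constCurve (ℂ × ℝ) (L z, 1))) := by
      have h1 := (hβ.continuousAt (hW.mem_nhds hLW.1)).tendsto
      rw [hβc _ hLW.1 rfl] at h1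
      exact h1.comp hlim
    obtain ⟨N, hN⟩ := Metric.tendsto_atTop.1 hβlim ε hε
    have hclose : ∀ n ≥ N, ∀ t, dist (β (P^[n] z) t).1 (L z) < ε := fun n hn t =>
      ((le_max_left _ _).trans (ContinuousMap.dist_apply_le_dist (f := β (P^[n] z))
        (g := constCurve (ℂ × ℝ) (L z, 1)) t)).trans_lt (hN n hn)
    -- the periods after the `N`-th one cover all later times, since each of them takes time at least `1`
    have hrun : ∀ m : ℕ, ∀ n ≥ N, ∀ S l', 0 ≤ S → l' ^ 3 = (P^[n] z).2 →
        Y S = (ofRotEcc ((P^[n] z).1, l'), 2 * Real.pi * n) →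
        ∀ s ∈ Icc S (S + m), dist (fixedEcc (Y s)) (L z) < ε := by
      intro m
      induction m with
      | zero =>
        intro n hn S l' h1 h2 h3 s hs
        obtain ⟨S', -, h4, -, -, h7⟩ := hstep n S l' h1 h2 h3
        obtain ⟨t, ht⟩ := h7 s ⟨hs.1, by have := hs.2; simp at this; linarith⟩
        rw [ht]; exact hclose n hn t
      | succ m ih =>
        intro n hn S l' h1 h2 h3 s hs
        obtain ⟨S', l'', h4, h5, h6, h7⟩ := hstep n S l' h1 h2 h3
        rcases le_total s S' with h | h
        · obtain ⟨t, ht⟩ := h7 s ⟨hs.1, h⟩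
          rw [ht]; exact hclose n hn t
        · refine ih (n + 1) (by omega) S' l'' (by linarith) h5 h6 s ⟨h, ?_⟩
          have := hs.2
          push_cast at this; linarith
    obtain ⟨S, l', h1, h2, h3⟩ := hstart N
    refine ⟨S, fun s hs => ?_⟩
    obtain ⟨m, hm⟩ := exists_nat_ge (s - S)
    exact hrun m N le_rfl S l' h1 h2 h3 s ⟨hs, by linarith⟩
  · obtain ⟨F, h1, h2, h3⟩ := hF k
    exact ⟨F, h1.mono inter_subset_left, fun z hz => h2 z hz.1, h3⟩

/-! ### Stable sets and limits of the eccentricity -/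

section StableSets

lemma tendsto_comp_add_real_iff {α : Type*} {f : ℝ → α} {l : Filter α} (c : ℝ) :
    Tendsto (fun s => f (s + c)) atTop l ↔ Tendsto f atTop l := by
  have h : map (fun s : ℝ => s + c) atTop = atTop := (OrderIso.addRight c).map_atTop
  conv_rhs => rw [← h, tendsto_map'_iff]
  rfl

variable {δ : ℝ} {Y : ℝ → (ℝ × ℝ × ℝ) × ℝ}

lemma IsTrajectory.reduced (h : IsTrajectory (extField δ) extDomain Y) :
    IsTrajectory (vectorField δ) posDomain fun s => (Y s).1 := fun s hs =>
  ⟨(h s hs).1, hasDerivWithinAt_fst (h s hs).2⟩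

lemma IsTrajectory.mem_phaseSpace (hδ : 0 < δ) (h : IsTrajectory (extField δ) extDomain Y)
    (h0 : (Y 0).1 ∈ phaseSpace) {s : ℝ} (hs : 0 ≤ s) : (Y s).1 ∈ phaseSpace :=
  ⟨(h s hs).1, by rw [h.ang_eq hδ h0.2 hs]; exact radialDecay_nonneg hδ h0.2 hs⟩

/-- Whether the initial point lies in a stable set can be decided on any trajectory that starts there,
by uniqueness. -/
lemma IsTrajectory.mem_stableSet_iff (hδ : 0 < δ) (h : IsTrajectory (extField δ) extDomain Y)
    (h0 : (Y 0).1 ∈ phaseSpace) (A : Set (ℝ × ℝ × ℝ)) :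
    (Y 0).1 ∈ stableSet δ A ↔
      Tendsto (fun s => Metric.infDist (Y s).1 A) atTop (𝓝 0) := by
  constructor
  · rintro ⟨γ, hγ0, hγ, hlim⟩
    have h1 : IsTrajectory (vectorField δ) posDomain γ := fun s hs => ⟨(hγ s hs).1.1, (hγ s hs).2⟩
    have h2 := h.reduced.eqOn isOpen_posDomain (contDiffOn_vectorField δ) h1 hγ0.symm
    refine hlim.congr' ?_
    filter_upwards [eventually_ge_atTop 0] with s hs
    rw [← h2 hs]
  · exact fun hlim => ⟨fun s => (Y s).1, rfl, fun s hs => ⟨h.mem_phaseSpace hδ h0 hs,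
      (h.reduced s hs).2⟩, hlim⟩

lemma stableSet_subset_phaseSpace (A : Set (ℝ × ℝ × ℝ)) : stableSet δ A ⊆ phaseSpace := by
  rintro p ⟨γ, rfl, hγ, -⟩
  exact (hγ 0 (mem_Ici.2 le_rfl)).1

/-- Stable sets are invariant under the flow, in both directions. -/
lemma IsTrajectoryOn.mem_stableSet_iff (hδ : 0 < δ) {T : ℝ} (hT : 0 ≤ T)
    {u : ℝ → ℝ × ℝ × ℝ} (hu : IsTrajectoryOn (vectorField δ) posDomain T u)
    (h0 : u 0 ∈ phaseSpace) (A : Set (ℝ × ℝ × ℝ)) :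
    u 0 ∈ stableSet δ A ↔ u T ∈ stableSet δ A := by
  obtain ⟨Y, hY0, hY⟩ := exists_isTrajectory_extField hδ h0 0
  have h1 : u T = (Y (0 + T)).1 := by
    rw [zero_add]
    exact hu.eqOn isOpen_posDomain (contDiffOn_vectorField δ) (hY.reduced.restrict T)
      (by rw [hY0]) ⟨hT, le_rfl⟩
  have h2 : u 0 = (Y 0).1 := by rw [hY0]
  have h3 : (Y 0).1 ∈ phaseSpace := by rwa [← h2]
  rw [h1, h2, hY.mem_stableSet_iff hδ h3, (hY.shift hT).mem_stableSet_iff hδ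
    (hY.mem_phaseSpace hδ h3 (by linarith))]
  exact (tendsto_comp_add_real_iff T
    (f := fun s => Metric.infDist (Y s).1 A)).symm

lemma hamiltonian_eq {p : ℝ × ℝ × ℝ} (hp : p.1 ≠ 0) :
    hamiltonian p.1 p.2.1 = ‖rotEcc p‖ ^ 2 / 2 := by
  rw [← Complex.normSq_eq_norm_sq, Complex.normSq_apply, hamiltonian, rotEcc_re, rotEcc_im]
  field_simp
  ring

lemma mem_Γ₁_iff {h : ℝ} {p : ℝ × ℝ × ℝ} :
    p ∈ Γ₁ h ↔ 0 < p.1 ∧ ‖rotEcc p‖ ^ 2 = 2 * h ∧ p.2.2 = 0 := by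
  constructor
  · rintro ⟨h1, h2, h3⟩
    rw [hamiltonian_eq h1.ne'] at h2
    exact ⟨h1, by linarith, h3⟩
  · rintro ⟨h1, h2, h3⟩
    refine ⟨h1, ?_, h3⟩
    rw [hamiltonian_eq h1.ne']; linarith

lemma one_add_re_pos {ζ : ℂ} (h : ‖ζ‖ < 1) : 0 < 1 + ζ.re := by
  have := (abs_le.1 (Complex.abs_re_le_norm ζ)).1
  linarith

lemma ofRotEcc_mem_Γ₁ {h : ℝ} {ζ : ℂ} (hζ : ‖ζ‖ < 1) (hh : ‖ζ‖ ^ 2 = 2 * h) :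
    ofRotEcc (ζ, 0) ∈ Γ₁ h := by
  refine mem_Γ₁_iff.2 ⟨inv_pos.2 (one_add_re_pos hζ), ?_, rfl⟩
  rw [rotEcc_ofRotEcc, hh]

lemma norm_lt_one_of_sq_eq {ζ : ℂ} {h : ℝ} (hh : h < 1 / 2) (hζ : ‖ζ‖ ^ 2 = 2 * h) : ‖ζ‖ < 1 := by
  nlinarith [norm_nonneg ζ]

lemma Γ₁_zero : Γ₁ 0 = {q₁} := by
  ext p
  rw [mem_Γ₁_iff, mem_singleton_iff]
  constructor
  · rintro ⟨h1, h2, h3⟩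
    have h4 : rotEcc p = 0 := by
      rw [mul_zero] at h2
      exact norm_eq_zero.1 (pow_eq_zero_iff (two_ne_zero) |>.1 h2)
    rw [← ofRotEcc_rotEcc p, h4, h3]
    simp [ofRotEcc, q₁]
  · rintro rfl
    have : rotEcc q₁ = 0 := by apply Complex.ext <;> simp [q₁]
    refine ⟨by simp [q₁], by simp [this], rfl⟩

lemma contDiffOn_rotEcc : ContDiffOn ℝ ∞ rotEcc posDomain := by
  have h1 : ContDiffOn ℝ ∞ (fun p : ℝ × ℝ × ℝ => ((p.1⁻¹ - 1, -p.2.1) : ℝ × ℝ)) posDomain := by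
    refine ContDiffOn.prodMk ?_ (by fun_prop)
    exact (contDiffOn_fst.inv fun p hp => ne_of_gt hp).sub contDiffOn_const
  exact Complex.equivRealProdCLM.symm.contDiff.comp_contDiffOn h1

lemma contDiffOn_ofRotEcc : ContDiffOn ℝ ∞ ofRotEcc {z : ℂ × ℝ | 0 < 1 + z.1.re} := by
  have h1 : ContDiff ℝ ∞ fun z : ℂ × ℝ => z.1.re := Complex.reCLM.contDiff.comp contDiff_fst
  have h2 : ContDiff ℝ ∞ fun z : ℂ × ℝ => z.1.im := Complex.imCLM.contDiff.comp contDiff_fst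
  have h3 : ContDiffOn ℝ ∞ (fun z : ℂ × ℝ => (1 + z.1.re)⁻¹) {z : ℂ × ℝ | 0 < 1 + z.1.re} :=
    ContDiffOn.inv (contDiff_const.add h1).contDiffOn fun z hz => ne_of_gt hz
  exact h3.prodMk (h2.neg.prodMk contDiff_snd).contDiffOn

lemma isCompact_Γ₁ {h : ℝ} (hh : h < 1 / 2) : IsCompact (Γ₁ h) := by
  have h1 : Γ₁ h = (fun ζ : ℂ => ofRotEcc (ζ, 0)) '' {ζ | ‖ζ‖ ^ 2 = 2 * h} := by
    ext p
    constructor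
    · intro hp
      obtain ⟨h2, h3, h4⟩ := mem_Γ₁_iff.1 hp
      exact ⟨rotEcc p, h3, by beta_reduce; rw [← h4, ofRotEcc_rotEcc]⟩
    · rintro ⟨ζ, hζ, rfl⟩
      exact ofRotEcc_mem_Γ₁ (norm_lt_one_of_sq_eq hh hζ) hζ
  have h2 : IsCompact {ζ : ℂ | ‖ζ‖ ^ 2 = 2 * h} := by
    refine (ProperSpace.isCompact_closedBall (0 : ℂ) 1).of_isClosed_subset
      (isClosed_eq (by fun_prop) continuous_const) fun ζ hζ => ?_
    simpa using (norm_lt_one_of_sq_eq hh hζ).le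
  rw [h1]
  refine h2.image_of_continuousOn (contDiffOn_ofRotEcc.continuousOn.comp (by fun_prop) ?_)
  exact fun ζ hζ => one_add_re_pos (norm_lt_one_of_sq_eq hh hζ)

lemma Γ₁_nonempty {h : ℝ} (h0 : 0 ≤ h) (hh : h < 1 / 2) : (Γ₁ h).Nonempty := by
  have h1 : ‖((√(2 * h) : ℝ) : ℂ)‖ ^ 2 = 2 * h := by
    rw [Complex.norm_real, Real.norm_eq_abs, sq_abs, Real.sq_sqrt (by positivity)]
  exact ⟨_, ofRotEcc_mem_Γ₁ (norm_lt_one_of_sq_eq hh h1) h1⟩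

/-- Curves converging to a compact set are eventually in every neighbourhood of it. -/
lemma eventually_mem_of_tendsto_infDist {α : Type*} {l : Filter α} {E : Type*}
    [PseudoMetricSpace E] {γ : α → E} {A V : Set E} (hA : IsCompact A) (hne : A.Nonempty)
    (hV : IsOpen V) (hAV : A ⊆ V) (h : Tendsto (fun s => Metric.infDist (γ s) A) l (𝓝 0)) :
    ∀ᶠ s in l, γ s ∈ V := by
  obtain ⟨ε, hε, hεV⟩ := hA.exists_thickening_subset_open hV hAV
  filter_upwards [h.eventually (gt_mem_nhds hε)] with s hs
  exact hεV ((Metric.mem_thickening_iff_infDist_lt hne).2 hs)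

/-- On the stable set of `Γ₁(h)`, `|Z|²` converges to `2 h`. -/
lemma tendsto_norm_sq_of_tendsto_infDist {h : ℝ} (h0 : 0 ≤ h) (hh : h < 1 / 2)
    (hlim : Tendsto (fun s => Metric.infDist (Y s).1 (Γ₁ h)) atTop (𝓝 0)) :
    Tendsto (fun s => ‖rotEcc (Y s).1‖ ^ 2) atTop (𝓝 (2 * h)) := by
  rw [Metric.tendsto_nhds]
  intro ε hε
  have hc : ContinuousOn (fun p => ‖rotEcc p‖ ^ 2) posDomain := contDiffOn_rotEcc.continuousOn.norm.pow 2
  have hV : IsOpen (posDomain ∩ (fun p => ‖rotEcc p‖ ^ 2) ⁻¹' Metric.ball (2 * h) ε) :=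
    hc.isOpen_inter_preimage isOpen_posDomain Metric.isOpen_ball
  filter_upwards [eventually_mem_of_tendsto_infDist (isCompact_Γ₁ hh) (Γ₁_nonempty h0 hh) hV
    (fun p hp => by
      obtain ⟨h1, h2, -⟩ := mem_Γ₁_iff.1 hp
      exact ⟨h1, by rw [mem_preimage, h2]; exact Metric.mem_ball_self hε⟩) hlim] with s hs
  exact hs.2

lemma norm_fixedEcc (x : (ℝ × ℝ × ℝ) × ℝ) : ‖fixedEcc x‖ = ‖rotEcc x.1‖ := by
  rw [fixedEcc, norm_mul, Complex.norm_exp_ofReal_mul_I, one_mul]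

lemma rotEcc_eq_fixedEcc (x : (ℝ × ℝ × ℝ) × ℝ) :
    rotEcc x.1 = Complex.exp (-(x.2 * Complex.I)) * fixedEcc x := by
  rw [fixedEcc, ← mul_assoc, ← Complex.exp_add]; simp

/-- If the fixed-frame eccentricity converges to `ζ` with `|ζ|² = 2 h < 1`, the orbit converges to
`Γ₁(h)`. -/
lemma IsTrajectory.tendsto_infDist (hδ : 0 < δ) (hY : IsTrajectory (extField δ) extDomain Y)
    (h0 : (Y 0).1 ∈ phaseSpace) {ζ : ℂ} (hζ : Tendsto (fun s => fixedEcc (Y s)) atTop (𝓝 ζ))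
    {h : ℝ} (hh : h < 1 / 2) (hζh : ‖ζ‖ ^ 2 = 2 * h) :
    Tendsto (fun s => Metric.infDist (Y s).1 (Γ₁ h)) atTop (𝓝 0) := by
  have hζ1 := norm_lt_one_of_sq_eq hh hζh
  set d : ℝ := 1 - ‖ζ‖ with hd
  have hd0 : 0 < d := sub_pos.2 hζ1
  have hε : Tendsto (fun s => ‖fixedEcc (Y s) - ζ‖) atTop (𝓝 0) :=
    tendsto_iff_norm_sub_tendsto_zero.1 hζ
  have hbound : Tendsto (fun s => 2 / d ^ 2 * ‖fixedEcc (Y s) - ζ‖ + ‖fixedEcc (Y s) - ζ‖ +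
      radialDecay δ (Y 0).1.2.2 s) atTop (𝓝 0) := by
    simpa using ((hε.const_mul (2 / d ^ 2)).add hε).add (tendsto_radialDecay hδ h0.2)
  refine squeeze_zero' (Eventually.of_forall fun s => Metric.infDist_nonneg) ?_ hbound
  filter_upwards [eventually_ge_atTop 0, hε.eventually (gt_mem_nhds (half_pos hd0))] with s hs hsd
  set ζ' : ℂ := Complex.exp (-((Y s).2 * Complex.I)) * ζ with hζ'
  have hn' : ‖ζ'‖ = ‖ζ‖ := by rw [hζ', norm_mul, norm_cexp_neg, one_mul]
  have hmem : ofRotEcc (ζ', 0) ∈ Γ₁ h := ofRotEcc_mem_Γ₁ (by rwa [hn']) (by rw [hn', hζh])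
  refine (Metric.infDist_le_dist_of_mem hmem).trans ?_
  set ε := ‖fixedEcc (Y s) - ζ‖ with hεdef
  have hZ : ‖rotEcc (Y s).1 - ζ'‖ = ε := by
    rw [rotEcc_eq_fixedEcc, hζ', ← mul_sub, norm_mul, norm_cexp_neg, one_mul]
  have hre : |(rotEcc (Y s).1).re - ζ'.re| ≤ ε := by
    rw [← hZ, ← Complex.sub_re]; exact Complex.abs_re_le_norm _
  have him : |(rotEcc (Y s).1).im - ζ'.im| ≤ ε := by
    rw [← hZ, ← Complex.sub_im]; exact Complex.abs_im_le_norm _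
  have hε0 : 0 ≤ ε := norm_nonneg _
  have hr : 0 < (Y s).1.1 := (hY s hs).1
  have hDζ : d ≤ 1 + ζ'.re := by
    have := (abs_le.1 (Complex.abs_re_le_norm ζ')).1
    rw [hn'] at this; linarith
  have hD : d / 2 ≤ (Y s).1.1⁻¹ := by
    rw [rotEcc_re] at hre
    have := (abs_le.1 hre).1; linarith
  have hDpos : 0 < (Y s).1.1⁻¹ := by positivity
  have hl := hY.ang_eq hδ h0.2 hs
  have hl0 : 0 ≤ radialDecay δ (Y 0).1.2.2 s := radialDecay_nonneg hδ h0.2 hs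
  rw [Prod.dist_eq, Prod.dist_eq]
  refine max_le ?_ (max_le ?_ ?_)
  · have h1 : (Y s).1.1 - (1 + ζ'.re)⁻¹ =
        (ζ'.re - (rotEcc (Y s).1).re) * ((Y s).1.1 * (1 + ζ'.re)⁻¹) := by
      have : 1 + ζ'.re ≠ 0 := by linarith
      rw [rotEcc_re]; field_simp; ring
    have h2 : (Y s).1.1 ≤ 2 / d := by
      have := inv_anti₀ (half_pos hd0) hD
      rwa [inv_inv, inv_div] at this
    have h3 : (1 + ζ'.re)⁻¹ ≤ 1 / d := by
      rw [one_div]; exact inv_anti₀ hd0 hDζ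
    have h4 : 0 ≤ (1 + ζ'.re)⁻¹ := inv_nonneg.2 (by linarith)
    have h5 : dist (Y s).1.1 (1 + ζ'.re)⁻¹ ≤ 2 / d ^ 2 * ε := by
      rw [Real.dist_eq, h1, abs_mul, abs_sub_comm, abs_of_nonneg (mul_nonneg hr.le h4)]
      calc _ ≤ ε * (2 / d * (1 / d)) := by gcongr
        _ = _ := by field_simp
    have h6 : (ofRotEcc (ζ', 0)).1 = (1 + ζ'.re)⁻¹ := rfl
    rw [h6]; linarith
  · have h5 : dist (Y s).1.2.1 (ofRotEcc (ζ', 0)).2.1 ≤ ε := by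
      rw [Real.dist_eq]
      rw [rotEcc_im, ← abs_neg] at him
      convert him using 2
      simp only [ofRotEcc]; ring
    have : 0 ≤ 2 / d ^ 2 * ε := by positivity
    linarith
  · have h5 : dist (Y s).1.2.2 (ofRotEcc (ζ', 0)).2.2 = radialDecay δ (Y 0).1.2.2 s := by
      rw [Real.dist_eq, hl]
      simp only [ofRotEcc, sub_zero]
      exact abs_of_nonneg hl0
    rw [h5]
    have : 0 ≤ 2 / d ^ 2 * ε := by positivity
    linarith

lemma IsTrajectory.sub_angle (hY : IsTrajectory (extField δ) extDomain Y) (θ : ℝ) :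
    IsTrajectory (extField δ) extDomain fun s => ((Y s).1, (Y s).2 - θ) := fun s hs =>
  ⟨(hY s hs).1, (hasDerivWithinAt_fst (hY s hs).2).prodMk
    ((hasDerivWithinAt_snd (hY s hs).2).sub_const θ)⟩

/-- Along orbits in the stable set of `Γ₁(h)` the fixed-frame eccentricity converges: such an orbit
enters a neighbourhood of `Γ₁(h)` in which all trajectories have this property. -/
lemma IsTrajectory.exists_tendsto_fixedEcc (hδ : 0 < δ)
    (hY : IsTrajectory (extField δ) extDomain Y) (h0 : (Y 0).1 ∈ phaseSpace) {h : ℝ} (hh0 : 0 ≤ h)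
    (hh : h < 1 / 2)
    (hlim : Tendsto (fun s => Metric.infDist (Y s).1 (Γ₁ h)) atTop (𝓝 0)) :
    ∃ ζ : ℂ, Tendsto (fun s => fixedEcc (Y s)) atTop (𝓝 ζ) ∧ ‖ζ‖ ^ 2 = 2 * h := by
  suffices H : ∃ ζ : ℂ, Tendsto (fun s => fixedEcc (Y s)) atTop (𝓝 ζ) by
    obtain ⟨ζ, hζ⟩ := H
    refine ⟨ζ, hζ, tendsto_nhds_unique (hζ.norm.pow 2) ?_⟩
    simpa only [norm_fixedEcc] using tendsto_norm_sq_of_tendsto_infDist hh0 hh hlim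
  have hex : ∀ p ∈ Γ₁ h, ∃ V : Set (ℝ × ℝ × ℝ), IsOpen V ∧ p ∈ V ∧ ∀ s, 0 ≤ s → (Y s).1 ∈ V →
      ∃ ζ : ℂ, Tendsto (fun s => fixedEcc (Y s)) atTop (𝓝 ζ) := by
    intro p hp
    obtain ⟨hp1, hp2, hp3⟩ := mem_Γ₁_iff.1 hp
    obtain ⟨O, hO, hpO, L, hL, -⟩ := exists_limit_fixedEcc hδ (norm_lt_one_of_sq_eq hh hp2)
    have hc : ContinuousOn (fun p : ℝ × ℝ × ℝ => (rotEcc p, p.2.2 ^ 3)) posDomain :=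
      contDiffOn_rotEcc.continuousOn.prodMk (by fun_prop)
    refine ⟨posDomain ∩ (fun p : ℝ × ℝ × ℝ => (rotEcc p, p.2.2 ^ 3)) ⁻¹' O,
      hc.isOpen_inter_preimage isOpen_posDomain hO, ⟨hp1, ?_⟩, fun s hs hsV => ?_⟩
    · simpa [hp3] using hpO
    · have hph := hY.mem_phaseSpace hδ h0 hs
      have h1 := (hL _ hsV.2 (pow_nonneg hph.2 3)).2 (Y s).1.2.2 rfl _ (by
        simp [ofRotEcc_rotEcc]) ((hY.shift hs).sub_angle (Y s).2)
      refine ⟨_, (tendsto_comp_add_real_iff s).1 ((h1.const_mul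
        (Complex.exp ((Y s).2 * Complex.I))).congr fun r => ?_)⟩
      rw [fixedEcc, fixedEcc, ← mul_assoc, ← Complex.exp_add]
      congr 2
      push_cast; ring
  choose! V hVo hpV hV using hex
  obtain ⟨s, hs0, hs⟩ := ((eventually_ge_atTop 0).and (eventually_mem_of_tendsto_infDist
    (isCompact_Γ₁ hh) (Γ₁_nonempty hh0 hh) (V := ⋃ p ∈ Γ₁ h, V p)
    (isOpen_biUnion hVo) (fun p hp => mem_biUnion hp (hpV p hp)) hlim)).exists
  obtain ⟨p, hp, hsp⟩ := mem_iUnion₂.1 hs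
  exact hV p hp s hs0 hsp

end StableSets

/-! ### Charts adapted to the stable sets -/

/-- `G` is a chart of the phase space on `U`, with values in `O ∩ {l ≥ 0}` and with inverse `Ψ`,
whose first component is (up to a rotation) the limit of the eccentricity and whose second
component vanishes exactly on the boundary `l = 0`. The inverse `Ψ` is smooth up to the boundary. -/
structure IsLimitChart (δ : ℝ) (U : Set (ℝ × ℝ × ℝ)) (O : Set (ℂ × ℝ)) (Ψ : ℂ × ℝ → ℝ × ℝ × ℝ)
    (G : ℝ × ℝ × ℝ → ℂ × ℝ) : Prop where
  isOpen_source : IsOpen U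
  isOpen_target : IsOpen O
  contDiffOn_symm : ContDiffOn ℝ ∞ Ψ (O ∩ {z | 0 ≤ z.2})
  contDiffOn_one : ContDiffOn ℝ 1 G U
  contDiffOn_interior : ContDiffOn ℝ ∞ G (U ∩ {p | 0 < p.2.2})
  map_source : ∀ p ∈ U ∩ phaseSpace, G p ∈ O ∧ 0 ≤ (G p).2 ∧ Ψ (G p) = p
  map_target : ∀ z ∈ O, 0 ≤ z.2 → Ψ z ∈ U ∩ phaseSpace ∧ G (Ψ z) = z
  boundary_iff : ∀ p ∈ U ∩ phaseSpace, (G p).2 = 0 ↔ p.2.2 = 0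
  mem_stableSet_iff : ∀ p ∈ U ∩ phaseSpace, ∀ h ∈ Ico (0 : ℝ) (1 / 2),
    p ∈ stableSet δ (Γ₁ h) ↔ ‖(G p).1‖ ^ 2 = 2 * h

lemma uniqueDiffOn_halfSpace_prod {X : Type} [NormedAddCommGroup X] [NormedSpace ℝ X] :
    UniqueDiffOn ℝ {z : X × ℝ | 0 ≤ z.2} := by
  have h1 : {z : X × ℝ | 0 ≤ z.2} = univ ×ˢ Ici 0 := by ext z; simp
  rw [h1]
  exact uniqueDiffOn_univ.prod (uniqueDiffOn_Ici 0)

/-- The inverse of a `C^1` map that coincides on a half space, for every `k`, with a `C^k` map is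
smooth on the half space. -/
lemma contDiffOn_symm_of_eqOn_halfSpace {X : Type} [NormedAddCommGroup X] [NormedSpace ℝ X]
    [FiniteDimensional ℝ X] {N : Set (X × ℝ)} (hN : IsOpen N) {M : X × ℝ → X × ℝ}
    (hM : ∀ k : ℕ, ∃ M', ContDiffOn ℝ k M' N ∧ (∀ z, (M' z).2 = z.2) ∧
      EqOn M' M (N ∩ {z | 0 ≤ z.2}))
    (hM2 : ∀ z, (M z).2 = z.2) (e : OpenPartialHomeomorph (X × ℝ) (X × ℝ)) (heN : e.source ⊆ N)
    (heM : ∀ z, e z = M z)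
    (hd : ∀ z ∈ e.source, ∃ g : (X × ℝ) ≃L[ℝ] X × ℝ, HasFDerivAt M (g : X × ℝ →L[ℝ] X × ℝ) z) :
    ContDiffOn ℝ ∞ e.symm (e.target ∩ {z | 0 ≤ z.2}) := by
  have : CompleteSpace X := FiniteDimensional.complete ℝ X
  have hsymm2 : ∀ y ∈ e.target, (e.symm y).2 = y.2 := fun y hy => by
    rw [← hM2, ← heM, e.right_inv hy]
  intro y hy
  rw [contDiffWithinAt_infty]
  intro k
  suffices H : ContDiffWithinAt ℝ (k + 1 : ℕ) e.symm (e.target ∩ {z | 0 ≤ z.2}) y from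
    H.of_le (by exact_mod_cast k.le_succ)
  obtain ⟨M', hM', hM'2, hMM'⟩ := hM (k + 1)
  set x := e.symm y with hx
  have hxs : x ∈ e.source := e.map_target hy.1
  have hx2 : 0 ≤ x.2 := by rw [hx, hsymm2 y hy.1]; exact hy.2
  have hxN : x ∈ N ∩ {z | 0 ≤ z.2} := ⟨heN hxs, hx2⟩
  obtain ⟨g, hg⟩ := hd x hxs
  -- the two maps have the same derivative at points of the half space
  have hg' : HasFDerivAt M' (g : X × ℝ →L[ℝ] X × ℝ) x := by
    have h1 : DifferentiableAt ℝ M' x :=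
      (hM'.contDiffAt (hN.mem_nhds hxN.1)).differentiableAt (by simp)
    have hu : UniqueDiffWithinAt ℝ (N ∩ {z | 0 ≤ z.2}) x := by
      rw [inter_comm]
      exact (uniqueDiffOn_halfSpace_prod x hx2).inter (hN.mem_nhds hxN.1)
    have h2 : HasFDerivWithinAt M' (g : X × ℝ →L[ℝ] X × ℝ) (N ∩ {z | 0 ≤ z.2}) x :=
      hg.hasFDerivWithinAt.congr hMM' (hMM' hxN)
    have h3 := hu.eq h1.hasFDerivAt.hasFDerivWithinAt h2
    rw [← h3]; exact h1.hasFDerivAt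
  obtain ⟨e', hxe', he'N, he'M, he', -⟩ := exists_openPartialHomeomorph_contDiffOn
    (n := ((k + 1 : ℕ) : WithTop ℕ∞)) (by exact_mod_cast Nat.succ_pos k) hN hM' hxN.1 hg'
  have hMx : M x = y := by rw [← heM, hx, e.right_inv hy.1]
  have hye' : e' x = y := by rw [he'M, hMM' hxN, hMx]
  have hyt : y ∈ e'.target := hye' ▸ e'.map_source hxe'
  have hsy : e'.symm y = x := by rw [← hye', e'.left_inv hxe']
  refine (he'.contDiffAt (e'.open_target.mem_nhds hyt)).contDiffWithinAt.congr_of_eventuallyEq ?_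
    hsy.symm
  have h1 : ∀ᶠ y' in 𝓝 y, y' ∈ e'.target := e'.open_target.mem_nhds hyt
  have h2 : ∀ᶠ y' in 𝓝 y, e'.symm y' ∈ e.source :=
    (e'.continuousAt_symm hyt).eventually (e.open_source.mem_nhds (hsy ▸ hxs))
  filter_upwards [mem_nhdsWithin_of_mem_nhds (h1.and h2), self_mem_nhdsWithin] with y' hy' hy2
  have h3 : M' (e'.symm y') = y' := by rw [← he'M, e'.right_inv hy'.1]
  have h4 : 0 ≤ (e'.symm y').2 := by rw [← hM'2, h3]; exact hy2.2
  rw [hMM' ⟨heN hy'.2, h4⟩, ← heM] at h3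
  rw [← h3, e.left_inv hy'.2, h3]

/-- A chart near a boundary point: `G = (L(Z, l³), l)`, where `L` is the limit of the fixed-frame
eccentricity. Its derivative at the boundary point is the identity in the coordinates `(Z, l)`. For
`l < 0` the limit is replaced by a `C^1` extension. -/
theorem exists_isLimitChart_boundary {δ : ℝ} (hδ : 0 < δ) {p₀ : ℝ × ℝ × ℝ} (hp₀ : 0 < p₀.1)
    (hl : p₀.2.2 = 0) (hZ : ‖rotEcc p₀‖ < 1) :
    ∃ U O Ψ G, p₀ ∈ U ∧ IsLimitChart δ U O Ψ G := by
  obtain ⟨O₀, hO₀, hxO₀, L, hL, hF⟩ := exists_limit_fixedEcc hδ hZ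
  set N : Set (ℂ × ℝ) := {z | (z.1, z.2 ^ 3) ∈ O₀ ∧ ‖z.1‖ < 1} with hN
  have hcube : ContDiff ℝ ∞ fun z : ℂ × ℝ => (z.1, z.2 ^ 3) := by fun_prop
  have hNo : IsOpen N := (hO₀.preimage hcube.continuous).inter
    (isOpen_lt continuous_fst.norm continuous_const)
  have hMk : ∀ F : ℂ × ℝ → ℂ, ∀ k : ℕ, ContDiffOn ℝ k F O₀ →
      ContDiffOn ℝ k (fun z : ℂ × ℝ => (F (z.1, z.2 ^ 3), z.2)) N := fun F k hF =>
    (hF.comp (hcube.of_le (by exact_mod_cast le_top)).contDiffOn fun z hz => hz.1).prodMk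
      contDiff_snd.contDiffOn
  obtain ⟨F, hF1, hFL, hF0⟩ := hF 1
  set M : ℂ × ℝ → ℂ × ℝ := fun z => (F (z.1, z.2 ^ 3), z.2) with hM
  have hxN : (rotEcc p₀, (0 : ℝ)) ∈ N := ⟨by simpa using hxO₀, hZ⟩
  have hM' : HasFDerivAt M
      ((ContinuousLinearEquiv.refl ℝ (ℂ × ℝ) : (ℂ × ℝ) ≃L[ℝ] ℂ × ℝ) : ℂ × ℝ →L[ℝ] ℂ × ℝ)
      (rotEcc p₀, 0) := by
    have h1 : DifferentiableAt ℝ F (rotEcc p₀, 0) :=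
      (hF1.contDiffAt (hO₀.mem_nhds hxO₀)).differentiableAt (by simp)
    have h2 : HasFDerivAt (fun x : ℂ => F (x, 0)) (fderiv ℝ F (rotEcc p₀, 0) ∘L
        ContinuousLinearMap.inl ℝ ℂ ℝ) (rotEcc p₀) :=
      HasFDerivAt.comp (f := fun x : ℂ => (x, (0 : ℝ))) (rotEcc p₀) h1.hasFDerivAt
        (hasFDerivAt_prodMk_left _ _)
    have h3 : HasFDerivAt (fun x : ℂ => F (x, 0)) (ContinuousLinearMap.id ℝ ℂ) (rotEcc p₀) := by
      simp only [hF0]; exact hasFDerivAt_id _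
    have h4 := h2.unique h3
    have h5 : HasFDerivAt (fun z : ℂ × ℝ => (z.1, z.2 ^ 3))
        ((ContinuousLinearMap.fst ℝ ℂ ℝ).prod 0) (rotEcc p₀, 0) := by
      refine hasFDerivAt_fst.prodMk ?_
      have := (hasFDerivAt_snd (𝕜 := ℝ) (p := (rotEcc p₀, (0 : ℝ)))).pow 3
      simpa using this
    have h6 : HasFDerivAt (fun z : ℂ × ℝ => F (z.1, z.2 ^ 3))
        (fderiv ℝ F (rotEcc p₀, 0) ∘L (ContinuousLinearMap.fst ℝ ℂ ℝ).prod 0) (rotEcc p₀, 0) := by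
      refine HasFDerivAt.comp (rotEcc p₀, (0 : ℝ)) ?_ h5
      simpa using h1.hasFDerivAt
    refine (h6.prodMk hasFDerivAt_snd).congr_fderiv ?_
    refine ContinuousLinearMap.ext fun v => Prod.ext ?_ rfl
    exact congrArg (fun A : ℂ →L[ℝ] ℂ => A v.1) h4
  obtain ⟨e, hxe, heN, heM, he, hed⟩ := exists_openPartialHomeomorph_contDiffOn (n := 1) le_rfl hNo
    (by exact_mod_cast hMk F 1 hF1) hxN hM'
  -- the limit chart in the coordinates `(Z, l)`
  set ρ : ℝ × ℝ × ℝ → ℂ × ℝ := fun p => (rotEcc p, p.2.2) with hρ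
  have hρs : ContDiffOn ℝ ∞ ρ posDomain := contDiffOn_rotEcc.prodMk (by fun_prop)
  have hofρ : ∀ p, ofRotEcc (ρ p) = p := ofRotEcc_rotEcc
  have hρof : ∀ z, ρ (ofRotEcc z) = z := fun z => Prod.ext (rotEcc_ofRotEcc z) rfl
  have hU : IsOpen (posDomain ∩ ρ ⁻¹' e.source) :=
    hρs.continuousOn.isOpen_inter_preimage isOpen_posDomain e.open_source
  have hM1 : ContDiffOn ℝ 1 M N := by exact_mod_cast hMk F 1 hF1
  have hpos : ∀ z ∈ e.source, 0 < 1 + z.1.re := fun z hz => one_add_re_pos (heN hz).2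
  have hsymm2 : ∀ y ∈ e.target, (e.symm y).2 = y.2 := fun y hy => by
    conv_rhs => rw [← e.right_inv hy, heM]
  refine ⟨posDomain ∩ ρ ⁻¹' e.source, e.target, fun z => ofRotEcc (e.symm z), fun p => M (ρ p),
    ⟨hp₀, by rw [mem_preimage, hρ]; beta_reduce; rwa [hl]⟩, hU, e.open_target, ?_, ?_, ?_, ?_, ?_, ?_, ?_⟩
  · refine contDiffOn_ofRotEcc.comp (contDiffOn_symm_of_eqOn_halfSpace (M := M) hNo (fun k => ?_)
      (fun z => rfl) e heN heM hed) fun z hz => hpos _ (e.map_target hz.1)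
    obtain ⟨F', h1, h2, h3⟩ := hF k
    refine ⟨fun z => (F' (z.1, z.2 ^ 3), z.2), hMk F' k h1, fun z => rfl, fun z hz => ?_⟩
    have h4 : (0 : ℝ) ≤ z.2 ^ 3 := pow_nonneg hz.2 3
    exact Prod.ext ((h2 _ hz.1.1 h4).trans (hFL _ hz.1.1 h4).symm) rfl
  · exact hM1.comp ((hρs.of_le (by exact_mod_cast le_top)).mono inter_subset_left)
      fun p hp => heN hp.2
  · have hMi : ContDiffOn ℝ ∞ M (N ∩ {z | 0 < z.2}) := by
      rw [contDiffOn_infty]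
      intro k
      obtain ⟨F', h1, h2, h3⟩ := hF k
      refine ((hMk F' k h1).mono inter_subset_left).congr fun z hz => ?_
      have h4 : (0 : ℝ) ≤ z.2 ^ 3 := pow_nonneg (le_of_lt hz.2) 3
      exact Prod.ext ((hFL _ hz.1.1 h4).trans (h2 _ hz.1.1 h4).symm) rfl
    exact hMi.comp (hρs.mono fun p hp => hp.1.1) fun p hp => ⟨heN hp.1.2, hp.2⟩
  · rintro p ⟨hp, hph⟩
    refine ⟨by rw [← heM]; exact e.map_source hp.2, hph.2, ?_⟩
    rw [← heM, e.left_inv hp.2, hofρ]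
  · intro z hz hz2
    have hs := e.map_target hz
    have hs2 : 0 ≤ (e.symm z).2 := by rw [hsymm2 z hz]; exact hz2
    have hr : 0 < (ofRotEcc (e.symm z)).1 := inv_pos.2 (hpos _ hs)
    exact ⟨⟨⟨hr, by rw [mem_preimage, hρof]; exact hs⟩, hr, hs2⟩,
      by rw [hρof, ← heM, e.right_inv hz]⟩
  · exact fun p _ => Iff.rfl
  · rintro p ⟨hp, hph⟩ h hh
    obtain ⟨Y, hY0, hY⟩ := exists_isTrajectory_extField hδ hph 0
    have hz := heN hp.2
    have h3 : (0 : ℝ) ≤ (ρ p).2 ^ 3 := pow_nonneg hph.2 3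
    have hlim := (hL _ hz.1 h3).2 p.2.2 rfl Y (by rw [hY0]; exact congrArg (·, (0 : ℝ)) (hofρ p).symm) hY
    rw [← hFL _ hz.1 h3] at hlim
    have hp' : p = (Y 0).1 := by rw [hY0]
    have hph' : (Y 0).1 ∈ phaseSpace := hp' ▸ hph
    have hiff : p ∈ stableSet δ (Γ₁ h) ↔ _ := hp' ▸ hY.mem_stableSet_iff hδ hph' (Γ₁ h)
    rw [hiff]
    constructor
    · intro hd
      have h4 := tendsto_norm_sq_of_tendsto_infDist hh.1 hh.2 hd
      refine tendsto_nhds_unique (hlim.norm.pow 2) ?_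
      simpa only [norm_fixedEcc] using h4
    · exact fun h4 => hY.tendsto_infDist hδ hph' hlim hh.2 h4

/-- A chart near an interior point whose orbit enters the domain of another chart, which is pulled back
by the flow. -/
theorem IsLimitChart.exists_pullback {δ : ℝ} (hδ : 0 < δ) {U O Ψ G} (hc : IsLimitChart δ U O Ψ G)
    {T : ℝ} (hT : 0 ≤ T) {u : ℝ → ℝ × ℝ × ℝ}
    (hu : IsTrajectoryOn (vectorField δ) posDomain T u) (h0 : 0 < (u 0).2.2)
    (hTl : 0 < (u T).2.2) (hTU : u T ∈ U) :
    ∃ U' O' Ψ' G', u 0 ∈ U' ∧ IsLimitChart δ U' O' Ψ' G' := by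
  obtain ⟨e, hu0, heu, he, he', hflow⟩ :=
    hu.exists_openPartialHomeomorph isOpen_posDomain (contDiffOn_vectorField δ) hT
  have hposo : IsOpen {p : ℝ × ℝ × ℝ | 0 < p.2.2} := isOpen_lt continuous_const (by fun_prop)
  -- a neighbourhood of the end point
  set D : Set (ℝ × ℝ × ℝ) := (e.target ∩ e.symm ⁻¹' {p | 0 < p.2.2}) ∩ {p | 0 < p.2.2} ∩ U with hD
  have hDo : IsOpen D := ((e.continuousOn_symm.isOpen_inter_preimage e.open_target hposo).inter
    hposo).inter hc.isOpen_source
  have hflow' : ∀ p ∈ e.source, ∃ u, u 0 = p ∧ u T = e p ∧ p ∈ posDomain ∧ e p ∈ posDomain ∧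
      IsTrajectoryOn (vectorField δ) posDomain T u := by
    intro p hp
    obtain ⟨w, h1, h2, h3⟩ := hflow p hp
    exact ⟨w, h1, h2, h1 ▸ (h3 0 ⟨le_rfl, hT⟩).1, h2 ▸ (h3 T ⟨hT, le_rfl⟩).1, h3⟩
  have hphD : ∀ p ∈ D, p ∈ U ∩ phaseSpace := fun p hp => by
    obtain ⟨w, -, -, -, h1, -⟩ := hflow' _ (e.map_target hp.1.1.1)
    rw [e.right_inv hp.1.1.1] at h1
    exact ⟨hp.2, h1, le_of_lt hp.1.2⟩
  have hGD : ∀ p ∈ D, G p ∈ O ∩ {z | 0 < z.2} := fun p hp => by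
    obtain ⟨h1, h2, -⟩ := hc.map_source p (hphD p hp)
    exact ⟨h1, lt_of_le_of_ne h2 fun h => (ne_of_gt hp.1.2)
      ((hc.boundary_iff p (hphD p hp)).1 h.symm)⟩
  have hU' : IsOpen (e.source ∩ e ⁻¹' D) := e.continuousOn.isOpen_inter_preimage e.open_source hDo
  have hOpos : IsOpen (O ∩ {z : ℂ × ℝ | 0 < z.2}) :=
    hc.isOpen_target.inter (isOpen_lt continuous_const continuous_snd)
  have hΨ : ContDiffOn ℝ ∞ Ψ (O ∩ {z | 0 < z.2}) :=
    hc.contDiffOn_symm.mono fun z hz => ⟨hz.1, show 0 ≤ z.2 from le_of_lt hz.2⟩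
  have hG : ContDiffOn ℝ ∞ (fun p => G (e p)) (e.source ∩ e ⁻¹' D) :=
    hc.contDiffOn_interior.comp (he.mono inter_subset_left) fun p hp => ⟨hp.2.2, hp.2.1.2⟩
  have hpos : ∀ p ∈ e.source ∩ e ⁻¹' D, 0 < p.2.2 := fun p hp => by
    have := hp.2.1.1.2
    rwa [mem_preimage, e.left_inv hp.1] at this
  refine ⟨e.source ∩ e ⁻¹' D, O ∩ {z | 0 < z.2} ∩ Ψ ⁻¹' D, fun z => e.symm (Ψ z),
    fun p => G (e p), ⟨hu0, ?_⟩, hU', hΨ.continuousOn.isOpen_inter_preimage hOpos hDo, ?_, ?_, ?_,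
    ?_, ?_, ?_, ?_⟩
  · rw [mem_preimage, heu]
    refine ⟨⟨⟨heu ▸ e.map_source hu0, ?_⟩, hTl⟩, hTU⟩
    rw [mem_preimage, ← heu, e.left_inv hu0]; exact h0
  · exact he'.comp (hΨ.mono fun z hz => hz.1.1) fun z hz => hz.1.2.1.1.1
  · exact hG.of_le (by exact_mod_cast le_top)
  · exact hG.mono inter_subset_left
  · rintro p ⟨hp, -⟩
    have h1 := hGD _ hp.2
    have h2 := (hc.map_source _ (hphD _ hp.2)).2.2
    refine ⟨⟨h1, ?_⟩, le_of_lt h1.2, ?_⟩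
    · rw [mem_preimage, h2]; exact hp.2
    · rw [h2, e.left_inv hp.1]
  · rintro z ⟨hz, hzD⟩ hz2
    have hs := e.map_target hzD.1.1.1
    have h1 : e.symm (Ψ z) ∈ e.source ∩ e ⁻¹' D :=
      ⟨hs, by rw [mem_preimage, e.right_inv hzD.1.1.1]; exact hzD⟩
    obtain ⟨-, -, -, h2, -⟩ := hflow' _ hs
    refine ⟨⟨h1, h2, le_of_lt (hpos _ h1)⟩, ?_⟩
    rw [e.right_inv hzD.1.1.1]
    exact (hc.map_target z hz.1 hz2).2
  · rintro p ⟨hp, -⟩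
    exact iff_of_false (ne_of_gt (hGD _ hp.2).2) (ne_of_gt (hpos p hp))
  · rintro p ⟨hp, hph⟩ h hh
    rw [← hc.mem_stableSet_iff _ (hphD _ hp.2) h hh]
    obtain ⟨w, h1, h2, -, -, h3⟩ := hflow' p hp.1
    rw [← h2, ← h1]
    exact h3.mem_stableSet_iff hδ hT (h1 ▸ hph) _

/-- There are charts near all points of the stable sets: their orbits enter the domains of the charts
near the compact set `Γ₁(h)`. -/
theorem exists_isLimitChart {δ : ℝ} (hδ : 0 < δ) {h : ℝ} (hh : h ∈ Ico (0 : ℝ) (1 / 2))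
    {p₀ : ℝ × ℝ × ℝ} (hp₀ : p₀ ∈ stableSet δ (Γ₁ h)) :
    ∃ U O Ψ G, p₀ ∈ U ∧ IsLimitChart δ U O Ψ G := by
  have hph := stableSet_subset_phaseSpace _ hp₀
  obtain ⟨Y, hY0, hY⟩ := exists_isTrajectory_extField hδ hph 0
  have hp' : p₀ = (Y 0).1 := by rw [hY0]
  have hph' : (Y 0).1 ∈ phaseSpace := hp' ▸ hph
  have hlim : Tendsto (fun s => Metric.infDist (Y s).1 (Γ₁ h)) atTop (𝓝 0) :=
    (hY.mem_stableSet_iff hδ hph' _).1 (hp' ▸ hp₀)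
  have hex : ∀ p ∈ Γ₁ h, ∃ U O Ψ G, p ∈ U ∧ IsLimitChart δ U O Ψ G := fun p hp => by
    obtain ⟨h1, h2, h3⟩ := mem_Γ₁_iff.1 hp
    exact exists_isLimitChart_boundary hδ h1 h3 (norm_lt_one_of_sq_eq hh.2 h2)
  choose! U O Ψ G hpU hc using hex
  obtain ⟨s, hs0, hs⟩ := ((eventually_ge_atTop 0).and (eventually_mem_of_tendsto_infDist
    (isCompact_Γ₁ hh.2) (Γ₁_nonempty hh.1 hh.2) (V := ⋃ p ∈ Γ₁ h, U p)
    (isOpen_biUnion fun p hp => (hc p hp).isOpen_source)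
    (fun p hp => mem_biUnion hp (hpU p hp)) hlim)).exists
  obtain ⟨p, hp, hsp⟩ := mem_iUnion₂.1 hs
  rcases hph.2.eq_or_lt with hl | hl
  · -- on the boundary the Hamiltonian is conserved
    refine exists_isLimitChart_boundary hδ hph.1 hl.symm ?_
    have h1 : ∀ t, 0 ≤ t → ‖rotEcc p₀‖ ^ 2 ≤ ‖rotEcc (Y t).1‖ ^ 2 := fun t ht => by
      have h2 := le_add_mul_of_hasDerivWithinAt_le (T := t) (c := 0)
        (fun r hr => ((hY.restrict t).hasDerivWithinAt_energy hr).fun_neg) (fun r hr => by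
          have h3 : (Y r).1.2.2 = 0 := by
            rw [hY.ang_eq hδ hph'.2 hr.1, ← hp', ← hl]; simp [radialDecay]
          simp [h3]) t ⟨ht, le_rfl⟩
      rw [← hp'] at h2
      simp only [Complex.normSq_eq_norm_sq] at h2
      linarith
    have h2 := ge_of_tendsto (tendsto_norm_sq_of_tendsto_infDist hh.1 hh.2 hlim)
      ((eventually_ge_atTop 0).mono h1)
    have h3 := hh.2
    nlinarith [norm_nonneg (rotEcc p₀)]
  · have h1 : ∀ s, 0 ≤ s → 0 < (Y s).1.2.2 := fun s hs => by
      have hl' : 0 < (Y 0).1.2.2 := hp' ▸ hl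
      rw [hY.ang_eq hδ hph'.2 hs, radialDecay]
      positivity
    have h2 := (hc p hp).exists_pullback hδ hs0 (hY.reduced.restrict s) (h1 0 le_rfl) (h1 s hs0) hsp
    simpa only [hp'] using h2

/-! ### The stable sets as submanifolds -/

section Submanifolds

lemma injective_fderivWithin_of_leftInverse {E F : Type*} [NormedAddCommGroup E] [NormedSpace ℝ E]
    [NormedAddCommGroup F] [NormedSpace ℝ F] {f : E → F} {g : F → E} {S : Set E} {x : E}
    (hS : UniqueDiffWithinAt ℝ S x) (hf : DifferentiableWithinAt ℝ f S x)
    (hg : DifferentiableAt ℝ g (f x)) (h : ∀ y ∈ S, g (f y) = y) (hx : x ∈ S) :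
    Function.Injective (fderivWithin ℝ f S x) := by
  have h1 : HasFDerivWithinAt (fun y => g (f y)) (fderiv ℝ g (f x) ∘L fderivWithin ℝ f S x) S x :=
    hg.hasFDerivAt.comp_hasFDerivWithinAt x hf.hasFDerivWithinAt
  have h2 : HasFDerivWithinAt (fun y => g (f y)) (ContinuousLinearMap.id ℝ E) S x :=
    (hasFDerivWithinAt_id x S).congr h (h x hx)
  have h3 := hS.eq h1 h2
  exact Function.LeftInverse.injective (g := fderiv ℝ g (f x))
    fun v => congrArg (fun A : E →L[ℝ] E => A v) h3

lemma uniqueDiffOn_inter_halfSpace {k : ℕ} [NeZero k] {O : Set (EuclideanSpace ℝ (Fin k))}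
    (hO : IsOpen O) : UniqueDiffOn ℝ (O ∩ halfSpace k) := by
  have h1 : UniqueDiffOn ℝ (halfSpace k) := by
    refine uniqueDiffOn_convex ?_ ?_
    · intro x hx y hy a b ha hb _
      have hx' : 0 ≤ x 0 := hx
      have hy' : 0 ≤ y 0 := hy
      have : 0 ≤ a * x 0 + b * y 0 := by positivity
      simpa [halfSpace] using this
    · have h2 : IsOpen {x : EuclideanSpace ℝ (Fin k) | 0 < x 0} :=
        isOpen_lt continuous_const (by fun_prop)
      have h3 : {x : EuclideanSpace ℝ (Fin k) | 0 < x 0} ⊆ halfSpace k := fun x hx =>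
        show 0 ≤ x 0 from le_of_lt hx
      refine ⟨EuclideanSpace.single 0 1, interior_maximal h3 h2 ?_⟩
      simp
  rw [inter_comm]
  exact h1.inter hO

/-- The members of a smooth family are smooth submanifolds. -/
lemma IsSmoothFamily.isSmoothSubmanifold {E : Type*} [NormedAddCommGroup E] [NormedSpace ℝ E]
    {k : ℕ} [NeZero k] {I : Set ℝ} {S B : ℝ → Set E} (hS : IsSmoothFamily k I S B) {h : ℝ}
    (hh : h ∈ I) : IsSmoothSubmanifold k (S h) (B h) := by
  refine ⟨hS.boundary_subset h hh, fun p hp => ?_⟩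
  obtain ⟨U, hU, hpU, O, hO, f, g, h1, h2, h3, h4, h5, h6⟩ := hS.exists_param h hh p hp
  have hset : {x | (h, x) ∈ O ∩ univ ×ˢ halfSpace k} = {x | (h, x) ∈ O} ∩ halfSpace k := by
    ext x; simp
  refine ⟨{p | (h, p) ∈ U}, hU.preimage (by fun_prop), hpU, {x | (h, x) ∈ O},
    hO.preimage (by fun_prop), fun x => f (h, x), fun p => g (h, p), ?_, ?_, ?_, ?_, ?_, ?_⟩
  · exact h1.comp (contDiff_prodMk_right h).contDiffOn fun x hx => ⟨hx.1, mem_univ _, hx.2⟩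
  · ext q
    constructor
    · rintro ⟨x, hx, rfl⟩
      have : (h, f (h, x)) ∈ _ := h2 ▸ mem_image_of_mem (fun y : ℝ × EuclideanSpace ℝ (Fin k) =>
        (y.1, f y)) (show (h, x) ∈ O ∩ univ ×ˢ halfSpace k from ⟨hx.1, mem_univ _, hx.2⟩)
      exact ⟨this.1.2, this.2⟩
    · rintro ⟨hq, hqU⟩
      have : (h, q) ∈ {z : ℝ × E | z.1 ∈ I ∧ z.2 ∈ S z.1} ∩ U := ⟨⟨hh, hq⟩, hqU⟩
      rw [← h2] at this
      obtain ⟨⟨h', x⟩, hx, hxq⟩ := this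
      obtain ⟨rfl, rfl⟩ := Prod.mk.inj hxq
      exact ⟨x, ⟨hx.1, hx.2.2⟩, rfl⟩
  · exact h3.comp (by fun_prop) fun q hq => ⟨⟨hh, hq.1⟩, hq.2⟩
  · exact fun x hx => h4 (h, x) ⟨hx.1, mem_univ _, hx.2⟩
  · intro x hx
    have := h5 (h, x) ⟨hx.1, mem_univ _, hx.2⟩
    rwa [hset] at this
  · exact fun x hx => h6 (h, x) ⟨hx.1, mem_univ _, hx.2⟩

variable {δ : ℝ}

/-- The Hamiltonian is conserved in the invariant subsystem `l = 0`. -/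
lemma IsTrajectory.norm_rotEcc_eq (hδ : 0 < δ) {Y : ℝ → (ℝ × ℝ × ℝ) × ℝ}
    (hY : IsTrajectory (extField δ) extDomain Y) (h0 : (Y 0).1.2.2 = 0) {t : ℝ} (ht : 0 ≤ t) :
    ‖rotEcc (Y t).1‖ ^ 2 = ‖rotEcc (Y 0).1‖ ^ 2 := by
  have h3 : ∀ r ∈ Icc 0 t, (Y r).1.2.2 = 0 := fun r hr => by
    rw [hY.ang_eq hδ h0.ge hr.1, h0]; simp [radialDecay]
  have h4 := fun r hr => (hY.restrict t).hasDerivWithinAt_energy (t := r) hr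
  have h1 := le_add_mul_of_hasDerivWithinAt_le (T := t) (c := 0) h4
    (fun r hr => by simp [h3 r hr]) t ⟨ht, le_rfl⟩
  have h2 := le_add_mul_of_hasDerivWithinAt_le (T := t) (c := 0) (fun r hr => (h4 r hr).fun_neg)
    (fun r hr => by simp [h3 r hr]) t ⟨ht, le_rfl⟩
  simp only [Complex.normSq_eq_norm_sq] at h1 h2
  linarith

lemma Γ₁_subset_stableSet (hδ : 0 < δ) (h : ℝ) : Γ₁ h ⊆ stableSet δ (Γ₁ h) := by
  intro p hp
  obtain ⟨h1, h2, h3⟩ := mem_Γ₁_iff.1 hp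
  have hph : p ∈ phaseSpace := ⟨h1, h3.ge⟩
  obtain ⟨Y, hY0, hY⟩ := exists_isTrajectory_extField hδ hph 0
  have hp' : p = (Y 0).1 := by rw [hY0]
  have h0 : (Y 0).1.2.2 = 0 := hp' ▸ h3
  rw [hp', hY.mem_stableSet_iff hδ (hp' ▸ hph)]
  refine tendsto_const_nhds.congr' ?_
  filter_upwards [eventually_ge_atTop 0] with s hs
  refine (Metric.infDist_zero_of_mem (mem_Γ₁_iff.2 ⟨(hY s hs).1, ?_, ?_⟩)).symm
  · rw [hY.norm_rotEcc_eq hδ h0 hs, ← hp', h2]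
  · rw [hY.ang_eq hδ h0.ge hs, h0]; simp [radialDecay]

lemma mem_Γ₁_iff_of_mem_stableSet (hδ : 0 < δ) {h : ℝ} (hh : h ∈ Ico (0 : ℝ) (1 / 2))
    {p : ℝ × ℝ × ℝ} (hp : p ∈ stableSet δ (Γ₁ h)) : p ∈ Γ₁ h ↔ p.2.2 = 0 := by
  refine ⟨fun h1 => (mem_Γ₁_iff.1 h1).2.2, fun h3 => ?_⟩
  have hph := stableSet_subset_phaseSpace _ hp
  obtain ⟨Y, hY0, hY⟩ := exists_isTrajectory_extField hδ hph 0
  have hp' : p = (Y 0).1 := by rw [hY0]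
  have h0 : (Y 0).1.2.2 = 0 := hp' ▸ h3
  have hlim := (hY.mem_stableSet_iff hδ (hp' ▸ hph) _).1 (hp' ▸ hp)
  refine mem_Γ₁_iff.2 ⟨hph.1, tendsto_nhds_unique (tendsto_const_nhds.congr' ?_)
    (tendsto_norm_sq_of_tendsto_infDist hh.1 hh.2 hlim), h3⟩
  filter_upwards [eventually_ge_atTop 0] with s hs
  rw [hY.norm_rotEcc_eq hδ h0 hs, ← hp']

/-- In a limit chart `(ω, l)` the stable set of `q₁` is the half line `ω = 0`. -/
theorem isSmoothSubmanifold_stableSet_q₁ (hδ : 0 < δ) :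
    IsSmoothSubmanifold 1 (stableSet δ {q₁}) {q₁} := by
  have hh : (0 : ℝ) ∈ Ico (0 : ℝ) (1 / 2) := by norm_num
  rw [← Γ₁_zero]
  refine ⟨Γ₁_subset_stableSet hδ 0, fun p₀ hp₀ => ?_⟩
  obtain ⟨U, O, Ψ, G, hpU, hc⟩ := exists_isLimitChart hδ hh hp₀
  have hS : ∀ p ∈ U ∩ phaseSpace, p ∈ stableSet δ (Γ₁ 0) ↔ (G p).1 = 0 := fun p hp => by
    rw [hc.mem_stableSet_iff p hp 0 hh]; simp
  let j : EuclideanSpace ℝ (Fin 1) → ℂ × ℝ := fun x => (0, x 0)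
  have hj : ContDiff ℝ ∞ j := by fun_prop
  let g : ℝ × ℝ × ℝ → EuclideanSpace ℝ (Fin 1) := fun p => EuclideanSpace.single 0 (G p).2
  have hg : ContDiffOn ℝ 1 g U := by
    have := hc.contDiffOn_one.snd
    rw [contDiffOn_euclidean]
    intro i
    fin_cases i
    simpa [g] using this
  have hmem : ∀ x ∈ j ⁻¹' O ∩ halfSpace 1, Ψ (j x) ∈ U ∩ phaseSpace ∧ G (Ψ (j x)) = j x :=
    fun x hx => hc.map_target _ hx.1 hx.2
  have hleft : ∀ x ∈ j ⁻¹' O ∩ halfSpace 1, g (Ψ (j x)) = x := fun x hx => by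
    ext i
    fin_cases i
    simp [g, (hmem x hx).2, j]
  have hf : ContDiffOn ℝ ∞ (fun x => Ψ (j x)) (j ⁻¹' O ∩ halfSpace 1) :=
    hc.contDiffOn_symm.comp hj.contDiffOn fun x hx => hx
  have hO : IsOpen (j ⁻¹' O) := hc.isOpen_target.preimage hj.continuous
  have hst : ∀ x ∈ j ⁻¹' O ∩ halfSpace 1, Ψ (j x) ∈ stableSet δ (Γ₁ 0) := fun x hx => by
    rw [hS _ (hmem x hx).1, (hmem x hx).2]
  refine ⟨U, hc.isOpen_source, hpU, j ⁻¹' O, hO, fun x => Ψ (j x), g, hf, ?_, ?_, hleft, ?_, ?_⟩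
  · ext p
    constructor
    · rintro ⟨x, hx, rfl⟩
      exact ⟨hst x hx, (hmem x hx).1.1⟩
    · rintro ⟨hp, hpU'⟩
      have hph := stableSet_subset_phaseSpace _ hp
      obtain ⟨h1, h2, h3⟩ := hc.map_source p ⟨hpU', hph⟩
      have h4 : j (g p) = G p := by
        refine Prod.ext ((hS p ⟨hpU', hph⟩).1 hp).symm ?_
        simp [j, g]
      refine ⟨g p, ⟨by rw [mem_preimage, h4]; exact h1, ?_⟩, ?_⟩
      · simpa [halfSpace, g] using h2
      · beta_reduce; rw [h4, h3]
  · exact hg.continuousOn.mono inter_subset_right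
  · exact fun x hx => injective_fderivWithin_of_leftInverse (uniqueDiffOn_inter_halfSpace hO x hx)
      ((hf x hx).differentiableWithinAt (by simp))
      ((hg.contDiffAt (hc.isOpen_source.mem_nhds (hmem x hx).1.1)).differentiableAt (by simp))
      hleft hx
  · intro x hx
    rw [mem_Γ₁_iff_of_mem_stableSet hδ hh (hst x hx), ← hc.boundary_iff _ (hmem x hx).1,
      (hmem x hx).2]

lemma contDiffAt_arg {z : ℂ} (hz : z ∈ Complex.slitPlane) : ContDiffAt ℝ ∞ Complex.arg z := by
  have h1 : ContDiffAt ℝ ∞ (fun z => (Complex.log z).im) z :=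
    Complex.imCLM.contDiff.contDiffAt.comp z ((Complex.contDiffAt_log hz).restrict_scalars ℝ)
  simpa only [Complex.log_im] using h1

/-- The stable sets `W^s(Γ₁(h))` form a smooth family. In a limit chart `(ω, l)` they are the sets
`|ω|² = 2 h`, which are parametrized by `arg ω` and `l`. -/
theorem isSmoothFamily_stableSet (hδ : 0 < δ) :
    IsSmoothFamily 2 (Ioo (0 : ℝ) (1 / 2)) (fun h => stableSet δ (Γ₁ h)) Γ₁ := by
  refine ⟨fun h _ => Γ₁_subset_stableSet hδ h, fun h₀ hh₀ p₀ hp₀ => ?_⟩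
  have hI : ∀ h ∈ Ioo (0 : ℝ) (1 / 2), h ∈ Ico (0 : ℝ) (1 / 2) := fun h hh => ⟨hh.1.le, hh.2⟩
  obtain ⟨U, O, Ψ, G, hpU, hc⟩ := exists_isLimitChart hδ (hI _ hh₀) hp₀
  have hnorm₀ : ‖(G p₀).1‖ ^ 2 = 2 * h₀ :=
    (hc.mem_stableSet_iff p₀ ⟨hpU, stableSet_subset_phaseSpace _ hp₀⟩ h₀ (hI _ hh₀)).1 hp₀
  have hne₀ : (G p₀).1 ≠ 0 := fun h => by
    rw [h] at hnorm₀; simp at hnorm₀; linarith [hh₀.1]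
  obtain ⟨u, hu, hup⟩ : ∃ u : ℂ, u * (starRingEnd ℂ) u = 1 ∧
      0 < ((G p₀).1 * (starRingEnd ℂ) u).re := by
    refine ⟨(‖(G p₀).1‖ : ℂ)⁻¹ * (G p₀).1, ?_, ?_⟩
    · rw [Complex.mul_conj, Complex.normSq_eq_norm_sq]
      simp [hne₀]
    · have h1 : (G p₀).1 * (starRingEnd ℂ) ((‖(G p₀).1‖ : ℂ)⁻¹ * (G p₀).1) =
          ((‖(G p₀).1‖⁻¹ * ‖(G p₀).1‖ ^ 2 : ℝ) : ℂ) := by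
        rw [map_mul, mul_left_comm, Complex.mul_conj, Complex.normSq_eq_norm_sq]
        simp
      rw [h1, Complex.ofReal_re]
      positivity
  have hunorm : ‖u‖ = 1 := by
    rw [Complex.mul_conj, Complex.normSq_eq_norm_sq] at hu
    have : ‖u‖ ^ 2 = 1 := by exact_mod_cast hu
    nlinarith [norm_nonneg u]
  -- the parametrization in the chart
  let j : ℝ × EuclideanSpace ℝ (Fin 2) → ℂ × ℝ := fun y =>
    ((√(2 * y.1) : ℂ) * Complex.exp ((y.2 1 : ℝ) * Complex.I) * u, y.2 0)
  have hcoord : ∀ i : Fin 2, ContDiff ℝ ∞ fun y : ℝ × EuclideanSpace ℝ (Fin 2) => y.2 i :=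
    fun i => by fun_prop
  have hexp : ContDiff ℝ ∞ fun y : ℝ × EuclideanSpace ℝ (Fin 2) =>
      Complex.exp ((y.2 1 : ℝ) * Complex.I) :=
    ((Complex.ofRealCLM.contDiff.comp (hcoord 1)).mul contDiff_const).cexp
  have hjc : Continuous j := by
    have h1 : Continuous fun y : ℝ × EuclideanSpace ℝ (Fin 2) => ((√(2 * y.1) : ℝ) : ℂ) := by
      fun_prop
    exact ((h1.mul hexp.continuous).mul continuous_const).prodMk (hcoord 0).continuous
  have hjs : ContDiffOn ℝ ∞ j {y | 0 < y.1} := by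
    have h1 : ContDiffOn ℝ ∞ (fun y : ℝ × EuclideanSpace ℝ (Fin 2) => √(2 * y.1)) {y | 0 < y.1} :=
      ContDiffOn.sqrt (by fun_prop) fun y hy => by
        have : 0 < y.1 := hy
        positivity
    have h2 := Complex.ofRealCLM.contDiff.comp_contDiffOn h1
    exact ((h2.mul hexp.contDiffOn).mul contDiffOn_const).prodMk (hcoord 0).contDiffOn
  set O' : Set (ℝ × EuclideanSpace ℝ (Fin 2)) :=
    {y | y.1 ∈ Ioo (0 : ℝ) (1 / 2) ∧ y.2 1 ∈ Ioo (-(Real.pi / 2)) (Real.pi / 2) ∧ j y ∈ O} with hO'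
  have hO'o : IsOpen O' :=
    (isOpen_Ioo.preimage continuous_fst).inter ((isOpen_Ioo.preimage (hcoord 1).continuous).inter
      (hc.isOpen_target.preimage hjc))
  have hG1c : ContinuousOn (fun p => ((G p).1 * (starRingEnd ℂ) u).re) U :=
    Complex.continuous_re.comp_continuousOn
      (hc.contDiffOn_one.continuousOn.fst.mul continuousOn_const)
  set U₁ : Set (ℝ × ℝ × ℝ) := U ∩ (fun p => ((G p).1 * (starRingEnd ℂ) u).re) ⁻¹' Ioi 0 with hU₁
  have hU₁o : IsOpen U₁ := hG1c.isOpen_inter_preimage hc.isOpen_source isOpen_Ioi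
  let g : ℝ × ℝ × ℝ → EuclideanSpace ℝ (Fin 2) := fun p =>
    !₂[(G p).2, Complex.arg ((G p).1 * (starRingEnd ℂ) u)]
  have hslit : ∀ p ∈ U₁, (G p).1 * (starRingEnd ℂ) u ∈ Complex.slitPlane := fun p hp =>
    Or.inl hp.2
  have hg : ContDiffOn ℝ 1 g U₁ := by
    have h1 := hc.contDiffOn_one.mono (inter_subset_left : U₁ ⊆ U)
    have h2 : ContDiffOn ℝ 1 (fun p => Complex.arg ((G p).1 * (starRingEnd ℂ) u)) U₁ :=
      fun p hp => ((contDiffAt_arg (hslit p hp)).of_le (by exact_mod_cast le_top)).comp_contDiffWithinAt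
        (f := fun p => (G p).1 * (starRingEnd ℂ) u) p ((h1.fst.mul contDiffOn_const) p hp)
    rw [contDiffOn_euclidean]
    intro i
    fin_cases i
    · exact h1.snd
    · exact h2
  have hmem : ∀ y ∈ O' ∩ univ ×ˢ halfSpace 2, Ψ (j y) ∈ U ∩ phaseSpace ∧ G (Ψ (j y)) = j y :=
    fun y hy => hc.map_target _ hy.1.2.2 hy.2.2
  have hjnorm : ∀ y ∈ O', ‖(j y).1‖ ^ 2 = 2 * y.1 := fun y hy => by
    have : 0 < y.1 := hy.1.1
    simp only [j, norm_mul, Complex.norm_exp_ofReal_mul_I, hunorm, mul_one, Complex.norm_real,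
      Real.norm_eq_abs, sq_abs]
    exact Real.sq_sqrt (by positivity)
  have hju : ∀ y, (j y).1 * (starRingEnd ℂ) u =
      (√(2 * y.1) : ℂ) * (Complex.cos (y.2 1 : ℝ) + Complex.sin (y.2 1 : ℝ) * Complex.I) := by
    intro y
    simp only [j]
    rw [mul_assoc, hu, mul_one, Complex.exp_mul_I]
  have hleft : ∀ y ∈ O' ∩ univ ×ˢ halfSpace 2, g (Ψ (j y)) = y.2 := fun y hy => by
    have h1 : 0 < √(2 * y.1) := Real.sqrt_pos.2 (by linarith [hy.1.1.1])
    have h2 : Complex.arg ((j y).1 * (starRingEnd ℂ) u) = y.2 1 := by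
      rw [hju]
      exact Complex.arg_mul_cos_add_sin_mul_I h1 ⟨by linarith [hy.1.2.1.1, Real.pi_pos],
        by linarith [hy.1.2.1.2, Real.pi_pos]⟩
    ext i
    fin_cases i
    · simp only [g, (hmem y hy).2]; rfl
    · simp only [g, (hmem y hy).2]; exact h2
  have hst : ∀ y ∈ O' ∩ univ ×ˢ halfSpace 2, Ψ (j y) ∈ stableSet δ (Γ₁ y.1) := fun y hy => by
    rw [hc.mem_stableSet_iff _ (hmem y hy).1 y.1 (hI _ hy.1.1), (hmem y hy).2]
    exact hjnorm y hy.1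
  have hU₁mem : ∀ y ∈ O' ∩ univ ×ˢ halfSpace 2, Ψ (j y) ∈ U₁ := fun y hy => by
    refine ⟨(hmem y hy).1.1, ?_⟩
    rw [mem_preimage, (hmem y hy).2, hju, Complex.re_ofReal_mul, ← Complex.ofReal_cos,
      ← Complex.ofReal_sin]
    have h1 : 0 < √(2 * y.1) := Real.sqrt_pos.2 (by linarith [hy.1.1.1])
    have h2 := Real.cos_pos_of_mem_Ioo hy.1.2.1
    simpa only [Complex.add_re, Complex.ofReal_re, Complex.re_ofReal_mul, Complex.I_re, mul_zero,
      add_zero, mem_Ioi] using mul_pos h1 h2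
  have hf : ContDiffOn ℝ ∞ (fun y => Ψ (j y)) (O' ∩ univ ×ˢ halfSpace 2) :=
    hc.contDiffOn_symm.comp (hjs.mono fun y hy => hy.1.1.1) fun y hy => ⟨hy.1.2.2, hy.2.2⟩
  refine ⟨Ioo 0 (1 / 2) ×ˢ U₁, isOpen_Ioo.prod hU₁o, ⟨hh₀, hpU, hup⟩, O', hO'o,
    fun y => Ψ (j y), fun z => g z.2, hf, ?_, ?_, hleft, ?_, ?_⟩
  · ext ⟨h, p⟩
    constructor
    · rintro ⟨y, hy, hyp⟩
      obtain ⟨rfl, rfl⟩ := Prod.mk.inj hyp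
      exact ⟨⟨hy.1.1, hst y hy⟩, hy.1.1, hU₁mem y hy⟩
    · rintro ⟨⟨hh, hp⟩, -, hpU₁⟩
      dsimp only at hh hp
      have hph := stableSet_subset_phaseSpace _ hp
      obtain ⟨h1, h2, h3⟩ := hc.map_source p ⟨hpU₁.1, hph⟩
      have hn := (hc.mem_stableSet_iff p ⟨hpU₁.1, hph⟩ h (hI _ hh)).1 hp
      have hsq : √(2 * h) = ‖(G p).1‖ := by rw [← hn]; exact Real.sqrt_sq (norm_nonneg _)
      have h4 : j (h, g p) = G p := by
        refine Prod.ext ?_ rfl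
        have h5 := Complex.norm_mul_exp_arg_mul_I ((G p).1 * (starRingEnd ℂ) u)
        rw [norm_mul, Complex.norm_conj, hunorm, mul_one] at h5
        calc (j (h, g p)).1 = ‖(G p).1‖ *
              Complex.exp (Complex.arg ((G p).1 * (starRingEnd ℂ) u) * Complex.I) * u := by
              simp [j, g, hsq]
          _ = (G p).1 := by
              rw [h5, mul_assoc, mul_comm _ u, hu, mul_one]
      refine ⟨(h, g p), ⟨⟨hh, ?_, by rw [h4]; exact h1⟩, mem_univ _, h2⟩, ?_⟩
      · exact abs_lt.1 (Complex.abs_arg_lt_pi_div_two_iff.2 (Or.inl hpU₁.2))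
      · beta_reduce; rw [h4, h3]
  · exact hg.continuousOn.comp continuousOn_snd fun z hz => hz.2.2
  · rintro ⟨h, x⟩ hy
    have hset : {x | (h, x) ∈ O' ∩ univ ×ˢ halfSpace 2} = {x | (h, x) ∈ O'} ∩ halfSpace 2 := by
      ext x; simp
    have hud : UniqueDiffWithinAt ℝ {x | (h, x) ∈ O' ∩ univ ×ˢ halfSpace 2} x := by
      rw [hset]
      exact uniqueDiffOn_inter_halfSpace (hO'o.preimage (by fun_prop)) x ⟨hy.1, hy.2.2⟩
    have hfx : ContDiffOn ℝ ∞ (fun x => Ψ (j (h, x))) {x | (h, x) ∈ O' ∩ univ ×ˢ halfSpace 2} :=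
      hf.comp (contDiff_prodMk_right h).contDiffOn fun x hx => hx
    exact injective_fderivWithin_of_leftInverse hud ((hfx x hy).differentiableWithinAt (by simp))
      ((hg.contDiffAt (hU₁o.mem_nhds (hU₁mem _ hy))).differentiableAt (by simp))
      (fun x hx => hleft (h, x) hx) hy
  · intro y hy
    rw [mem_Γ₁_iff_of_mem_stableSet hδ (hI _ hy.1.1) (hst y hy), ← hc.boundary_iff _ (hmem y hy).1,
      (hmem y hy).2]

end Submanifolds

/-! ### The Kepler problem in reduced variables -/

section VectorProduct

@[simp] lemma cross_zero_apply (a b : E3) : cross a b 0 = a 1 * b 2 - a 2 * b 1 := by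
  simp [cross, cross_apply]

@[simp] lemma cross_one_apply (a b : E3) : cross a b 1 = a 2 * b 0 - a 0 * b 2 := by
  simp [cross, cross_apply]

@[simp] lemma cross_two_apply (a b : E3) : cross a b 2 = a 0 * b 1 - a 1 * b 0 := by
  simp [cross, cross_apply]

lemma inner_eq_sum (a b : E3) : inner ℝ a b = a 0 * b 0 + a 1 * b 1 + a 2 * b 2 := by
  simp [PiLp.inner_apply, Fin.sum_univ_three]; ring

lemma ext_E3 {a b : E3} (h0 : a 0 = b 0) (h1 : a 1 = b 1) (h2 : a 2 = b 2) : a = b := by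
  ext i; fin_cases i
  exacts [h0, h1, h2]

lemma norm_sq_cross (a b : E3) :
    ‖cross a b‖ ^ 2 = ‖a‖ ^ 2 * ‖b‖ ^ 2 - (inner ℝ a b) ^ 2 := by
  simp only [← real_inner_self_eq_norm_sq, inner_eq_sum, cross_zero_apply, cross_one_apply,
    cross_two_apply]
  ring

lemma cross_cross_left (a b c : E3) :
    cross a (cross b c) = (inner ℝ a c) • b - (inner ℝ a b) • c := by
  apply ext_E3 <;> simp [inner_eq_sum] <;> ring

lemma cross_cross_right (a b c : E3) :
    cross (cross a b) c = (inner ℝ a c) • b - (inner ℝ b c) • a := by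
  apply ext_E3 <;> simp [inner_eq_sum] <;> ring

lemma inner_cross_self_left (a b : E3) : inner ℝ (cross a b) a = 0 := by
  simp [inner_eq_sum]; ring

end VectorProduct

section Frame

/-- The embedding `ζ ↦ Re ζ a + Im ζ b` of the complex plane into space, which is isometric when `a` and
`b` are orthonormal. -/
noncomputable def frame (a b : E3) : ℂ →L[ℝ] E3 :=
  Complex.reCLM.smulRight a + Complex.imCLM.smulRight b

lemma frame_apply (a b : E3) (ζ : ℂ) : frame a b ζ = ζ.re • a + ζ.im • b := rfl

variable {a b : E3}

lemma inner_frame (ha : inner ℝ a a = 1) (hb : inner ℝ b b = 1) (hab : inner ℝ a b = 0)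
    (ζ ξ : ℂ) : inner ℝ (frame a b ζ) (frame a b ξ) = ζ.re * ξ.re + ζ.im * ξ.im := by
  have hba : inner ℝ b a = 0 := by rw [real_inner_comm, hab]
  simp only [frame_apply, inner_add_left, inner_add_right, real_inner_smul_left,
    real_inner_smul_right, ha, hb, hab, hba]
  ring

lemma norm_frame (ha : inner ℝ a a = 1) (hb : inner ℝ b b = 1) (hab : inner ℝ a b = 0) (ζ : ℂ) :
    ‖frame a b ζ‖ = ‖ζ‖ := by
  have h1 : ‖frame a b ζ‖ ^ 2 = ‖ζ‖ ^ 2 := by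
    rw [← real_inner_self_eq_norm_sq, inner_frame ha hb hab, ← Complex.normSq_eq_norm_sq,
      Complex.normSq_apply]
  exact (sq_eq_sq₀ (norm_nonneg _) (norm_nonneg _)).1 h1

lemma cross_frame (ζ ξ : ℂ) : cross (frame a b ζ) (frame a b ξ) =
    (ζ.re * ξ.im - ζ.im * ξ.re) • cross a b := by
  apply ext_E3 <;> simp [frame_apply] <;> ring

lemma cross_frame_normal (ha : inner ℝ a a = 1) (hb : inner ℝ b b = 1) (hab : inner ℝ a b = 0)
    (ζ : ℂ) (c : ℝ) : cross (frame a b ζ) (c • cross a b) = frame a b (-Complex.I * (c * ζ)) := by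
  have hba : inner ℝ b a = 0 := by rw [real_inner_comm, hab]
  have h1 : cross (frame a b ζ) (c • cross a b) = c • cross (frame a b ζ) (cross a b) := by
    apply ext_E3 <;> simp <;> ring
  rw [h1, cross_cross_left]
  simp only [frame_apply, inner_add_left, real_inner_smul_left, ha, hb, hab, hba]
  apply ext_E3 <;> simp <;> ring

lemma norm_cross_frame (ha : inner ℝ a a = 1) (hb : inner ℝ b b = 1) (hab : inner ℝ a b = 0) :
    ‖cross a b‖ = 1 := by
  have h := norm_sq_cross a b
  rw [← real_inner_self_eq_norm_sq a, ← real_inner_self_eq_norm_sq b, ha, hb, hab] at h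
  nlinarith [norm_nonneg (cross a b)]

end Frame

section Reduction

/-- The position in the orbital plane, `l² r₁ e^{iθ}`. -/
noncomputable def planePos (x : (ℝ × ℝ × ℝ) × ℝ) : ℂ :=
  ((x.1.2.2 ^ 2 * x.1.1 : ℝ) : ℂ) * Complex.exp (x.2 * Complex.I)

/-- The velocity in the orbital plane, `e^{iθ} (v + i / r₁) / l`. -/
noncomputable def planeVel (x : (ℝ × ℝ × ℝ) × ℝ) : ℂ :=
  Complex.exp (x.2 * Complex.I) * (⟨x.1.2.1 / x.1.2.2, 1 / (x.1.2.2 * x.1.1)⟩ : ℂ)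

lemma planePos_re (x : (ℝ × ℝ × ℝ) × ℝ) :
    (planePos x).re = x.1.2.2 ^ 2 * x.1.1 * Real.cos x.2 := by
  rw [planePos, Complex.re_ofReal_mul, Complex.exp_ofReal_mul_I_re]

lemma planePos_im (x : (ℝ × ℝ × ℝ) × ℝ) :
    (planePos x).im = x.1.2.2 ^ 2 * x.1.1 * Real.sin x.2 := by
  rw [planePos, Complex.im_ofReal_mul, Complex.exp_ofReal_mul_I_im]

lemma planeVel_re (x : (ℝ × ℝ × ℝ) × ℝ) : (planeVel x).re =
    Real.cos x.2 * (x.1.2.1 / x.1.2.2) - Real.sin x.2 * (1 / (x.1.2.2 * x.1.1)) := by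
  rw [planeVel, Complex.mul_re, Complex.exp_ofReal_mul_I_re, Complex.exp_ofReal_mul_I_im]

lemma planeVel_im (x : (ℝ × ℝ × ℝ) × ℝ) : (planeVel x).im =
    Real.cos x.2 * (1 / (x.1.2.2 * x.1.1)) + Real.sin x.2 * (x.1.2.1 / x.1.2.2) := by
  rw [planeVel, Complex.mul_im, Complex.exp_ofReal_mul_I_re, Complex.exp_ofReal_mul_I_im]

lemma norm_planePos {x : (ℝ × ℝ × ℝ) × ℝ} (hr : 0 < x.1.1) :
    ‖planePos x‖ = x.1.2.2 ^ 2 * x.1.1 := by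
  rw [planePos, norm_mul, Complex.norm_exp_ofReal_mul_I, mul_one, Complex.norm_real,
    Real.norm_of_nonneg (by positivity)]

lemma planePos_cross_planeVel {x : (ℝ × ℝ × ℝ) × ℝ} (hr : x.1.1 ≠ 0) (hl : x.1.2.2 ≠ 0) :
    (planePos x).re * (planeVel x).im - (planePos x).im * (planeVel x).re = x.1.2.2 := by
  rw [planePos_re, planePos_im, planeVel_re, planeVel_im]
  field_simp
  linear_combination Real.cos_sq_add_sin_sq x.2

lemma planePos_inner_planeVel {x : (ℝ × ℝ × ℝ) × ℝ} (hr : x.1.1 ≠ 0) (hl : x.1.2.2 ≠ 0) :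
    (planePos x).re * (planeVel x).re + (planePos x).im * (planeVel x).im =
      x.1.2.2 * x.1.1 * x.1.2.1 := by
  rw [planePos_re, planePos_im, planeVel_re, planeVel_im]
  field_simp
  linear_combination (x.1.1 * x.1.2.1) * Real.cos_sq_add_sin_sq x.2

variable {a b : E3}

lemma angularMomentum_frame {x : (ℝ × ℝ × ℝ) × ℝ} (hr : x.1.1 ≠ 0) (hl : x.1.2.2 ≠ 0) :
    angularMomentum (frame a b (planePos x)) (frame a b (planeVel x)) = x.1.2.2 • cross a b := by
  rw [angularMomentum, cross_frame, planePos_cross_planeVel hr hl]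

/-- The eccentricity vector is the fixed-frame eccentricity in the orbital plane. -/
lemma eccentricity_frame (ha : inner ℝ a a = 1) (hb : inner ℝ b b = 1) (hab : inner ℝ a b = 0)
    {x : (ℝ × ℝ × ℝ) × ℝ} (hr : 0 < x.1.1) (hl : 0 < x.1.2.2) :
    eccentricity (frame a b (planePos x)) (frame a b (planeVel x)) = frame a b (fixedEcc x) := by
  rw [eccentricity, angularMomentum_frame hr.ne' hl.ne', cross_frame_normal ha hb hab,
    norm_frame ha hb hab, norm_planePos hr, ← map_smul, ← map_sub]
  congr 1
  have hl' := hl.ne'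
  have hr' := hr.ne'
  have h1 : (x.1.2.2 ^ 2 * x.1.1)⁻¹ • planePos x = Complex.exp (x.2 * Complex.I) := by
    rw [planePos, Complex.real_smul, ← mul_assoc, ← Complex.ofReal_mul,
      inv_mul_cancel₀ (by positivity), Complex.ofReal_one, one_mul]
  rw [h1, planeVel, fixedEcc]
  have h2 : (x.1.2.2 : ℂ) * (⟨x.1.2.1 / x.1.2.2, 1 / (x.1.2.2 * x.1.1)⟩ : ℂ) =
      ⟨x.1.2.1, x.1.1⁻¹⟩ := by
    apply Complex.ext <;> simp <;> field_simp
  rw [mul_left_comm (x.1.2.2 : ℂ), h2, mul_left_comm, ← mul_sub_one]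
  congr 1
  apply Complex.ext <;> simp

lemma hasDerivWithinAt_cexp {Y : ℝ → (ℝ × ℝ × ℝ) × ℝ} {θ' : ℝ} {s : ℝ} {A : Set ℝ}
    (h : HasDerivWithinAt (fun s => (Y s).2) θ' A s) :
    HasDerivWithinAt (fun s => Complex.exp ((Y s).2 * Complex.I))
      (θ' * (Complex.I * Complex.exp ((Y s).2 * Complex.I))) A s := by
  have := (hasDerivAt_cexp_mul_I (Y s).2).scomp_hasDerivWithinAt s h
  exact this.congr_deriv Complex.real_smul

variable {δ : ℝ} {Y : ℝ → (ℝ × ℝ × ℝ) × ℝ}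

lemma IsTrajectory.hasDerivWithinAt_planePos (hY : IsTrajectory (extField δ) extDomain Y) {s : ℝ}
    (hs : 0 ≤ s) (hl : 0 < (Y s).1.2.2) : HasDerivWithinAt (fun s => planePos (Y s))
      ((Y s).1.2.2 ^ 3 • planeVel (Y s)) (Ici 0) s := by
  have h := (hY s hs).2
  have hr' : 0 < (Y s).1.1 := (hY s hs).1
  have h1 := hasDerivWithinAt_fst h
  have hθ := hasDerivWithinAt_cexp (hasDerivWithinAt_snd h)
  have hr := hasDerivWithinAt_fst h1
  have hl' := hasDerivWithinAt_snd (hasDerivWithinAt_snd h1)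
  have h2 := ((hl'.fun_pow 2).fun_mul hr).ofReal_comp.fun_mul hθ
  refine h2.congr_deriv ?_
  have hne := hl.ne'
  have hne' := hr'.ne'
  simp only [planeVel, extField, vectorField, Complex.real_smul, Nat.cast_ofNat,
    Nat.add_one_sub_one, pow_one]
  set E := Complex.exp ((Y s).2 * Complex.I)
  generalize (Y s).1.1 = r at *
  generalize (Y s).1.2.1 = v at *
  generalize (Y s).1.2.2 = l at *
  have key : ((2 * l * (-δ * l ^ 4) * r + l ^ 2 * (v + 2 * δ * r * l ^ 3) : ℝ) : ℂ) +
      ((l ^ 2 * r : ℝ) : ℂ) * (((r ^ 2)⁻¹ : ℝ) * Complex.I) =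
      ((l ^ 3 : ℝ) : ℂ) * (⟨v / l, 1 / (l * r)⟩ : ℂ) := by
    apply Complex.ext
    · rw [Complex.add_re, Complex.re_ofReal_mul, Complex.re_ofReal_mul, Complex.re_ofReal_mul,
        Complex.ofReal_re, Complex.I_re]
      field_simp; ring
    · rw [Complex.add_im, Complex.im_ofReal_mul, Complex.im_ofReal_mul, Complex.im_ofReal_mul,
        Complex.ofReal_im, Complex.I_im]
      field_simp; ring
  linear_combination E * key

lemma IsTrajectory.hasDerivWithinAt_planeVel (hY : IsTrajectory (extField δ) extDomain Y) {s : ℝ}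
    (hs : 0 ≤ s) (hl : 0 < (Y s).1.2.2) : HasDerivWithinAt (fun s => planeVel (Y s))
      ((Y s).1.2.2 ^ 3 • (-(δ • planeVel (Y s)) - (‖planePos (Y s)‖ ^ 3)⁻¹ • planePos (Y s)))
      (Ici 0) s := by
  have h := (hY s hs).2
  have hr' : 0 < (Y s).1.1 := (hY s hs).1
  have hne := hl.ne'
  have hne' := hr'.ne'
  have h1 := hasDerivWithinAt_fst h
  have hθ := hasDerivWithinAt_cexp (hasDerivWithinAt_snd h)
  have hr := hasDerivWithinAt_fst h1
  have hv := hasDerivWithinAt_fst (hasDerivWithinAt_snd h1)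
  have hl' := hasDerivWithinAt_snd (hasDerivWithinAt_snd h1)
  have hre := hv.fun_div hl' hne
  have him := (hasDerivWithinAt_const s (Ici 0) (1 : ℝ)).fun_div (hl'.fun_mul hr)
    (mul_ne_zero hne hne')
  have h2 : HasDerivWithinAt
      (fun s => (⟨(Y s).1.2.1 / (Y s).1.2.2, 1 / ((Y s).1.2.2 * (Y s).1.1)⟩ : ℂ)) (⟨_, _⟩ : ℂ)
      (Ici 0) s :=
    Complex.equivRealProdCLM.symm.toContinuousLinearMap.hasFDerivAt.comp_hasDerivWithinAt s
      (hre.prodMk him)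
  refine (hθ.fun_mul h2).congr_deriv ?_
  rw [norm_planePos hr']
  simp only [planeVel, planePos, extField, vectorField, Complex.real_smul]
  set E := Complex.exp ((Y s).2 * Complex.I)
  generalize (Y s).1.1 = r at *
  generalize (Y s).1.2.1 = v at *
  generalize (Y s).1.2.2 = l at *
  have key : ((r ^ 2)⁻¹ : ℝ) * (Complex.I * (⟨v / l, 1 / (l * r)⟩ : ℂ)) +
      (⟨((-(r - 1) / r ^ 3 - 2 * δ * v * l ^ 3) * l - v * (-δ * l ^ 4)) / l ^ 2,
        (0 * (l * r) - 1 * (-δ * l ^ 4 * r + l * (v + 2 * δ * r * l ^ 3))) / (l * r) ^ 2⟩ : ℂ) =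
      ((l ^ 3 : ℝ) : ℂ) * (-((δ : ℂ) * (⟨v / l, 1 / (l * r)⟩ : ℂ)) -
        ((((l ^ 2 * r) ^ 3)⁻¹ : ℝ) : ℂ) * ((l ^ 2 * r : ℝ) : ℂ)) := by
    apply Complex.ext
    · rw [Complex.add_re, Complex.re_ofReal_mul, Complex.re_ofReal_mul, Complex.sub_re,
        Complex.neg_re, Complex.re_ofReal_mul, Complex.re_ofReal_mul, Complex.ofReal_re,
        Complex.I_mul_re]
      field_simp; ring
    · rw [Complex.add_im, Complex.im_ofReal_mul, Complex.im_ofReal_mul, Complex.sub_im,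
        Complex.neg_im, Complex.im_ofReal_mul, Complex.im_ofReal_mul, Complex.ofReal_im,
        Complex.I_mul_im]
      field_simp; ring
  linear_combination E * key

end Reduction

/-! ### The Kepler flow and the limiting eccentricity -/

section KeplerFlow

/-- The vector field of the Kepler problem with linear drag. -/
noncomputable def keplerField (δ : ℝ) (z : E3 × E3) : E3 × E3 :=
  (z.2, -(δ • z.2) - (‖z.1‖ ^ 3)⁻¹ • z.1)

/-- The states without collision. -/
def keplerDomain : Set (E3 × E3) := {z | z.1 ≠ 0}

lemma isOpen_keplerDomain : IsOpen keplerDomain := isOpen_ne_fun continuous_fst continuous_const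

lemma contDiffOn_norm_fst : ContDiffOn ℝ ∞ (fun z : E3 × E3 => ‖z.1‖) keplerDomain :=
  contDiffOn_fst.norm ℝ fun _ hz => hz

lemma contDiffOn_keplerField (δ : ℝ) : ContDiffOn ℝ ∞ (keplerField δ) keplerDomain := by
  have h1 : ContDiffOn ℝ ∞ (fun z : E3 × E3 => (‖z.1‖ ^ 3)⁻¹) keplerDomain :=
    (contDiffOn_norm_fst.pow 3).inv fun z hz => pow_ne_zero _ (norm_ne_zero_iff.2 hz)
  have h2 : ContDiffOn ℝ ∞ (fun z : E3 × E3 => -(δ • z.2)) keplerDomain := by fun_prop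
  exact contDiffOn_snd.prodMk (h2.sub (h1.smul contDiffOn_fst))

lemma timeInterval_top : timeInterval ⊤ = Ici 0 := by
  ext t; simp [timeInterval]

variable {δ : ℝ}

lemma isKeplerSolution_top_iff {u w : ℝ → E3} : IsKeplerSolution δ ⊤ u w ↔
    IsTrajectory (keplerField δ) keplerDomain fun t => (u t, w t) := by
  constructor
  · rintro ⟨h1, h2, h3⟩
    rw [timeInterval_top] at h1 h2 h3
    exact fun t ht => ⟨h1 t ht, (h2 t ht).prodMk (h3 t ht)⟩
  · intro h
    refine ⟨?_, ?_, ?_⟩ <;> rw [timeInterval_top]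
    · exact fun t ht => (h t ht).1
    · exact fun t ht => hasDerivWithinAt_fst (h t ht).2
    · exact fun t ht => hasDerivWithinAt_snd (h t ht).2

lemma comap_coe_nhdsLT_top : comap ((↑) : ℝ → EReal) (𝓝[<] ⊤) = atTop := by
  have h1 : (Iio (⊤ : EReal)) = {⊤}ᶜ := by ext x; simp [lt_top_iff_ne_top]
  rw [h1, EReal.nhdsWithin_top]
  exact comap_map EReal.coe_injective

/-- The time `s` of the reduced system as a function of the physical time `t`, for the initial angular
momentum `ℓ`: the solution of `ds/dt = l⁻³`, where `l = ℓ e^{-δ t}`. -/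
noncomputable def redTime (δ ℓ t : ℝ) : ℝ := (Real.exp (3 * δ * t) - 1) / (3 * δ * ℓ ^ 3)

lemma radialDecay_redTime (hδ : 0 < δ) {ℓ : ℝ} (hℓ : 0 < ℓ) (t : ℝ) :
    radialDecay δ ℓ (redTime δ ℓ t) = ℓ * Real.exp (-(δ * t)) := by
  have h1 : 1 + 3 * δ * ℓ ^ 3 * redTime δ ℓ t = Real.exp (3 * δ * t) := by
    unfold redTime; field_simp; ring
  rw [radialDecay, h1, ← Real.exp_mul]
  congr 2; ring

lemma hasDerivAt_redTime (hδ : 0 < δ) {ℓ : ℝ} (hℓ : 0 < ℓ) (t : ℝ) :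
    HasDerivAt (redTime δ ℓ) ((radialDecay δ ℓ (redTime δ ℓ t) ^ 3)⁻¹) t := by
  have h1 := ((((hasDerivAt_id' t).const_mul (3 * δ)).exp).sub_const 1).div_const (3 * δ * ℓ ^ 3)
  refine h1.congr_deriv ?_
  rw [radialDecay_redTime hδ hℓ, mul_pow, ← Real.exp_nat_mul, mul_inv, ← Real.exp_neg]
  have h2 : -(((3 : ℕ) : ℝ) * -(δ * t)) = 3 * δ * t := by push_cast; ring
  rw [h2]
  field_simp

lemma redTime_nonneg (hδ : 0 < δ) {ℓ : ℝ} (hℓ : 0 < ℓ) {t : ℝ} (ht : 0 ≤ t) :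
    0 ≤ redTime δ ℓ t := by
  have : 1 ≤ Real.exp (3 * δ * t) := Real.one_le_exp (by positivity)
  exact div_nonneg (by linarith) (by positivity)

lemma tendsto_redTime (hδ : 0 < δ) {ℓ : ℝ} (hℓ : 0 < ℓ) :
    Tendsto (redTime δ ℓ) atTop atTop := by
  refine Tendsto.atTop_div_const (by positivity) (tendsto_atTop_add_const_right _ _ ?_)
  exact Real.tendsto_exp_atTop.comp (tendsto_id.const_mul_atTop (by positivity))

lemma map_redTime (hδ : 0 < δ) {ℓ : ℝ} (hℓ : 0 < ℓ) : map (redTime δ ℓ) atTop = atTop := by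
  refine le_antisymm (tendsto_redTime hδ hℓ) ?_
  set σ : ℝ → ℝ := fun s => Real.log (1 + 3 * δ * ℓ ^ 3 * s) / (3 * δ) with hσ
  have h1 : Tendsto σ atTop atTop := by
    refine Tendsto.atTop_div_const (by positivity) (Real.tendsto_log_atTop.comp ?_)
    exact tendsto_atTop_add_const_left _ _ (tendsto_id.const_mul_atTop (by positivity))
  have h2 : ∀ᶠ s in atTop, redTime δ ℓ (σ s) = s := by
    filter_upwards [eventually_ge_atTop 0] with s hs
    have h3 : 3 * δ * σ s = Real.log (1 + 3 * δ * ℓ ^ 3 * s) := by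
      simp only [hσ]; field_simp
    rw [redTime, h3, Real.exp_log (by positivity)]
    field_simp; ring
  have h3 : map (redTime δ ℓ) (map σ atTop) = atTop := by
    rw [map_map]
    exact (map_congr (h2.mono fun s hs => hs)).trans map_id
  calc atTop = map (redTime δ ℓ) (map σ atTop) := h3.symm
    _ ≤ map (redTime δ ℓ) atTop := map_mono h1

/-- The reduced state `(r₁, v, l) = (|u| / |L|², |L| ⟨u, w⟩ / |u|, |L|)`, which is meaningful when
`u` and `L` do not vanish. -/
noncomputable def toReduced (z : E3 × E3) : ℝ × ℝ × ℝ :=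
  (‖z.1‖ / ‖angularMomentum z.1 z.2‖ ^ 2, ‖angularMomentum z.1 z.2‖ * inner ℝ z.1 z.2 / ‖z.1‖,
    ‖angularMomentum z.1 z.2‖)

lemma toReduced_mem_phaseSpace {z : E3 × E3} (h1 : z.1 ≠ 0) (h2 : angularMomentum z.1 z.2 ≠ 0) :
    toReduced z ∈ phaseSpace :=
  ⟨div_pos (norm_pos_iff.2 h1) (pow_pos (norm_pos_iff.2 h2) 2), norm_nonneg _⟩

/-- Every state with nonvanishing angular momentum is the image of its reduced state under an
orthonormal frame of the orbital plane. -/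
lemma exists_frame {z : E3 × E3} (h1 : z.1 ≠ 0) (h2 : angularMomentum z.1 z.2 ≠ 0) :
    ∃ a b : E3, inner ℝ a a = (1 : ℝ) ∧ inner ℝ b b = (1 : ℝ) ∧ inner ℝ a b = (0 : ℝ) ∧
      frame a b (planePos (toReduced z, 0)) = z.1 ∧ frame a b (planeVel (toReduced z, 0)) = z.2 := by
  obtain ⟨u, w⟩ := z
  dsimp only at h1 h2 ⊢
  set L := angularMomentum u w with hL
  have hr : 0 < ‖u‖ := norm_pos_iff.2 h1
  have hl : 0 < ‖L‖ := norm_pos_iff.2 h2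
  have hLu : inner ℝ L u = 0 := inner_cross_self_left u w
  have hcc : cross L u = ‖u‖ ^ 2 • w - (inner ℝ u w) • u := by
    rw [hL, angularMomentum, cross_cross_right, real_inner_self_eq_norm_sq, real_inner_comm]
  refine ⟨‖u‖⁻¹ • u, (‖L‖ * ‖u‖)⁻¹ • cross L u, ?_, ?_, ?_, ?_, ?_⟩
  · rw [real_inner_smul_left, real_inner_smul_right, real_inner_self_eq_norm_sq]
    field_simp
  · rw [real_inner_smul_left, real_inner_smul_right, real_inner_self_eq_norm_sq, norm_sq_cross, hLu]
    field_simp; ring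
  · rw [real_inner_smul_left, real_inner_smul_right, real_inner_comm, hL,
      inner_eq_sum]
    simp; right; right; ring
  · rw [frame_apply, planePos_re, planePos_im]
    simp only [toReduced, Real.cos_zero, Real.sin_zero, mul_one, mul_zero, ← hL, smul_smul]
    have : ‖L‖ ^ 2 * (‖u‖ / ‖L‖ ^ 2) * ‖u‖⁻¹ = 1 := by field_simp
    rw [this, one_smul, zero_mul, zero_smul, add_zero]
  · rw [frame_apply, planeVel_re, planeVel_im, hcc]
    simp only [toReduced, Real.cos_zero, Real.sin_zero, one_mul, zero_mul, sub_zero, add_zero,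
      ← hL, smul_sub, smul_smul]
    have e1 : ‖L‖ * inner ℝ u w / ‖u‖ / ‖L‖ * ‖u‖⁻¹ = inner ℝ u w / ‖u‖ ^ 2 := by field_simp
    have e2 : 1 / (‖L‖ * (‖u‖ / ‖L‖ ^ 2)) * ((‖L‖ * ‖u‖)⁻¹ * ‖u‖ ^ 2) = 1 := by field_simp
    have e3 : 1 / (‖L‖ * (‖u‖ / ‖L‖ ^ 2)) * ((‖L‖ * ‖u‖)⁻¹ * inner ℝ u w) =
        inner ℝ u w / ‖u‖ ^ 2 := by field_simp
    simp only [← mul_assoc] at e2 e3 ⊢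
    rw [e1, e2, e3, one_smul]
    abel

variable {a b : E3}

/-- Trajectories of the reduced system with `l > 0` give, in the physical time, global solutions of the
Kepler problem in any orbital plane. -/
lemma IsTrajectory.kepler (hδ : 0 < δ) (ha : inner ℝ a a = (1 : ℝ)) (hb : inner ℝ b b = (1 : ℝ))
    (hab : inner ℝ a b = (0 : ℝ)) {Y : ℝ → (ℝ × ℝ × ℝ) × ℝ}
    (hY : IsTrajectory (extField δ) extDomain Y) (hl : 0 < (Y 0).1.2.2) :
    IsTrajectory (keplerField δ) keplerDomain fun t =>
      (frame a b (planePos (Y (redTime δ (Y 0).1.2.2 t))),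
        frame a b (planeVel (Y (redTime δ (Y 0).1.2.2 t)))) := by
  intro t ht
  set ℓ := (Y 0).1.2.2 with hℓ
  have hs : ∀ t ∈ Ici (0 : ℝ), redTime δ ℓ t ∈ Ici (0 : ℝ) := fun t ht => redTime_nonneg hδ hl ht
  have hlt : (Y (redTime δ ℓ t)).1.2.2 = radialDecay δ ℓ (redTime δ ℓ t) :=
    hY.ang_eq hδ hl.le (hs t ht)
  have hlpos : 0 < (Y (redTime δ ℓ t)).1.2.2 := by
    rw [hlt, radialDecay_redTime hδ hl]; positivity
  have hrpos : 0 < (Y (redTime δ ℓ t)).1.1 := (hY _ (hs t ht)).1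
  have hτ := (hasDerivAt_redTime hδ hl t).hasDerivWithinAt (s := Ici 0)
  rw [← hlt] at hτ
  have hne : (Y (redTime δ ℓ t)).1.2.2 ^ 3 ≠ 0 := (pow_pos hlpos 3).ne'
  have h1 := (hY.hasDerivWithinAt_planePos (hs t ht) hlpos).scomp t hτ hs
  have h2 := (hY.hasDerivWithinAt_planeVel (hs t ht) hlpos).scomp t hτ hs
  rw [smul_smul, inv_mul_cancel₀ hne, one_smul] at h1 h2
  refine ⟨?_, ?_⟩
  · have h3 : 0 < ‖frame a b (planePos (Y (redTime δ ℓ t)))‖ := by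
      rw [norm_frame ha hb hab, norm_planePos hrpos]; positivity
    exact norm_pos_iff.1 h3
  · have h4 := (frame a b).hasFDerivAt.comp_hasDerivWithinAt t h1
    have h5 := (frame a b).hasFDerivAt.comp_hasDerivWithinAt t h2
    refine (h4.prodMk h5).congr_deriv (Prod.ext rfl ?_)
    simp only [keplerField, norm_frame ha hb hab, map_sub, map_neg, map_smul]

/-- For nonvanishing angular momentum, `|𝓔_∞| = c` is a condition on the reduced state. -/
lemma mem_eccentricityLevelSet_iff (hδ : 0 < δ) {c : ℝ} (hc : c ∈ Ioo (0 : ℝ) 1) {z : E3 × E3}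
    (h1 : z.1 ≠ 0) (h2 : angularMomentum z.1 z.2 ≠ 0) :
    z ∈ eccentricityLevelSet δ c ↔ toReduced z ∈ stableSet δ (Γ₁ (c ^ 2 / 2)) := by
  have hh : c ^ 2 / 2 ∈ Ico (0 : ℝ) (1 / 2) := ⟨by positivity, by nlinarith [hc.1, hc.2]⟩
  have hph := toReduced_mem_phaseSpace h1 h2
  obtain ⟨a, b, ha, hb, hab, hpos, hvel⟩ := exists_frame h1 h2
  obtain ⟨Y, hY0, hY⟩ := exists_isTrajectory_extField hδ hph 0
  have hp' : toReduced z = (Y 0).1 := by rw [hY0]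
  have hph' : (Y 0).1 ∈ phaseSpace := hp' ▸ hph
  have hl : 0 < (Y 0).1.2.2 := hp' ▸ norm_pos_iff.2 h2
  set ℓ := (Y 0).1.2.2 with hℓ
  have hK := hY.kepler hδ ha hb hab hl
  have hK0 : redTime δ ℓ 0 = 0 := by simp [redTime]
  have hsol := isKeplerSolution_top_iff.2 hK
  have hecc : ∀ t, 0 ≤ t → eccentricity (frame a b (planePos (Y (redTime δ ℓ t))))
      (frame a b (planeVel (Y (redTime δ ℓ t)))) = frame a b (fixedEcc (Y (redTime δ ℓ t))) := by
    intro t ht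
    have hs := redTime_nonneg hδ hl ht
    refine eccentricity_frame ha hb hab (hY _ hs).1 ?_
    rw [hY.ang_eq hδ hl.le hs, radialDecay_redTime hδ hl]; positivity
  have hstart : (frame a b (planePos (Y (redTime δ ℓ 0))) = z.1) ∧
      frame a b (planeVel (Y (redTime δ ℓ 0))) = z.2 := by rw [hK0, hY0]; exact ⟨hpos, hvel⟩
  rw [hp', hY.mem_stableSet_iff hδ hph']
  constructor
  · rintro ⟨-, e, ⟨T, u, w, ⟨hT, hu, hmax⟩, hu0, hw0, hlim⟩, he⟩
    have hTtop : T = ⊤ := top_le_iff.1 (hmax ⊤ _ _ hsol (by rw [hstart.1, hu0])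
      (by rw [hstart.2, hw0]))
    rw [hTtop, comap_coe_nhdsLT_top] at hlim
    have heq := hK.eqOn isOpen_keplerDomain (contDiffOn_keplerField δ)
      (isKeplerSolution_top_iff.1 (hTtop ▸ hu)) (by rw [hu0, hw0, hstart.1, hstart.2])
    have hlim1 : Tendsto (fun t => frame a b (fixedEcc (Y (redTime δ ℓ t)))) atTop (𝓝 e) := by
      refine hlim.congr' ?_
      filter_upwards [eventually_ge_atTop 0] with t ht
      obtain ⟨h3, h4⟩ := Prod.mk.inj (heq ht)
      rw [← hecc t ht, h3, h4]
    have hlim2 : Tendsto (fun s => frame a b (fixedEcc (Y s))) atTop (𝓝 e) := by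
      rw [← map_redTime hδ hl, tendsto_map'_iff]; exact hlim1
    -- the frame is an isometry, so that its inverse on the orbital plane is continuous
    have hlim3 : Tendsto (fun s => fixedEcc (Y s)) atTop (𝓝 ⟨inner ℝ a e, inner ℝ b e⟩) := by
      have h3 : Tendsto (fun s => ((inner ℝ a (frame a b (fixedEcc (Y s))) : ℝ),
          (inner ℝ b (frame a b (fixedEcc (Y s))) : ℝ))) atTop (𝓝 (inner ℝ a e, inner ℝ b e)) :=
        (tendsto_const_nhds.inner hlim2).prodMk_nhds (tendsto_const_nhds.inner hlim2)
      have h4 := (Complex.equivRealProdCLM.symm.continuous.tendsto _).comp h3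
      refine h4.congr fun s => ?_
      have hba : inner ℝ b a = (0 : ℝ) := by rw [real_inner_comm, hab]
      apply Complex.ext
      · change inner ℝ a (frame a b _) = _
        simp only [frame_apply, inner_add_right, real_inner_smul_right, ha, hab, mul_one, mul_zero,
          add_zero]
      · change inner ℝ b (frame a b _) = _
        simp only [frame_apply, inner_add_right, real_inner_smul_right, hb, hba, mul_one, mul_zero,
          zero_add]
    refine hY.tendsto_infDist hδ hph' hlim3 hh.2 ?_
    have h5 := tendsto_nhds_unique hlim3.norm (hlim2.norm.congr fun s => norm_frame ha hb hab _)
    rw [h5, he]; ring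
  · intro hd
    obtain ⟨ζ, hζ, hζc⟩ := hY.exists_tendsto_fixedEcc hδ hph' hh.1 hh.2 hd
    refine ⟨h1, frame a b ζ, ⟨⊤, _, _, ⟨by simp, hsol, fun T' _ _ _ _ _ => le_top⟩, hstart.1,
      hstart.2, ?_⟩, ?_⟩
    · rw [comap_coe_nhdsLT_top]
      have h3 := ((frame a b).continuous.tendsto ζ).comp (hζ.comp (tendsto_redTime hδ hl))
      refine h3.congr' ?_
      filter_upwards [eventually_ge_atTop 0] with t ht
      exact (hecc t ht).symm
    · rw [norm_frame ha hb hab]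
      have h3 : ‖ζ‖ ^ 2 = c ^ 2 := by rw [hζc]; ring
      exact (sq_eq_sq₀ (norm_nonneg _) hc.1.le).1 h3

/-- The angular momentum of a Kepler solution satisfies `L' = -δ L`. In particular, it stays zero
if it is zero initially. -/
lemma IsKeplerSolution.angularMomentum_eq_zero {T : EReal} {u w : ℝ → E3}
    (h : IsKeplerSolution δ T u w) (h0 : angularMomentum (u 0) (w 0) = 0) {t : ℝ}
    (ht : t ∈ timeInterval T) : angularMomentum (u t) (w t) = 0 := by
  have hsub : Icc 0 t ⊆ timeInterval T := fun s hs =>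
    ⟨hs.1, lt_of_le_of_lt (by exact_mod_cast hs.2) ht.2⟩
  have hu : ∀ i : Fin 3, ∀ s ∈ Icc 0 t, HasDerivWithinAt (fun s => u s i) (w s i) (Icc 0 t) s :=
    fun i s hs => ((EuclideanSpace.proj i : E3 →L[ℝ] ℝ).hasFDerivAt.comp_hasDerivWithinAt s
      (h.deriv_pos s (hsub hs))).mono hsub
  have hw : ∀ i : Fin 3, ∀ s ∈ Icc 0 t, HasDerivWithinAt (fun s => w s i)
      (-(δ * w s i) - (‖u s‖ ^ 3)⁻¹ * u s i) (Icc 0 t) s :=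
    fun i s hs => ((EuclideanSpace.proj i : E3 →L[ℝ] ℝ).hasFDerivAt.comp_hasDerivWithinAt s
      (h.deriv_vel s (hsub hs))).mono hsub
  have key : ∀ i j : Fin 3, u 0 i * w 0 j - u 0 j * w 0 i = 0 →
      u t i * w t j - u t j * w t i = 0 := by
    intro i j hij
    have h1 : IsTrajectoryOn (fun y : ℝ => -δ * y) univ t
        fun s => u s i * w s j - u s j * w s i := fun s hs => by
      refine ⟨mem_univ _, ?_⟩
      refine (((hu i s hs).fun_mul (hw j s hs)).fun_sub
        ((hu j s hs).fun_mul (hw i s hs))).congr_deriv ?_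
      ring
    have h2 : IsTrajectoryOn (fun y : ℝ => -δ * y) univ t fun _ => 0 := fun s hs => by
      refine ⟨mem_univ _, ?_⟩
      simpa using hasDerivWithinAt_const s (Icc 0 t) (0 : ℝ)
    exact h1.eqOn isOpen_univ (by fun_prop) h2 hij ⟨ht.1, le_rfl⟩
  have hc : ∀ i, cross (u 0) (w 0) i = 0 := fun i => by
    have := congrArg (fun e : E3 => e i) h0
    simpa [angularMomentum] using this
  have h0' := hc 0
  have h1' := hc 1
  have h2' := hc 2
  rw [cross_zero_apply] at h0'
  rw [cross_one_apply] at h1'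
  rw [cross_two_apply] at h2'
  refine ext_E3 ?_ ?_ ?_
  · simpa [angularMomentum] using key 1 2 h0'
  · simpa [angularMomentum] using key 2 0 h1'
  · simpa [angularMomentum] using key 0 1 h2'

/-- On radial orbits the eccentricity has norm one, so that its limit cannot be shorter. -/
lemma angularMomentum_ne_zero_of_mem {c : ℝ} (hc : c < 1) {z : E3 × E3}
    (hz : z ∈ eccentricityLevelSet δ c) : angularMomentum z.1 z.2 ≠ 0 := by
  intro h0
  obtain ⟨-, e, ⟨T, u, w, ⟨hT, hu, -⟩, hu0, hw0, hlim⟩, he⟩ := hz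
  -- the limit is taken along a proper filter, since `T > 0`
  have hne : (comap ((↑) : ℝ → EReal) (𝓝[<] T)).NeBot := by
    refine comap_neBot fun s hs => ?_
    obtain ⟨l, hl, hls⟩ := (mem_nhdsLT_iff_exists_Ioo_subset' hT).1 hs
    obtain ⟨x, hx1, hx2⟩ := EReal.lt_iff_exists_real_btwn.1 hl
    exact ⟨x, hls ⟨hx1, hx2⟩⟩
  have hev : ∀ᶠ t in comap ((↑) : ℝ → EReal) (𝓝[<] T), t ∈ timeInterval T := by
    have h1 : ∀ᶠ x in 𝓝[<] T, x ∈ Ioo 0 T := Ioo_mem_nhdsLT hT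
    filter_upwards [tendsto_comap.eventually h1] with t ht
    exact ⟨by exact_mod_cast ht.1.le, ht.2⟩
  have h1 : ∀ᶠ t in comap ((↑) : ℝ → EReal) (𝓝[<] T), ‖eccentricity (u t) (w t)‖ = 1 := by
    filter_upwards [hev] with t ht
    have h2 := hu.angularMomentum_eq_zero (by rw [hu0, hw0, h0]) ht
    have h3 : cross (w t) (0 : E3) = 0 := by apply ext_E3 <;> simp
    have h4 := norm_ne_zero_iff.2 (hu.ne_zero t ht)
    rw [eccentricity, h2, h3, zero_sub, norm_neg, norm_smul, norm_inv, norm_norm,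
      inv_mul_cancel₀ h4]
  have h5 := tendsto_nhds_unique hlim.norm (tendsto_const_nhds.congr' (h1.mono fun t ht => ht.symm))
  linarith

end KeplerFlow

/-! ### The level sets of the limiting eccentricity -/

section LevelSets

/-- A nonzero functional is the first coordinate of a linear isomorphism. -/
lemma exists_continuousLinearEquiv_fst {E : Type*} [NormedAddCommGroup E] [NormedSpace ℝ E]
    [FiniteDimensional ℝ E] {k : ℕ} (hdim : Module.finrank ℝ E = k + 1) {φ : E →L[ℝ] ℝ}
    (hφ : φ ≠ 0) :
    ∃ (κ : E →L[ℝ] EuclideanSpace ℝ (Fin k)) (A : E ≃L[ℝ] ℝ × EuclideanSpace ℝ (Fin k)),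
      (A : E →L[ℝ] ℝ × EuclideanSpace ℝ (Fin k)) = φ.prod κ := by
  have hφ' : (φ : E →ₗ[ℝ] ℝ) ≠ 0 := fun h => hφ (ContinuousLinearMap.coe_inj.1 h)
  have hker : Module.finrank ℝ (LinearMap.ker (φ : E →ₗ[ℝ] ℝ)) = k := by
    have h1 := LinearMap.finrank_range_add_finrank_ker (φ : E →ₗ[ℝ] ℝ)
    rw [LinearMap.range_eq_top.2 (LinearMap.surjective hφ'), finrank_top,
      Module.finrank_self, hdim] at h1
    omega
  obtain ⟨P, hP⟩ := (LinearMap.ker (φ : E →ₗ[ℝ] ℝ)).subtype.exists_leftInverse_of_injective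
    (LinearMap.ker_eq_bot.2 (Submodule.injective_subtype _))
  have hk : Module.finrank ℝ (LinearMap.ker (φ : E →ₗ[ℝ] ℝ)) =
      Module.finrank ℝ (EuclideanSpace ℝ (Fin k)) := by rw [hker, finrank_euclideanSpace_fin]
  let ε := LinearEquiv.ofFinrankEq _ _ hk
  let κ : E →ₗ[ℝ] EuclideanSpace ℝ (Fin k) := ε.toLinearMap ∘ₗ P
  let B : E →ₗ[ℝ] ℝ × EuclideanSpace ℝ (Fin k) := (φ : E →ₗ[ℝ] ℝ).prod κ
  have hB : Function.Injective B := by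
    rw [← LinearMap.ker_eq_bot, LinearMap.ker_eq_bot']
    intro x hx
    obtain ⟨h1, h2⟩ := Prod.mk.inj hx
    have h3 : P x = 0 := ε.map_eq_zero_iff.1 h2
    have h4 := LinearMap.congr_fun hP ⟨x, h1⟩
    have h5 : P x = ⟨x, h1⟩ := h4
    rw [h3] at h5
    exact (congrArg Subtype.val h5).symm
  have hfin : Module.finrank ℝ E = Module.finrank ℝ (ℝ × EuclideanSpace ℝ (Fin k)) := by
    rw [hdim, Module.finrank_prod, Module.finrank_self, finrank_euclideanSpace_fin, add_comm]
  let A := (LinearMap.linearEquivOfInjective B hB hfin).toContinuousLinearEquiv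
  exact ⟨LinearMap.toContinuousLinearMap κ, A, by ext x <;> rfl⟩

/-- The level sets of a submersion to `ℝ` form a smooth family of hypersurfaces. The coordinates
are shifted into the interior of the half space, since there is no boundary. -/
lemma exists_param_levelSet {E : Type*} [NormedAddCommGroup E] [NormedSpace ℝ E]
    [FiniteDimensional ℝ E] {k : ℕ} [NeZero k] (hdim : Module.finrank ℝ E = k + 1) {I : Set ℝ}
    (hI : IsOpen I) {S : ℝ → Set E} {R : Set E} (hR : IsOpen R) {F : E → ℝ}
    (hF : ContDiffOn ℝ ∞ F R) (hS : ∀ c ∈ I, ∀ z ∈ R, z ∈ S c ↔ F z = c) {c₀ : ℝ} (hc₀ : c₀ ∈ I)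
    {z₀ : E} (hz₀ : z₀ ∈ R) (hd : fderiv ℝ F z₀ ≠ 0) :
    ∃ U : Set (ℝ × E), IsOpen U ∧ (c₀, z₀) ∈ U ∧
    ∃ O : Set (ℝ × EuclideanSpace ℝ (Fin k)), IsOpen O ∧
    ∃ (f : ℝ × EuclideanSpace ℝ (Fin k) → E) (g : ℝ × E → EuclideanSpace ℝ (Fin k)),
      ContDiffOn ℝ ∞ f (O ∩ univ ×ˢ halfSpace k) ∧
      (fun y : ℝ × EuclideanSpace ℝ (Fin k) => (y.1, f y)) '' (O ∩ univ ×ˢ halfSpace k) =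
        {z : ℝ × E | z.1 ∈ I ∧ z.2 ∈ S z.1} ∩ U ∧
      ContinuousOn g ({z : ℝ × E | z.1 ∈ I ∧ z.2 ∈ S z.1} ∩ U) ∧
      (∀ y ∈ O ∩ univ ×ˢ halfSpace k, g (y.1, f y) = y.2) ∧
      (∀ y ∈ O ∩ univ ×ˢ halfSpace k, Function.Injective
        (fderivWithin ℝ (fun x => f (y.1, x)) {x | (y.1, x) ∈ O ∩ univ ×ˢ halfSpace k} y.2)) ∧
      (∀ y ∈ O ∩ univ ×ˢ halfSpace k, f y ∈ (∅ : Set E) ↔ y.2 0 = 0) := by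
  have : CompleteSpace E := FiniteDimensional.complete ℝ E
  obtain ⟨κ, A, hA⟩ := exists_continuousLinearEquiv_fst hdim hd
  let Θ : E → ℝ × EuclideanSpace ℝ (Fin k) := fun z =>
    (F z, κ z + (EuclideanSpace.single 0 1 - κ z₀))
  have hΘ : ContDiffOn ℝ ∞ Θ R := hF.prodMk (by fun_prop)
  have hΘ' : HasFDerivAt Θ (A : E →L[ℝ] ℝ × EuclideanSpace ℝ (Fin k)) z₀ := by
    rw [hA]
    exact (((hF.contDiffAt (hR.mem_nhds hz₀)).differentiableAt (by simp)).hasFDerivAt).prodMk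
      (κ.hasFDerivAt.add_const _)
  obtain ⟨e, hze, heR, heΘ, he, hed⟩ := exists_openPartialHomeomorph_contDiffOn (n := ∞)
    (by exact_mod_cast le_top) hR hΘ hz₀ hΘ'
  have heF : ∀ z, (e z).1 = F z := fun z => by rw [heΘ]
  set H : Set (ℝ × EuclideanSpace ℝ (Fin k)) := {y | 0 < y.2 0} with hH
  have hHo : IsOpen H := isOpen_lt continuous_const (by fun_prop)
  set D : Set E := e.source ∩ e ⁻¹' H with hD
  have hDo : IsOpen D := e.continuousOn.isOpen_inter_preimage e.open_source hHo
  have hzD : z₀ ∈ D := by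
    refine ⟨hze, ?_⟩
    rw [mem_preimage, heΘ]; simp [Θ, hH]
  have hΘD : ContDiffOn ℝ ∞ (fun z => (e z).2) D := by
    refine ContDiffOn.congr (f := fun z => (Θ z).2) (hΘ.snd.mono fun z hz => heR hz.1)
      fun z _ => by rw [heΘ]
  have hsub : ∀ y, y ∈ (e.target ∩ H ∩ {y | y.1 ∈ I}) ∩ univ ×ˢ halfSpace k ↔
      y ∈ e.target ∩ H ∩ {y | y.1 ∈ I} := fun y =>
    ⟨fun h => h.1, fun h => ⟨h, mem_univ _, show 0 ≤ y.2 0 from le_of_lt h.1.2⟩⟩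
  have hsub' : (e.target ∩ H ∩ {y | y.1 ∈ I}) ∩ univ ×ˢ halfSpace k =
      e.target ∩ H ∩ {y | y.1 ∈ I} := Set.ext hsub
  have hOo : IsOpen (e.target ∩ H ∩ {y | y.1 ∈ I}) :=
    (e.open_target.inter hHo).inter (hI.preimage continuous_fst)
  have hmemD : ∀ y ∈ e.target ∩ H ∩ {y | y.1 ∈ I}, e.symm y ∈ D := fun y hy =>
    ⟨e.map_target hy.1.1, by rw [mem_preimage, e.right_inv hy.1.1]; exact hy.1.2⟩
  refine ⟨I ×ˢ D, hI.prod hDo, ⟨hc₀, hzD⟩, e.target ∩ H ∩ {y | y.1 ∈ I}, hOo, e.symm,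
    fun z => (e z.2).2, ?_, ?_, ?_, ?_, ?_, ?_⟩
  · rw [hsub']; exact he.mono fun y hy => hy.1.1
  · rw [hsub']
    ext ⟨c, z⟩
    constructor
    · rintro ⟨y, hy, hyz⟩
      obtain ⟨rfl, rfl⟩ := Prod.mk.inj hyz
      have hyD := hmemD y hy
      refine ⟨⟨hy.2, (hS _ hy.2 _ (heR hyD.1)).2 ?_⟩, hy.2, hyD⟩
      rw [← heF, e.right_inv hy.1.1]
    · rintro ⟨⟨hc, hz⟩, -, hzD⟩
      have hFz := (hS c hc z (heR hzD.1)).1 hz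
      have h1 : (c, (e z).2) = e z := Prod.ext (by rw [heF, hFz]) rfl
      have h2 : e z ∈ e.target := e.map_source hzD.1
      refine ⟨e z, ⟨⟨h2, hzD.2⟩, ?_⟩, ?_⟩
      · rw [← h1]; exact hc
      · beta_reduce
        rw [e.left_inv hzD.1, heF, hFz]
  · exact hΘD.continuousOn.comp continuousOn_snd fun z hz => hz.2.2
  · intro y hy
    rw [hsub] at hy
    beta_reduce
    rw [e.right_inv hy.1.1]
  · rintro ⟨c, x⟩ hy
    have hset : {x | (c, x) ∈ (e.target ∩ H ∩ {y | y.1 ∈ I}) ∩ univ ×ˢ halfSpace k} =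
        {x | (c, x) ∈ e.target ∩ H ∩ {y | y.1 ∈ I}} := by rw [hsub']
    rw [hsub] at hy
    dsimp only
    rw [hset]
    have hfx : ContDiffOn ℝ ∞ (fun x => e.symm (c, x))
        {x | (c, x) ∈ e.target ∩ H ∩ {y | y.1 ∈ I}} :=
      he.comp (contDiff_prodMk_right c).contDiffOn fun x hx => hx.1.1
    exact injective_fderivWithin_of_leftInverse
      (IsOpen.uniqueDiffWithinAt (hOo.preimage (by fun_prop)) hy)
      ((hfx x hy).differentiableWithinAt (by simp))
      ((hΘD.contDiffAt (hDo.mem_nhds (hmemD _ hy))).differentiableAt (by simp))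
      (fun x hx => by rw [e.right_inv hx.1.1]) hy
  · intro y hy
    rw [hsub] at hy
    exact iff_of_false (notMem_empty _) (ne_of_gt hy.1.2)

lemma contDiff_angularMomentum : ContDiff ℝ ∞ fun z : E3 × E3 => angularMomentum z.1 z.2 := by
  rw [contDiff_euclidean]
  intro i
  fin_cases i
  · simp only [angularMomentum, Fin.zero_eta, cross_zero_apply]; fun_prop
  · simp only [angularMomentum, Fin.mk_one, cross_one_apply]; fun_prop
  · simp only [angularMomentum, Fin.reduceFinMk, cross_two_apply]; fun_prop

/-- The states with nonvanishing position and angular momentum. -/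
def regularStates : Set (E3 × E3) := {z | z.1 ≠ 0 ∧ angularMomentum z.1 z.2 ≠ 0}

lemma isOpen_regularStates : IsOpen regularStates :=
  (isOpen_ne_fun continuous_fst continuous_const).inter
    (isOpen_ne_fun contDiff_angularMomentum.continuous continuous_const)

lemma contDiffOn_toReduced : ContDiffOn ℝ ∞ toReduced regularStates := by
  have h1 : ContDiffOn ℝ ∞ (fun z : E3 × E3 => ‖z.1‖) regularStates :=
    contDiffOn_norm_fst.mono fun z hz => hz.1
  have h2 : ContDiffOn ℝ ∞ (fun z : E3 × E3 => ‖angularMomentum z.1 z.2‖) regularStates :=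
    contDiff_angularMomentum.contDiffOn.norm ℝ fun z hz => hz.2
  have h3 : ContDiffOn ℝ ∞ (fun z : E3 × E3 => (inner ℝ z.1 z.2 : ℝ)) regularStates :=
    (contDiff_fst.inner ℝ contDiff_snd).contDiffOn
  exact (h1.div (h2.pow 2) fun z hz => pow_ne_zero _ (norm_ne_zero_iff.2 hz.2)).prodMk
    (((h2.mul h3).div h1 fun z hz => norm_ne_zero_iff.2 hz.1).prodMk h2)

/-- The state in the orbital plane spanned by `a` and `b` with given reduced state and with
position in the direction of `a`. -/
noncomputable def planarState (a b : E3) (p : ℝ × ℝ × ℝ) : E3 × E3 :=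
  (frame a b (planePos (p, 0)), frame a b (planeVel (p, 0)))

lemma planarState_eq (a b : E3) (p : ℝ × ℝ × ℝ) : planarState a b p =
    ((p.2.2 ^ 2 * p.1) • a, (p.2.1 / p.2.2) • a + (1 / (p.2.2 * p.1)) • b) := by
  simp [planarState, frame_apply, planePos_re, planePos_im, planeVel_re, planeVel_im]

lemma contDiffOn_planarState (a b : E3) :
    ContDiffOn ℝ ∞ (planarState a b) {p | p.1 ≠ 0 ∧ p.2.2 ≠ 0} := by
  have h1 : ∀ p ∈ {p : ℝ × ℝ × ℝ | p.1 ≠ 0 ∧ p.2.2 ≠ 0}, p.2.2 ≠ 0 := fun p hp => hp.2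
  have h2 : ∀ p ∈ {p : ℝ × ℝ × ℝ | p.1 ≠ 0 ∧ p.2.2 ≠ 0}, p.2.2 * p.1 ≠ 0 :=
    fun p hp => mul_ne_zero hp.2 hp.1
  have h3 : planarState a b = fun p =>
      ((p.2.2 ^ 2 * p.1) • a, (p.2.1 / p.2.2) • a + (1 / (p.2.2 * p.1)) • b) :=
    funext (planarState_eq a b)
  rw [h3]
  fun_prop (disch := assumption)

lemma toReduced_planarState {a b : E3} (ha : inner ℝ a a = (1 : ℝ)) (hb : inner ℝ b b = (1 : ℝ))
    (hab : inner ℝ a b = (0 : ℝ)) {p : ℝ × ℝ × ℝ} (hr : 0 < p.1) (hl : 0 < p.2.2) :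
    toReduced (planarState a b p) = p := by
  have h1 : ‖frame a b (planePos (p, 0))‖ = p.2.2 ^ 2 * p.1 := by
    rw [norm_frame ha hb hab, norm_planePos hr]
  have h2 : ‖angularMomentum (frame a b (planePos (p, 0))) (frame a b (planeVel (p, 0)))‖ =
      p.2.2 := by
    rw [angularMomentum_frame hr.ne' hl.ne', norm_smul, norm_cross_frame ha hb hab, mul_one]
    exact Real.norm_of_nonneg hl.le
  have h3 : inner ℝ (frame a b (planePos (p, 0))) (frame a b (planeVel (p, 0))) =
      p.2.2 * p.1 * p.2.1 := by
    rw [inner_frame ha hb hab, planePos_inner_planeVel hr.ne' hl.ne']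
  simp only [toReduced, planarState, h1, h2, h3]
  refine Prod.ext ?_ (Prod.ext ?_ rfl)
  · field_simp
  · field_simp

/-- The level sets of `|𝓔_∞|` form a smooth family. Locally `|𝓔_∞|` is the norm of the first
component of a limit chart of the reduced system, and it is a submersion since the states over the
curve `ε ↦ ((1 + ε) ω, l)` in the chart have `|𝓔_∞| = (1 + ε) |ω|`. -/
theorem isSmoothFamily_eccentricityLevelSet {δ : ℝ} (hδ : 0 < δ) :
    IsSmoothFamily 5 (Ioo (0 : ℝ) 1) (fun c => eccentricityLevelSet δ c) (fun _ => ∅) := by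
  refine ⟨fun c _ => empty_subset _, fun c₀ hc₀ z₀ hz₀ => ?_⟩
  have hreg : z₀ ∈ regularStates := ⟨hz₀.1, angularMomentum_ne_zero_of_mem hc₀.2 hz₀⟩
  have hI : ∀ c ∈ Ioo (0 : ℝ) 1, c ^ 2 / 2 ∈ Ico (0 : ℝ) (1 / 2) := fun c hc =>
    ⟨by positivity, by nlinarith [hc.1, hc.2]⟩
  have hp₀ := (mem_eccentricityLevelSet_iff hδ hc₀ hreg.1 hreg.2).1 hz₀
  obtain ⟨U, O, Ψ, G, hpU, hc⟩ := exists_isLimitChart hδ (hI _ hc₀) hp₀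
  have hph : ∀ z ∈ regularStates, toReduced z ∈ phaseSpace := fun z hz =>
    toReduced_mem_phaseSpace hz.1 hz.2
  have hl : ∀ z ∈ regularStates, 0 < (toReduced z).2.2 := fun z hz => norm_pos_iff.2 hz.2
  have hD₁ : IsOpen (regularStates ∩ toReduced ⁻¹' U) :=
    contDiffOn_toReduced.continuousOn.isOpen_inter_preimage isOpen_regularStates hc.isOpen_source
  have hGs : ContDiffOn ℝ ∞ (fun z => (G (toReduced z)).1) (regularStates ∩ toReduced ⁻¹' U) :=
    (hc.contDiffOn_interior.comp (contDiffOn_toReduced.mono inter_subset_left)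
      fun z hz => ⟨hz.2, hl z hz.1⟩).fst
  set R : Set (E3 × E3) := (regularStates ∩ toReduced ⁻¹' U) ∩
    (fun z => (G (toReduced z)).1) ⁻¹' {0}ᶜ with hR
  have hRo : IsOpen R := hGs.continuousOn.isOpen_inter_preimage hD₁ isOpen_compl_singleton
  have hF : ContDiffOn ℝ ∞ (fun z => ‖(G (toReduced z)).1‖) R :=
    (hGs.mono inter_subset_left).norm ℝ fun z hz => hz.2
  have hS : ∀ c ∈ Ioo (0 : ℝ) 1, ∀ z ∈ regularStates ∩ toReduced ⁻¹' U,
      z ∈ eccentricityLevelSet δ c ↔ ‖(G (toReduced z)).1‖ = c := fun c hcI z hz => by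
    rw [mem_eccentricityLevelSet_iff hδ hcI hz.1.1 hz.1.2,
      hc.mem_stableSet_iff _ ⟨hz.2, hph z hz.1⟩ _ (hI c hcI), mul_div_cancel₀ _ (two_ne_zero)]
    exact sq_eq_sq₀ (norm_nonneg _) hcI.1.le
  have hn₀ : ‖(G (toReduced z₀)).1‖ = c₀ := (hS c₀ hc₀ z₀ ⟨hreg, hpU⟩).1 hz₀
  have hz₀R : z₀ ∈ R := ⟨⟨hreg, hpU⟩, fun h => by
    have h1 : (G (toReduced z₀)).1 = 0 := h
    rw [h1, norm_zero] at hn₀; exact hc₀.1.ne hn₀⟩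
  refine exists_param_levelSet (by simp [Module.finrank_prod]) isOpen_Ioo hRo hF
    (fun c hcI z hz => hS c hcI z hz.1) hc₀ hz₀R fun hd => ?_
  obtain ⟨a, b, ha, hb, hab, hpos, hvel⟩ := exists_frame hreg.1 hreg.2
  obtain ⟨hGO, hG2, hΨG⟩ := hc.map_source _ ⟨hpU, hph z₀ hreg⟩
  have hG2pos : 0 < (G (toReduced z₀)).2 := lt_of_le_of_ne hG2 fun h =>
    (hl z₀ hreg).ne' ((hc.boundary_iff _ ⟨hpU, hph z₀ hreg⟩).1 h.symm)
  set y₀ := G (toReduced z₀) with hy₀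
  let y : ℝ → ℂ × ℝ := fun ε => ((1 + ε : ℝ) • y₀.1, y₀.2)
  have hy0 : y 0 = y₀ := by simp [y]
  have hyc : Continuous y := by fun_prop
  have hy' : DifferentiableAt ℝ y 0 := by fun_prop
  have hΨ : DifferentiableAt ℝ Ψ (y 0) := by
    rw [hy0]
    have hΨs : ContDiffOn ℝ ∞ Ψ (O ∩ {z | 0 < z.2}) := hc.contDiffOn_symm.mono fun z hz =>
      ⟨hz.1, show 0 ≤ z.2 from le_of_lt hz.2⟩
    refine (hΨs.contDiffAt ?_).differentiableAt (by simp)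
    exact (hc.isOpen_target.inter (isOpen_lt continuous_const continuous_snd)).mem_nhds
      ⟨hGO, hG2pos⟩
  have hΨ0 : Ψ (y 0) = toReduced z₀ := by rw [hy0, hΨG]
  have hlift : DifferentiableAt ℝ (planarState a b) (Ψ (y 0)) := by
    rw [hΨ0]
    refine ((contDiffOn_planarState a b).contDiffAt ?_).differentiableAt (by simp)
    refine IsOpen.mem_nhds ((isOpen_ne_fun continuous_fst continuous_const).inter
      (isOpen_ne_fun continuous_snd.snd continuous_const)) ⟨(hph z₀ hreg).1.ne', (hl z₀ hreg).ne'⟩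
  let σ : ℝ → E3 × E3 := fun ε => planarState a b (Ψ (y ε))
  have hσ : DifferentiableAt ℝ σ 0 :=
    DifferentiableAt.comp (g := planarState a b) (f := fun ε => Ψ (y ε)) 0 hlift (hΨ.comp 0 hy')
  have hσ0 : σ 0 = z₀ := by
    change planarState a b (Ψ (y 0)) = z₀
    rw [hΨ0]; exact Prod.ext hpos hvel
  have hFσ : HasDerivAt (fun ε => ‖(G (toReduced (σ ε))).1‖) 0 0 := by
    have h1 : HasFDerivAt (fun z => ‖(G (toReduced z)).1‖) (0 : E3 × E3 →L[ℝ] ℝ) (σ 0) := by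
      rw [hσ0, ← hd]
      exact ((hF.contDiffAt (hRo.mem_nhds hz₀R)).differentiableAt (by simp)).hasFDerivAt
    exact h1.comp_hasDerivAt 0 hσ.hasDerivAt
  have hev : (fun ε => ‖(G (toReduced (σ ε))).1‖) =ᶠ[𝓝 0] fun ε => (1 + ε) * c₀ := by
    have h1 : ∀ᶠ ε in 𝓝 (0 : ℝ), y ε ∈ O :=
      hyc.continuousAt.eventually (hc.isOpen_target.mem_nhds (hy0 ▸ hGO))
    filter_upwards [h1, Ioi_mem_nhds (show (-1 : ℝ) < 0 by norm_num)] with ε hε hε1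
    obtain ⟨h2, h3⟩ := hc.map_target (y ε) hε hG2pos.le
    have h4 : 0 < (Ψ (y ε)).2.2 := lt_of_le_of_ne h2.2.2 fun h => by
      have := (hc.boundary_iff _ h2).2 h.symm
      rw [h3] at this
      exact hG2pos.ne' this
    have h5 : (0 : ℝ) ≤ 1 + ε := by simp only [mem_Ioi] at hε1; linarith
    simp only [σ]
    rw [toReduced_planarState ha hb hab h2.2.1 h4, h3, norm_smul, hn₀, Real.norm_of_nonneg h5]
  have hder : HasDerivAt (fun ε : ℝ => (1 + ε) * c₀) c₀ 0 := by
    simpa using ((hasDerivAt_id' (0 : ℝ)).const_add 1).mul_const c₀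
  exact hc₀.1.ne ((hFσ.congr_of_eventuallyEq hev.symm).unique hder)

end LevelSets

end KeplerDrag

theorem theorem2p4 (δ : ℝ) (hδ : 0 < δ) :
    IsSmoothSubmanifold 1 (stableSet δ {q₁}) {q₁} ∧
    (∀ h ∈ Set.Ioo (0 : ℝ) (1 / 2), IsSmoothSubmanifold 2 (stableSet δ (Γ₁ h)) (Γ₁ h)) ∧
    IsSmoothFamily 2 (Set.Ioo (0 : ℝ) (1 / 2)) (fun h => stableSet δ (Γ₁ h)) Γ₁ ∧
    (∀ c ∈ Set.Ioo (0 : ℝ) 1, IsSmoothSubmanifold 5 (eccentricityLevelSet δ c) ∅) ∧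
    IsSmoothFamily 5 (Set.Ioo (0 : ℝ) 1) (fun c => eccentricityLevelSet δ c) (fun _ => ∅) := by
  have h1 := isSmoothFamily_stableSet hδ
  have h2 : IsSmoothFamily 5 (Set.Ioo (0 : ℝ) 1) (fun c => eccentricityLevelSet δ c)
      (fun _ => ∅) := isSmoothFamily_eccentricityLevelSet hδ
  exact ⟨isSmoothSubmanifold_stableSet_q₁ hδ, fun h hh => h1.isSmoothSubmanifold hh, h1,
    fun c hc => h2.isSmoothSubmanifold hc, h2⟩
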